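/- **Definitions.** For a group $G$, let $\mathrm{cl}(g)\in\mathbb N\cup\{\infty\}$ be the least number of commutators whose product is $g$, let $\mathrm{cl}(g_1+\cdots+g_m)$ be the least commutator length of a product of conjugates of $g_1,\dots,g_m$, and let $\mathrm{scl}(g_1+\cdots+g_m)=\lim_{n\to\infty}\mathrm{cl}(g_1^n+\cdots+g_m^n)/n$. Let $B_1(G)$ be the space of real group $1$-boundaries, $H\subset B_1(G)$ the subspace spanned by all $g^n-ng$ ($n\in\mathbb Z$) and $g-hgh^{-1}$, and $B_1^H=B_1/H$. On $B_1^H$, $\mathrm{scl}$ denotes the unique pseudo-norm that agrees with the above limit on all sums $g_1+\cdots+g_m\in B_1$. A point of $B_1^H$ is rational if it is represented by an element of $B_1$ with rational coefficients; a finite-dimensional rational subspace of $B_1^H$ is one spanned by finitely many rational points; a linear functional on such a subspace is rational if it takes rational values at its rational points. Let $X$ be a connected CW complex with $\pi_1(X)=G$, and let $C=\sum_i q_ig_i\in B_1$ with $q_i\in\mathbb Q$, where $g_i$ is represented by a loop $\gamma_i$ in $X$. A map $f:S\to X$ of a compact oriented surface (possibly disconnected, and possibly empty, which can only occur when all $q_i=0$)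 rationally bounds $C$ if every boundary component of $S$ wraps around one of the $\gamma_i$ with some integer degree and, for some integer $n(S)>0$, the total degree of $\partial S$ over $\gamma_i$ is $n(S)q_i$ for each $i$. It is extremal if moreover $S$ has no disk or closed components and $\mathrm{scl}(C)=-\chi^-(S)/2n(S)$, where $\chi^-(S)$ is the sum of $\min(0,\chi(S_j))$ over the components $S_j$ of $S$. **Theorem (Rationality Theorem).** Let $F$ be a free group. The pseudo-norm $\mathrm{scl}$ on $B_1^H(F)$ is well defined, and: 1. For every $g\in[F,F]$, $\mathrm{scl}(g)=\lim_{n\to\infty}\mathrm{cl}(g^n)/n$ is rational. 2. Every $g\in[F,F]$, and more generally every rational chain $C=\sum_i q_ig_i$ in $B_1(F)$, rationally bounds an extremal surface. 3. $\mathrm{scl}$ is piecewise rational linear on $B_1^H(F)$: every finite-dimensional rational subspace $L$ is a finite union of rational polyhedral cones on each of which $\mathrm{scl}$ agrees with a rational linear functional on $L$. In particular $\{x\in L:\mathrm{scl}(x)\le 1\}$ is a finite-sided rational polyhedron. 4. There is an algorithm that computes $\mathrm{scl}$ on any finite-dimensional rational subspace of $B_1^H(F)$: there is one computable function, for all free groups,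 which takes rational chains $C_1,\dots,C_k\in B_1(F)$, written as rational combinations of words in (numbered) free generators, to a finite list of vectors $y\in\mathbb Q^k$ such that $\mathrm{scl}(\sum_j t_jC_j)=\max_y\sum_j y_jt_j$ for all $t\in\mathbb R^k$. -/

import Mathlib

open scoped ENNReal Topology commutatorElement
open Filter

universe u v

noncomputable section

namespace StableCommutatorLength

section Chains

variable (G : Type u) [Group G]

/-- The boundary map from real group 2-chains to real group 1-chains (inhomogeneous bar complex
with trivial real coefficients): `∂ (g, h) = g - gh + h`. -/
def boundaryMap : (G × G →₀ ℝ) →ₗ[ℝ] (G →₀ ℝ) :=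
  Finsupp.lsum ℝ fun p : G × G =>
    Finsupp.lsingle p.1 - Finsupp.lsingle (p.1 * p.2) + Finsupp.lsingle p.2

/-- Real group 1-boundaries. -/
def B1 : Submodule ℝ (G →₀ ℝ) := LinearMap.range (boundaryMap G)

/-- The subspace `H` spanned by all `g ^ n - n g` (with `n` an integer) and `g - h g h⁻¹`. -/
def homogeneousRelations : Submodule ℝ (G →₀ ℝ) :=
  Submodule.span ℝ
    ({c | ∃ (g : G) (n : ℤ), c = Finsupp.single (g ^ n) 1 - (n : ℝ) • Finsupp.single g 1} ∪
     {c | ∃ g h : G, c = Finsupp.single g 1 - Finsupp.single (h * g * h⁻¹) 1})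

/-- The space `B₁ / H` of homogenized real 1-boundaries, as a subspace of `C₁ / H`
(note that `H` is contained in `B₁`). -/
def B1H : Submodule ℝ ((G →₀ ℝ) ⧸ homogeneousRelations G) :=
  (B1 G).map (homogeneousRelations G).mkQ

variable {G}

/-- The class in `B₁ / H` of a chain that is a boundary. -/
def toB1H (c : G →₀ ℝ) (hc : c ∈ B1 G) : B1H G :=
  ⟨(homogeneousRelations G).mkQ c, Submodule.mem_map_of_mem hc⟩

/-- The chain `g₁ + ⋯ + gₘ` of a list of group elements. -/
def sumChain (l : List G) : G →₀ ℝ := (l.map fun g => Finsupp.single g (1 : ℝ)).sum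

/-- The chain `∑ qᵢ gᵢ`. -/
def ratChain {m : ℕ} (g : Fin m → G) (q : Fin m → ℚ) : G →₀ ℝ :=
  ∑ i, Finsupp.single (g i) (q i : ℝ)

end Chains

section Scl

variable {G : Type u} [Group G]

/-- Commutator length: the least number of commutators whose product is `g`
(`⊤` if there is no such product). -/
def cl (g : G) : ℕ∞ :=
  ⨅ (l : List (G × G)) (_ : (l.map fun p => ⁅p.1, p.2⁆).prod = g), (l.length : ℕ∞)

/-- `cl (g₁ + ⋯ + gₘ)`: the least commutator length of a product of conjugates of the `gᵢ`. -/
def clSum (l : List G) : ℕ∞ :=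
  ⨅ (l' : List G) (_ : List.Forall₂ IsConj l l'), cl l'.prod

/-- `scl (g₁ + ⋯ + gₘ)`: the limit of `cl (g₁ⁿ + ⋯ + gₘⁿ) / n`, as an extended real number. -/
def sclSum (l : List G) : ℝ≥0∞ :=
  liminf (fun n : ℕ => (clSum (l.map (· ^ n)) : ℝ≥0∞) / (n : ℝ≥0∞)) atTop

/-- Stable commutator length on `B₁ / H`: the extension of `scl (g₁ + ⋯ + gₘ)` to real chains.
It is the largest pseudo-norm bounded by `sclSum` on the sums `g₁ + ⋯ + gₘ` that are boundaries,
written out as an infimum over all real combinations of such sums. -/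
def scl (c : B1H G) : ℝ :=
  sInf {s : ℝ | ∃ (k : ℕ) (r : Fin k → ℝ) (l : Fin k → List G)
    (hl : ∀ j, sumChain (l j) ∈ B1 G),
    ∑ j, r j • toB1H (sumChain (l j)) (hl j) = c ∧
    s = ∑ j, |r j| * (sclSum (l j)).toReal}

end Scl

section Surfaces

/-- A compact oriented surface (possibly disconnected or empty, possibly with boundary), presented
by gluing oriented polygons along their sides. `Dart` is the set of all sides of all polygons, each
with the orientation of the boundary of its polygon; `face` sends a side to the next side of
the same polygon. A side `d` with `glue d = d` is left free and lies in the boundary of the surface;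
any other side `d` is glued to the side `glue d` with the opposite orientation. -/
structure PolygonalSurface where
  Dart : Type
  [fintypeDart : Fintype Dart]
  face : Equiv.Perm Dart
  glue : Equiv.Perm Dart
  glue_glue : ∀ d, glue (glue d) = d

namespace PolygonalSurface

attribute [instance] fintypeDart

variable (S : PolygonalSurface)

/-- Vertices: a vertex is represented by the sides starting at it. If `d` is glued to `glue d`,
the start of `d` is the end of `glue d`, hence the start of `face (glue d)`. -/
def Vertex : Type := Quot fun d e : S.Dart => S.glue d ≠ d ∧ e = S.face (S.glue d)

/-- Edges. -/
def Edge : Type := Quot fun d e : S.Dart => e = S.glue d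

/-- Faces, that is, the polygons. -/
def Face : Type := Quot fun d e : S.Dart => e = S.face d

/-- Connected components. -/
def Component : Type := Quot fun d e : S.Dart => e = S.face d ∨ e = S.glue d

/-- The component containing a side. -/
def component (d : S.Dart) : S.Component := Quot.mk _ d

instance : Finite S.Component := inferInstanceAs (Finite (Quot _))

instance : Fintype S.Component := Fintype.ofFinite _

/-- The Euler characteristic of a component: vertices minus edges plus faces. -/
def chi (c : S.Component) : ℤ :=
  (Nat.card {x : S.Vertex // ∃ d, Quot.mk _ d = x ∧ S.component d = c} : ℤ)
    - (Nat.card {x : S.Edge // ∃ d, Quot.mk _ d = x ∧ S.component d = c} : ℤ)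
    + (Nat.card {x : S.Face // ∃ d, Quot.mk _ d = x ∧ S.component d = c} : ℤ)

/-- `χ⁻(S)`: the sum of `min (0, χ)` over all components. -/
def chiMinus : ℤ := ∑ c : S.Component, min 0 (S.chi c)

/-- The free sides. -/
def BoundaryDart : Type := {d : S.Dart // S.glue d = d}

/-- A component is closed if it has empty boundary. -/
def IsClosedComponent (c : S.Component) : Prop :=
  ∀ d : S.Dart, S.component d = c → S.glue d ≠ d

/-- A component is a disk: among connected compact oriented surfaces, disks are exactly those
of Euler characteristic one. -/
def IsDiskComponent (c : S.Component) : Prop := S.chi c = 1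

/-- Walking along the boundary: starting from a free side `d`, the iterates of this permutation
turn around the end of `d` through glued sides (which start there) until they reach the next
free side, and so on. -/
def walk : Equiv.Perm S.Dart := S.face * S.glue

/-- Boundary components: orbits of free sides under the boundary walk. -/
def BoundaryComponent : Type :=
  Quot fun d e : S.BoundaryDart => S.walk.SameCycle d.1 e.1

/-- The boundary component containing a free side. -/
def boundaryComponent (d : S.BoundaryDart) : S.BoundaryComponent := Quot.mk _ d

instance : Finite S.BoundaryDart := inferInstanceAs (Finite {d : S.Dart // S.glue d = d})

instance : Finite S.BoundaryComponent := inferInstanceAs (Finite (Quot _))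

instance : Fintype S.BoundaryComponent := Fintype.ofFinite _

end PolygonalSurface

/-- A map, up to homotopy, from the surface `S` to a connected complex `X` with fundamental
group `G` : all vertices are sent to the base point, each side to a loop with class `label d`,
glued sides to inverse loops, and the boundary of each polygon to a null-homotopic loop. -/
structure SurfaceMap (S : PolygonalSurface) (G : Type u) [Group G] where
  label : S.Dart → G
  label_glue : ∀ d, S.glue d ≠ d → label (S.glue d) = (label d)⁻¹
  face_prod : ∀ d, ((List.range (Function.minimalPeriod S.face d)).map
    fun i => label ((S.face ^ i) d)).prod = 1

section Maps

variable {S : PolygonalSurface} {G : Type u} [Group G]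

open Classical in
/-- The class of the image of the boundary component through the free side `d`, read from `d` on:
the product of the labels of its free sides in their cyclic order. -/
def SurfaceMap.boundaryClass (f : SurfaceMap S G) (d : S.BoundaryDart) : G :=
  ((List.range (Function.minimalPeriod S.walk d.1)).map fun i =>
    if S.glue ((S.walk ^ i) d.1) = (S.walk ^ i) d.1 then f.label ((S.walk ^ i) d.1) else 1).prod

/-- `f : S → X` rationally bounds the chain `∑ qᵢ gᵢ` with degree `n > 0` : every boundary
component wraps around one of the loops `gᵢ` with some integer degree, and for each `i` the
total degree with which the boundary of `S` wraps around `gᵢ` is `n qᵢ`. -/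
def RationallyBounds (f : SurfaceMap S G) {m : ℕ} (g : Fin m → G) (q : Fin m → ℚ) (n : ℕ) :
    Prop :=
  0 < n ∧ ∃ (target : S.BoundaryComponent → Fin m) (deg : S.BoundaryComponent → ℤ),
    (∀ d : S.BoundaryDart, IsConj (f.boundaryClass d)
      (g (target (S.boundaryComponent d)) ^ deg (S.boundaryComponent d))) ∧
    ∀ i, ((∑ b with target b = i, deg b : ℤ) : ℚ) = n * q i

/-- `f : S → X` is an extremal surface for the boundary `∑ qᵢ gᵢ` : it rationally bounds the
chain with some degree `n`, has no disk or closed components, and `scl` of the chain is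
`-χ⁻(S) / 2n`. -/
def IsExtremal (f : SurfaceMap S G) {m : ℕ} (g : Fin m → G) (q : Fin m → ℚ)
    (h : ratChain g q ∈ B1 G) : Prop :=
  ∃ n : ℕ, RationallyBounds f g q n ∧
    (∀ c : S.Component, ¬ S.IsDiskComponent c ∧ ¬ S.IsClosedComponent c) ∧
    scl (toB1H (ratChain g q) h) = -(S.chiMinus : ℝ) / (2 * n)

end Maps

end Surfaces

section RationalStructure

variable {G : Type u} [Group G]

/-- Rational points of `B₁ / H` : classes of boundaries with rational coefficients. -/
def IsRationalPoint (x : B1H G) : Prop :=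
  ∃ (c : G →₀ ℝ) (hc : c ∈ B1 G), (∀ g, ∃ q : ℚ, c g = q) ∧ toB1H c hc = x

/-- Finite-dimensional rational subspaces: those spanned by finitely many rational points. -/
def IsFiniteRationalSubspace (L : Submodule ℝ (B1H G)) : Prop :=
  ∃ T : Set (B1H G), T.Finite ∧ (∀ x ∈ T, IsRationalPoint x) ∧ Submodule.span ℝ T = L

/-- Rational linear functionals on `L` : rational values at all rational points. -/
def IsRationalFunctional {L : Submodule ℝ (B1H G)} (φ : L →ₗ[ℝ] ℝ) : Prop :=
  ∀ x : L, IsRationalPoint (x : B1H G) → ∃ q : ℚ, φ x = q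

/-- Finite-sided rational polyhedra in `L`. -/
def IsRationalPolyhedron {L : Submodule ℝ (B1H G)} (P : Set L) : Prop :=
  ∃ A : Set ((L →ₗ[ℝ] ℝ) × ℚ), A.Finite ∧ (∀ a ∈ A, IsRationalFunctional a.1) ∧
    P = {x | ∀ a ∈ A, a.1 x ≤ (a.2 : ℝ)}

/-- Finite-sided rational polyhedral cones in `L`. -/
def IsRationalCone {L : Submodule ℝ (B1H G)} (P : Set L) : Prop :=
  ∃ A : Set (L →ₗ[ℝ] ℝ), A.Finite ∧ (∀ φ ∈ A, IsRationalFunctional φ) ∧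
    P = {x | ∀ φ ∈ A, φ x ≤ 0}

/-- `f` is piecewise rational linear on `L` : finitely many rational polyhedral cones cover `L`,
and on each of them `f` agrees with a rational linear functional. -/
def IsPiecewiseRationalLinear {L : Submodule ℝ (B1H G)} (f : L → ℝ) : Prop :=
  ∃ Ps : Set (Set L), Ps.Finite ∧ (∀ P ∈ Ps, IsRationalCone P) ∧ ⋃₀ Ps = Set.univ ∧
    ∀ P ∈ Ps, ∃ φ : L →ₗ[ℝ] ℝ, IsRationalFunctional φ ∧ ∀ x ∈ P, f x = φ x

end RationalStructure

section Algorithm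

/-- Codes for rational numbers: `(a, b)` stands for `a / (b + 1)`. -/
abbrev Frac : Type := ℤ × ℕ

/-- The rational number with a given code. -/
def Frac.val (p : Frac) : ℚ := p.1 / (p.2 + 1)

/-- Group words in letters from `ι`: `(i, true)` is the generator `i`, `(i, false)` its inverse. -/
abbrev Word (ι : Type v) : Type v := List (ι × Bool)

/-- Formal rational combinations of words. -/
abbrev FormalChain (ι : Type v) : Type v := List (Frac × Word ι)

/-- Relabelling of the letters. -/
def FormalChain.relabel {ι : Type v} (name : ι → ℕ) (c : FormalChain ι) : FormalChain ℕ :=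
  c.map fun p => (p.1, p.2.map fun a => (name a.1, a.2))

/-- The letters that occur in a list of formal chains. -/
def letters {ι : Type v} (C : List (FormalChain ι)) : Set ι :=
  {i | ∃ c ∈ C, ∃ p ∈ c, ∃ a ∈ p.2, a.1 = i}

variable {ι : Type v} {F : Type u} [Group F]

/-- The group element spelled by a word in a free basis. -/
def evalWord (b : FreeGroupBasis ι F) (w : Word ι) : F :=
  (w.map fun a => if a.2 then b a.1 else (b a.1)⁻¹).prod

/-- The group 1-chain described by a formal chain. -/
def evalChain (b : FreeGroupBasis ι F) (c : FormalChain ι) : F →₀ ℝ :=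
  (c.map fun p => Finsupp.single (evalWord b p.2) (p.1.val : ℝ)).sum

/-- A list `out` of rational vectors, read as linear functionals in the parameters `t`, computes
`scl` on the subspace spanned by the chains in `C` : for all real `t` the number `scl (∑ tⱼ Cⱼ)` is
the largest value at `t` of a functional in the list. -/
def ComputesScl (b : FreeGroupBasis ι F) (C : List (FormalChain ι))
    (hC : ∀ j : Fin C.length, evalChain b (C.get j) ∈ B1 F) (out : List (List Frac)) : Prop :=
  (∀ y ∈ out, y.length = C.length) ∧
  ∀ t : Fin C.length → ℝ,
    IsGreatest {s : ℝ | ∃ y ∈ out, s = ∑ j : Fin C.length, ((y.getD j (0, 0)).val : ℝ) * t j}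
      (scl (∑ j, t j • toB1H (evalChain b (C.get j)) (hC j)))

end Algorithm

end StableCommutatorLength

end

open StableCommutatorLength

/-! In a free group, stable commutator length is the optimal value of a rational linear program. A
surface bounded by powers of cyclically reduced words is cut into tiles: a rectangle runs between
two inverse letters, and a triangle has its corners at the starting points of three letters. A
tiling only records how many tiles of each kind are used, and its main constraint is that every type
`(u, v)` of interior side occurs as often as the reversed type `(v, u)`. Each glued side counts -1/2
in the Euler characteristic of its tile, so a rectangle contributes 0 and a triangle -1/2, and a
surface with t triangles has -χ/2 = t/4. The claim behind everything is that scl is a quarter of the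
least number of triangles in a rational tiling with the prescribed degrees.

Upper bound: the tiles of an integral tiling are glued one pair of sides at a time while the scl of
the boundary is tracked (`IsPatchwork.sclLE`, `IsTiling.sclLE`). The rules are that merging or
splitting elements costs 1/2, the value of a pair of pants (`SclLE.merge`, `SclLE.split`); discs
need separate treatment.

Lower bound: if a product of conjugates of n-th powers is a product of k commutators, then the
concatenated word folds onto a graph of rank 2k + O(1) (`folding_of_commProd`,
`folding_of_conjProd`). The polygons dual to its vertices are triangulated and yield a tiling with
4k + O(1) triangles (`exists_isTiling_of_bounds`). The error depends on the number of words but not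
on n, so it disappears in the limit.

Fourier–Motzkin elimination solves the program with parameters (`lowerBounds_spec`): scl on a finite
family is a maximum of finitely many rational linear functionals (`exists_hasScl_of_words`). This
gives rationality and piecewise linearity, and an algorithm because the elimination is primitive
recursive. The maximizing functional is also a dual certificate: it is at most scl on every sum and
vanishes on `H`, so the infimum defining the pseudo-norm cannot fall below the limit
(`scl_sumChain`). Real coefficients follow from rational ones by continuity (`isGreatest_of_rat`).

Finally, an optimal solution with cleared denominators, taken twice, is glued to an actual surface
whose χ is minus the number of triangles of one copy (`exists_surface_of_isTiling`); by optimality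
this surface is extremal (`exists_isExtremal`). -/

namespace StableCommutatorLength

/-! ### Commutator length of formal sums, and its behaviour under cutting and gluing -/

section Filling

variable {G : Type u} [Group G]

/-- `g` is a product of at most `k` commutators. -/
def CommProd (k : ℕ) (g : G) : Prop :=
  ∃ l : List (G × G), l.length ≤ k ∧ (l.map fun p => ⁅p.1, p.2⁆).prod = g

theorem CommProd.one : CommProd 0 (1 : G) := ⟨[], by simp, by simp⟩

theorem CommProd.comm (a b : G) : CommProd 1 ⁅a, b⁆ := ⟨[(a, b)], by simp, by simp⟩

theorem CommProd.mul {j k : ℕ} {g h : G} (hg : CommProd j g) (hh : CommProd k h) :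
    CommProd (j + k) (g * h) := by
  obtain ⟨l, hl, rfl⟩ := hg
  obtain ⟨l', hl', rfl⟩ := hh
  exact ⟨l ++ l', by simp; omega, by simp⟩

theorem CommProd.mono {j k : ℕ} {g : G} (hg : CommProd j g) (h : j ≤ k) : CommProd k g := by
  obtain ⟨l, hl, rfl⟩ := hg
  exact ⟨l, hl.trans h, rfl⟩

theorem CommProd.map {H : Type*} [Group H] (f : G →* H) {k : ℕ} {g : G} (hg : CommProd k g) :
    CommProd k (f g) := by
  obtain ⟨l, hl, rfl⟩ := hg
  refine ⟨l.map fun p => (f p.1, f p.2), by simpa, ?_⟩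
  simp [map_list_prod, Function.comp_def, map_commutatorElement]

theorem CommProd.conj {k : ℕ} {g : G} (hg : CommProd k g) (u : G) : CommProd k (u * g * u⁻¹) := by
  simpa using hg.map (MulAut.conj u).toMonoidHom

theorem exists_commProd {g : G} (hg : g ∈ commutator G) : ∃ k, CommProd k g := by
  rw [commutator_eq_closure] at hg
  induction hg using Subgroup.closure_induction with
  | mem x hx => obtain ⟨a, b, rfl⟩ := hx; exact ⟨1, .comm a b⟩
  | one => exact ⟨0, .one⟩
  | mul x y _ _ hx hy =>
    obtain ⟨j, hj⟩ := hx
    obtain ⟨k, hk⟩ := hy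
    exact ⟨_, hj.mul hk⟩
  | inv x _ hx =>
    obtain ⟨j, l, hl, rfl⟩ := hx
    refine ⟨j, (l.map fun p => (p.2, p.1)).reverse, by simpa, ?_⟩
    rw [List.prod_inv_reverse]
    simp [Function.comp_def, commutatorElement_inv]

theorem cl_le_iff {g : G} {k : ℕ} : cl g ≤ k ↔ CommProd k g := by
  constructor
  · intro h
    have : cl g < ((k + 1 : ℕ) : ℕ∞) := lt_of_le_of_lt h (by exact_mod_cast Nat.lt_succ_self k)
    simp only [cl, iInf_lt_iff] at this
    obtain ⟨l, hl, hlt⟩ := this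
    exact ⟨l, by have : l.length < k + 1 := by exact_mod_cast hlt
                 omega, hl⟩
  · rintro ⟨l, hl, hg⟩
    exact (iInf₂_le l hg).trans (by exact_mod_cast hl)

/-- `g` is a product of conjugates of the entries of `l`. -/
def ConjProd (l : List G) (g : G) : Prop := ∃ l', List.Forall₂ IsConj l l' ∧ l'.prod = g

theorem conjProd_nil {g : G} : ConjProd [] g ↔ g = 1 := by
  simp [ConjProd, eq_comm]

theorem conjProd_cons {a : G} {l : List G} {g : G} :
    ConjProd (a :: l) g ↔ ∃ u h, ConjProd l h ∧ g = u * a * u⁻¹ * h := by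
  constructor
  · rintro ⟨l', hl, rfl⟩
    obtain ⟨b, l'', hb, hl', rfl⟩ := List.forall₂_cons_left_iff.1 hl
    obtain ⟨u, rfl⟩ := isConj_iff.1 hb
    exact ⟨u, _, ⟨l'', hl', rfl⟩, by simp⟩
  · rintro ⟨u, h, ⟨l', hl, rfl⟩, rfl⟩
    exact ⟨u * a * u⁻¹ :: l', List.Forall₂.cons (isConj_iff.2 ⟨u, rfl⟩) hl, by simp⟩

theorem ConjProd.append {l l' : List G} {g h : G} (hl : ConjProd l g) (hl' : ConjProd l' h) :
    ConjProd (l ++ l') (g * h) := by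
  obtain ⟨m, hm, rfl⟩ := hl
  obtain ⟨m', hm', rfl⟩ := hl'
  exact ⟨m ++ m', List.rel_append hm hm', by simp⟩

theorem ConjProd.perm {l l' : List G} (p : l.Perm l') {g : G} (h : ConjProd l g) :
    ConjProd l' g := by
  induction p generalizing g with
  | nil => exact h
  | cons a _ ih =>
    obtain ⟨u, h', hl, rfl⟩ := conjProd_cons.1 h
    exact conjProd_cons.2 ⟨u, h', ih hl, rfl⟩
  | swap a b l =>
    obtain ⟨u, h', hl, rfl⟩ := conjProd_cons.1 h
    obtain ⟨v, h'', hl', rfl⟩ := conjProd_cons.1 hl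
    exact conjProd_cons.2 ⟨(u * b * u⁻¹) * v, _, conjProd_cons.2 ⟨u, h'', hl', rfl⟩, by group⟩
  | trans _ _ ih₁ ih₂ => exact ih₂ (ih₁ h)

theorem clSum_le_iff {l : List G} {k : ℕ} :
    clSum l ≤ k ↔ ∃ g, ConjProd l g ∧ CommProd k g := by
  constructor
  · intro h
    have : clSum l < ((k + 1 : ℕ) : ℕ∞) := lt_of_le_of_lt h (by exact_mod_cast Nat.lt_succ_self k)
    simp only [clSum, iInf_lt_iff] at this
    obtain ⟨l', hl, hlt⟩ := this
    refine ⟨_, ⟨l', hl, rfl⟩, cl_le_iff.1 (Order.le_of_lt_add_one ?_)⟩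
    exact_mod_cast hlt
  · rintro ⟨g, ⟨l', hl, rfl⟩, hg⟩
    exact (iInf₂_le l' hl).trans (cl_le_iff.2 hg)

/-- Some product of conjugates of the elements of `m` is a product of at most `k` commutators. -/
def Bounds (k : ℕ) (m : Multiset G) : Prop :=
  ∃ l : List G, (l : Multiset G) = m ∧ ∃ g, ConjProd l g ∧ CommProd k g

theorem bounds_coe {k : ℕ} {l : List G} : Bounds k (l : Multiset G) ↔ clSum l ≤ k := by
  rw [clSum_le_iff]
  constructor
  · rintro ⟨l', hl', g, hg, hk⟩
    exact ⟨g, hg.perm (Multiset.coe_eq_coe.1 hl'), hk⟩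
  · rintro ⟨g, hg, hk⟩
    exact ⟨l, rfl, g, hg, hk⟩

theorem bounds_cons {k : ℕ} {a : G} {m : Multiset G} :
    Bounds k (a ::ₘ m) ↔ ∃ l : List G, (l : Multiset G) = m ∧ ∃ u h, ConjProd l h ∧
      CommProd k (u * a * u⁻¹ * h) := by
  constructor
  · intro h
    obtain ⟨l, rfl⟩ := Quot.exists_rep m
    refine ⟨l, rfl, ?_⟩
    obtain ⟨l', hl', g, hg, hk⟩ := h
    have := hg.perm (Multiset.coe_eq_coe.1 (hl'.trans (Multiset.cons_coe a l)))
    obtain ⟨u, h, hl, rfl⟩ := conjProd_cons.1 this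
    exact ⟨u, h, hl, hk⟩
  · rintro ⟨l, rfl, u, h, hl, hk⟩
    exact ⟨a :: l, by simp, _, conjProd_cons.2 ⟨u, h, hl, rfl⟩, hk⟩

theorem Bounds.zero : Bounds 0 (0 : Multiset G) := ⟨[], by simp, 1, by simp [conjProd_nil], .one⟩

theorem Bounds.mono {j k : ℕ} {m : Multiset G} (h : Bounds j m) (hjk : j ≤ k) : Bounds k m := by
  obtain ⟨l, hl, g, hg, hk⟩ := h
  exact ⟨l, hl, g, hg, hk.mono hjk⟩

theorem Bounds.add {j k : ℕ} {m m' : Multiset G} (h : Bounds j m) (h' : Bounds k m') :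
    Bounds (j + k) (m + m') := by
  obtain ⟨l, rfl, g, hg, hk⟩ := h
  obtain ⟨l', rfl, g', hg', hk'⟩ := h'
  exact ⟨l ++ l', by simp, _, hg.append hg', hk.mul hk'⟩

theorem Bounds.conj {k : ℕ} {a b : G} {m : Multiset G} (h : Bounds k (a ::ₘ m)) (hab : IsConj a b) :
    Bounds k (b ::ₘ m) := by
  obtain ⟨v, rfl⟩ := isConj_iff.1 hab
  obtain ⟨l, rfl, u, h, hl, hk⟩ := bounds_cons.1 h
  exact bounds_cons.2 ⟨l, rfl, u * v⁻¹, h, hl, by simpa [mul_assoc] using hk⟩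

/-- Splitting is free: a conjugate of `a * b` is already a product of conjugates of `a` and of `b`,
by the same element. -/
theorem Bounds.split {k : ℕ} {a b : G} {m : Multiset G} (h : Bounds k (a * b ::ₘ m)) :
    Bounds k (a ::ₘ b ::ₘ m) := by
  obtain ⟨l, rfl, u, h, hl, hk⟩ := bounds_cons.1 h
  refine bounds_cons.2 ⟨b :: l, by simp, u, u * b * u⁻¹ * h, conjProd_cons.2 ⟨u, h, hl, rfl⟩, ?_⟩
  simpa [mul_assoc] using hk

/-- The conjugators of `a` and `b` may differ. One commutator replaces the second by the first,
after which the two conjugates form a conjugate of `a * b`. This crude unit price is only paid where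
the number of merges stays bounded as the exponents grow. -/
theorem Bounds.merge {k : ℕ} {a b : G} {m : Multiset G} (h : Bounds k (a ::ₘ b ::ₘ m)) :
    Bounds (k + 1) (a * b ::ₘ m) := by
  obtain ⟨l, hl', u, h, hl, hk⟩ := bounds_cons.1 h
  obtain ⟨l₁, rfl⟩ := Quot.exists_rep m
  obtain ⟨v, h₁, hl₁, rfl⟩ := conjProd_cons.1
    (hl.perm (Multiset.coe_eq_coe.1 (hl'.trans (Multiset.cons_coe b l₁))))
  refine bounds_cons.2 ⟨l₁, rfl, u, h₁, hl₁, ?_⟩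
  have := ((CommProd.comm (u * v⁻¹) (v * b * v⁻¹)).conj (u * a * u⁻¹)).mul hk
  rw [add_comm] at this
  convert this using 1
  simp only [commutatorElement_def]
  group

theorem bounds_one_cons {k : ℕ} {m : Multiset G} : Bounds k (1 ::ₘ m) ↔ Bounds k m := by
  rw [bounds_cons]
  constructor
  · rintro ⟨l, rfl, u, h, hl, hk⟩
    exact ⟨l, rfl, h, hl, by simpa using hk⟩
  · rintro ⟨l, rfl, h, hl, hk⟩
    exact ⟨l, rfl, 1, h, hl, by simpa using hk⟩

theorem Bounds.cons_inv {k : ℕ} {m : Multiset G} (h : Bounds k m) (a : G) :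
    Bounds k (a ::ₘ a⁻¹ ::ₘ m) := by
  apply Bounds.split
  simpa [bounds_one_cons]

theorem Bounds.of_cons_inv {k : ℕ} {m : Multiset G} {a : G} (h : Bounds k (a ::ₘ a⁻¹ ::ₘ m)) :
    Bounds (k + 1) m := by
  simpa [bounds_one_cons] using h.merge

theorem Bounds.of_pow {k n : ℕ} {a : G} {m : Multiset G} (h : Bounds k (a ^ n ::ₘ m)) :
    Bounds k (Multiset.replicate n a + m) := by
  induction n generalizing m with
  | zero => simpa [bounds_one_cons] using h
  | succ n ih =>
    rw [pow_succ] at h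
    have := ih h.split
    rwa [Multiset.add_cons, ← Multiset.cons_add, ← Multiset.replicate_succ] at this

theorem Bounds.pow {k n : ℕ} {a : G} {m : Multiset G} (h : Bounds k (Multiset.replicate n a + m)) :
    Bounds (k + n) (a ^ n ::ₘ m) := by
  induction n generalizing m with
  | zero => simpa [bounds_one_cons] using h
  | succ n ih =>
    rw [Multiset.replicate_succ, Multiset.cons_add, ← Multiset.add_cons] at h
    rw [pow_succ]
    simpa [add_assoc] using (ih h).merge

/-- The price `n * card l` does not involve the elements themselves, so it stays the same when these
are replaced by high powers. `SclLE.of_nsmul` rests on this. -/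
theorem Bounds.map_pow {k n : ℕ} {l m : Multiset G} (h : Bounds k (n • l + m)) :
    Bounds (k + n * Multiset.card l) (l.map (· ^ n) + m) := by
  induction l using Multiset.induction generalizing m k with
  | empty => simpa using h
  | cons a l ih =>
    rw [Multiset.nsmul_cons, Multiset.nsmul_singleton, add_assoc] at h
    have := h.pow
    rw [← Multiset.add_cons] at this
    have := ih this
    rw [Multiset.map_cons, Multiset.cons_add, ← Multiset.add_cons, Multiset.card_cons]
    exact this.mono (by ring_nf; omega)

theorem Bounds.map_mul {k : ℕ} {ι : Type*} {s : Multiset ι} {f g : ι → G} {m : Multiset G}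
    (h : Bounds k (s.map f + s.map g + m)) :
    Bounds (k + Multiset.card s) (s.map (fun i => f i * g i) + m) := by
  induction s using Multiset.induction generalizing k m with
  | empty => simpa using h
  | cons a s ih =>
    have h' : Bounds k (f a ::ₘ g a ::ₘ (s.map f + s.map g + m)) := by
      convert h using 1
      rw [Multiset.map_cons, Multiset.map_cons]
      simp only [← Multiset.singleton_add]
      abel
    have := h'.merge
    rw [← Multiset.add_cons] at this
    have := ih this
    rw [Multiset.map_cons, Multiset.cons_add, ← Multiset.add_cons, Multiset.card_cons]
    exact this.mono (by omega)

section Pants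

variable (x y : G)

/-- The partial products of `x ^ i * y * x ^ (-i - 1)` over all, over odd and over even indices. -/
theorem commProd_reorder (e : ℕ → G) (k : ℕ) :
    CommProd k (((List.range (2 * k + 1)).map e).prod *
      (((List.range k).map fun i => e (2 * i + 1)).prod *
        ((List.range (k + 1)).map fun i => e (2 * i)).prod)⁻¹) := by
  induction k with
  | zero => simpa using CommProd.one
  | succ k ih =>
    set B := ((List.range k).map fun i => e (2 * i + 1)).prod
    set D := ((List.range (k + 1)).map fun i => e (2 * i)).prod with hD
    have h1 : ((List.range (2 * (k + 1) + 1)).map e).prod =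
        ((List.range (2 * k + 1)).map e).prod * e (2 * k + 1) * e (2 * k + 2) := by
      rw [show 2 * (k + 1) + 1 = 2 * k + 1 + 1 + 1 by ring, List.range_succ, List.range_succ]
      simp [mul_assoc]
    have h2 : ((List.range (k + 1 + 1)).map fun i => e (2 * i)).prod = D * e (2 * k + 2) := by
      rw [List.range_succ, List.map_append, List.prod_append, ← hD]
      simp [mul_add]
    have h3 : ((List.range (k + 1)).map fun i => e (2 * i + 1)).prod = B * e (2 * k + 1) := by
      rw [List.range_succ]
      simp [B]
    rw [h1, h2, h3]
    -- The new odd factor has to pass `D`, the product of the even factors so far. This takes one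
    -- commutator, conjugated by the odd factors `B` that stand in front.
    have := ih.mul ((CommProd.comm D (e (2 * k + 1))).conj B)
    convert this using 1
    simp only [commutatorElement_def]
    group

/-- The factors `x ^ i * y * (x ^ (i + 1))⁻¹` telescope in three ways: the product of all of them is
a power of `y` times a power of `x`, while those of odd index, and those of even index, give powers
of `x * y` up to powers of `x`. Moving the odd factors in front of the even ones relates these
powers for one commutator per two units of the exponent. -/
theorem pow_mul_pow_commProd (k : ℕ) :
    CommProd k (y ^ (2 * k + 1) *
      ((x * y) ^ k * (x ^ (2 * k + 1))⁻¹ * (x * y) ^ (k + 1))⁻¹) := by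
  have h := commProd_reorder (fun i => x ^ i * y * (x ^ (i + 1))⁻¹) k
  have h1 : ∀ n, ((List.range n).map fun i => x ^ i * y * (x ^ (i + 1))⁻¹).prod
      = y ^ n * (x ^ n)⁻¹ := by
    intro n
    induction n with
    | zero => simp
    | succ n ih => rw [List.range_succ, List.map_append, List.prod_append, ih]; simp [pow_succ, mul_assoc]
  have h2 : ∀ n, ((List.range n).map fun i => x ^ (2 * i + 1) * y * (x ^ (2 * i + 1 + 1))⁻¹).prod
      = (x * y) ^ n * (x ^ (2 * n))⁻¹ := by
    intro n
    induction n with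
    | zero => simp
    | succ n ih =>
      rw [List.range_succ, List.map_append, List.prod_append, ih]
      simp [pow_succ, mul_add, mul_assoc]
  have h3 : ∀ n, ((List.range (n + 1)).map fun i => x ^ (2 * i) * y * (x ^ (2 * i + 1))⁻¹).prod
      = x⁻¹ * (x * y) ^ (n + 1) * (x ^ (2 * n + 1))⁻¹ := by
    intro n
    induction n with
    | zero => simp
    | succ n ih =>
      rw [List.range_succ, List.map_append, List.prod_append, ih]
      simp [pow_succ, mul_add, mul_assoc]
  rw [h1, h2, h3] at h
  convert h using 1
  rw [pow_succ' x (2 * k)]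
  group

theorem bounds_pants_odd (k : ℕ) :
    Bounds k {x ^ (2 * k + 1), y ^ (2 * k + 1), ((x * y)⁻¹) ^ (2 * k + 1)} := by
  have h := (pow_mul_pow_commProd x y k).conj ((x * y) ^ k)⁻¹
  refine ⟨[y ^ (2 * k + 1), ((x * y)⁻¹) ^ (2 * k + 1), x ^ (2 * k + 1)], ?_, _, ?_, h⟩
  · exact (Multiset.coe_eq_coe.2 (by
      exact (List.perm_append_comm (l₁ := [y ^ (2 * k + 1), ((x * y)⁻¹) ^ (2 * k + 1)])
        (l₂ := [x ^ (2 * k + 1)]))))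
  · refine conjProd_cons.2 ⟨((x * y) ^ k)⁻¹, _, conjProd_cons.2 ⟨1, _, conjProd_cons.2
      ⟨1, 1, conjProd_nil.2 rfl, rfl⟩, rfl⟩, ?_⟩
    rw [inv_pow, show 2 * k + 1 = k + (k + 1) by ring, pow_add (x * y) k (k + 1)]
    simp only [mul_inv_rev, inv_inv, one_mul, inv_one, mul_one]
    generalize x * y = z
    group

/-- The growth rate 1/2 is `-χ / 2` of a pair of pants. A positive even exponent is the preceding
odd exponent plus 1, and three merges put the two together. -/
theorem bounds_pants (n : ℕ) :
    Bounds (n / 2 + 3) {x ^ n, y ^ n, ((x * y)⁻¹) ^ n} := by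
  rcases Nat.even_or_odd' n with ⟨k, rfl | rfl⟩
  · rcases k with _ | k
    · simpa [bounds_one_cons, ← Multiset.cons_zero] using Bounds.zero.mono (Nat.zero_le 3)
    · have h := (bounds_pants_odd x y k).add (bounds_pants_odd x y 0)
      have := Bounds.map_mul (s := {x, y, (x * y)⁻¹}) (f := fun g => g ^ (2 * k + 1))
        (g := fun g => g) (m := 0) (k := k + 0) (by simpa using h)
      refine Bounds.mono (j := _) (by simpa [← pow_succ, mul_add] using this) ?_
      simp
  · exact (bounds_pants_odd x y k).mono (by omega)

end Pants

/-- The stable commutator length of the sum of the elements of `m` is at most `r`, with a bounded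
error at all powers. -/
def SclLE (m : Multiset G) (r : ℝ) : Prop :=
  ∃ c : ℕ, ∀ n : ℕ, ∃ k : ℕ, (k : ℝ) ≤ r * n + c ∧ Bounds k (m.map (· ^ n))

variable {m m' : Multiset G} {r r' : ℝ} {a b : G}

theorem SclLE.mono (h : SclLE m r) (hr : r ≤ r') : SclLE m r' := by
  obtain ⟨c, hc⟩ := h
  refine ⟨c, fun n => ?_⟩
  obtain ⟨k, hk, hb⟩ := hc n
  exact ⟨k, hk.trans (by gcongr), hb⟩

theorem SclLE.imp (d : ℕ) (h : SclLE m r)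
    (H : ∀ n k : ℕ, Bounds k (m.map (· ^ n)) → Bounds (k + d) (m'.map (· ^ n))) : SclLE m' r := by
  obtain ⟨c, hc⟩ := h
  refine ⟨c + d, fun n => ?_⟩
  obtain ⟨k, hk, hb⟩ := hc n
  exact ⟨k + d, by push_cast; linarith, H n k hb⟩

theorem SclLE.zero : SclLE (0 : Multiset G) 0 := ⟨0, fun n => ⟨0, by simp, by simpa using Bounds.zero⟩⟩

theorem SclLE.add (h : SclLE m r) (h' : SclLE m' r') : SclLE (m + m') (r + r') := by
  obtain ⟨c, hc⟩ := h
  obtain ⟨c', hc'⟩ := h'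
  refine ⟨c + c', fun n => ?_⟩
  obtain ⟨k, hk, hb⟩ := hc n
  obtain ⟨k', hk', hb'⟩ := hc' n
  exact ⟨k + k', by push_cast; linarith, by simpa using hb.add hb'⟩

theorem SclLE.conj (h : SclLE (a ::ₘ m) r) (hab : IsConj a b) : SclLE (b ::ₘ m) r :=
  h.imp 0 fun n k hk => by
    rw [Multiset.map_cons] at *
    exact hk.conj (hab.pow n)

theorem sclLE_one_cons : SclLE (1 ::ₘ m) r ↔ SclLE m r := by
  constructor <;> exact fun h => h.imp 0 fun n k hk => by simpa [bounds_one_cons] using hk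

theorem SclLE.cons_inv (h : SclLE m r) (a : G) : SclLE (a ::ₘ a⁻¹ ::ₘ m) r :=
  h.imp 0 fun n k hk => by simpa using hk.cons_inv (a ^ n)

theorem SclLE.of_cons_inv (h : SclLE (a ::ₘ a⁻¹ ::ₘ m) r) : SclLE m r :=
  h.imp 1 fun n k hk => by
    simp only [Multiset.map_cons, inv_pow] at hk
    exact hk.of_cons_inv

theorem SclLE.of_pow {n : ℕ} (h : SclLE (a ^ n ::ₘ m) r) : SclLE (n • {a} + m) r :=
  h.imp 0 fun j k hk => by
    rw [Multiset.map_cons, ← pow_mul, mul_comm, pow_mul] at hk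
    simpa [Multiset.map_nsmul, Multiset.nsmul_singleton] using hk.of_pow

theorem sclLE_pants (x y : G) : SclLE {x, y, (x * y)⁻¹} (1 / 2) := by
  refine ⟨3, fun n => ⟨n / 2 + 3, ?_, by simpa using bounds_pants x y n⟩⟩
  have : ((n / 2 : ℕ) : ℝ) ≤ n / 2 := Nat.cast_div_le
  push_cast
  linarith

/-- A pair of pants with boundary `b⁻¹`, `a⁻¹` and `a * b` is glued on. `Bounds.merge` alone would
produce `a ^ n * b ^ n` instead of `(a * b) ^ n`; the pants supply the latter at the stable price
1/2, and cancelling the two inverse pairs adds a bounded error only. -/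
theorem SclLE.merge (h : SclLE (a ::ₘ b ::ₘ m) r) : SclLE (a * b ::ₘ m) (r + 1 / 2) := by
  have h1 := h.add (sclLE_pants b⁻¹ a⁻¹)
  have h2 : SclLE (a ::ₘ a⁻¹ ::ₘ b ::ₘ b⁻¹ ::ₘ a * b ::ₘ m) (r + 1 / 2) := by
    convert h1 using 1
    simp only [← Multiset.singleton_add, Multiset.insert_eq_cons, ← mul_inv_rev, inv_inv]
    abel
  exact h2.of_cons_inv.of_cons_inv

theorem SclLE.split (h : SclLE (a * b ::ₘ m) r) : SclLE (a ::ₘ b ::ₘ m) (r + 1 / 2) := by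
  have h1 := h.add (sclLE_pants a b)
  have h2 : SclLE (a * b ::ₘ (a * b)⁻¹ ::ₘ a ::ₘ b ::ₘ m) (r + 1 / 2) := by
    convert h1 using 1
    simp only [← Multiset.singleton_add, Multiset.insert_eq_cons]
    abel
  exact h2.of_cons_inv

/-- The `n`-th powers are assembled from `N`-th powers of `(n / N)`-th powers and from remainders
with exponent `n % N`. The number of merges depends on `N` and `card m` only. The remainders have
finitely many exponents, so `d` bounds their cost; `hm` makes this cost finite. -/
theorem SclLE.of_nsmul {N : ℕ} (hN : 0 < N) (h : SclLE (N • m) (N * r)) (hr : 0 ≤ r)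
    (hm : ∀ n : ℕ, ∃ k, Bounds k (m.map (· ^ n))) : SclLE m r := by
  obtain ⟨c, hc⟩ := h
  choose f hf using hm
  set d := ∑ i ∈ Finset.range N, f i
  refine ⟨c + d + N * Multiset.card m + Multiset.card m, fun n => ?_⟩
  obtain ⟨k, hk, hb⟩ := hc (n / N)
  have h1 : Bounds (k + N * Multiset.card m) (m.map fun g => (g ^ (n / N)) ^ N) := by
    have := Bounds.map_pow (l := m.map (· ^ (n / N))) (m := 0) (n := N) (k := k)
      (by simpa [Multiset.map_nsmul] using hb)
    simpa using this
  have h2 : Bounds d (m.map (· ^ (n % N))) := by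
    refine (hf _).mono ?_
    exact Finset.single_le_sum (f := f) (fun _ _ => Nat.zero_le _)
      (Finset.mem_range.2 (Nat.mod_lt n hN))
  have h3 := Bounds.map_mul (m := 0) (by simpa using h1.add h2)
  refine ⟨_, ?_, by
    simpa only [← pow_mul, ← pow_add, add_zero, mul_comm (n / N) N, Nat.div_add_mod] using h3⟩
  have h4 : (N : ℝ) * (n / N : ℕ) ≤ n := by exact_mod_cast Nat.mul_div_le n N
  push_cast
  nlinarith [mul_le_mul_of_nonneg_left h4 hr]

end Filling

/-! ### Surfaces glued abstractly from tiles, and the bound on scl they provide -/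

section Assembly

variable {G : Type u} [Group G] {P I : Type*} (idx : P → I) (pot : P → G) (W : I → G)

/-- Value of a letter: sides `(u, v)` of tiles join a point on the loop of `u` to a point on the
loop of `v`; the other letters are the loops themselves. -/
def sideVal : (P × P) ⊕ I → G
  | .inl (u, v) => pot u * (pot v)⁻¹
  | .inr i => W i

/-- Value of a word in sides and loops. -/
def wordVal (l : List ((P × P) ⊕ I)) : G := (l.map (sideVal pot W)).prod

/-- `l` is a path from the loop `i` to the loop `j`. -/
def IsSidePath : I → List ((P × P) ⊕ I) → I → Prop
  | i, [], j => i = j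
  | i, .inl (u, v) :: l, j => i = idx u ∧ IsSidePath (idx v) l j
  | i, .inr k :: l, j => i = k ∧ IsSidePath k l j

/-- The sides occurring in a word. -/
def wordSides (l : List ((P × P) ⊕ I)) : Multiset (P × P) := (l.filterMap Sum.getLeft? : List _)

/-- The loops occurring in a word. -/
def wordLoops (l : List ((P × P) ⊕ I)) : Multiset I := (l.filterMap Sum.getRight? : List _)

variable {idx pot W}

theorem isSidePath_append {i j : I} {l l' : List ((P × P) ⊕ I)} :
    IsSidePath idx i (l ++ l') j ↔ ∃ k, IsSidePath idx i l k ∧ IsSidePath idx k l' j := by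
  induction l generalizing i with
  | nil => simp [IsSidePath]
  | cons a l ih =>
    rcases a with ⟨u, v⟩ | k
    · simp only [List.cons_append, IsSidePath, ih]
      tauto
    · simp only [List.cons_append, IsSidePath, ih]
      tauto

@[simp] theorem wordVal_append (l l' : List ((P × P) ⊕ I)) :
    wordVal pot W (l ++ l') = wordVal pot W l * wordVal pot W l' := by simp [wordVal]

@[simp] theorem wordVal_cons (a) (l : List ((P × P) ⊕ I)) :
    wordVal pot W (a :: l) = sideVal pot W a * wordVal pot W l := by simp [wordVal]

@[simp] theorem wordSides_append (l l' : List ((P × P) ⊕ I)) :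
    wordSides (l ++ l') = wordSides l + wordSides l' := by simp [wordSides]

@[simp] theorem wordLoops_append (l l' : List ((P × P) ⊕ I)) :
    wordLoops (l ++ l') = wordLoops l + wordLoops l' := by simp [wordLoops]

@[simp] theorem wordSides_inl (a) (l : List ((P × P) ⊕ I)) :
    wordSides (.inl a :: l) = a ::ₘ wordSides l := by simp [wordSides]

@[simp] theorem wordSides_inr (a) (l : List ((P × P) ⊕ I)) :
    wordSides (.inr a :: l) = wordSides l := by
  rw [wordSides, List.filterMap_cons_none rfl, wordSides]

@[simp] theorem wordLoops_inl (a) (l : List ((P × P) ⊕ I)) :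
    wordLoops (.inl a :: l) = wordLoops l := by
  rw [wordLoops, List.filterMap_cons_none rfl, wordLoops]

@[simp] theorem wordLoops_inr (a) (l : List ((P × P) ⊕ I)) :
    wordLoops (.inr a :: l) = a ::ₘ wordLoops l := by simp [wordLoops]

@[simp] theorem wordSides_nil : wordSides ([] : List ((P × P) ⊕ I)) = 0 := rfl

@[simp] theorem wordLoops_nil : wordLoops ([] : List ((P × P) ⊕ I)) = 0 := rfl

variable (pot W) in
/-- A partially glued component made of `B.1` triangles, with boundary words `B.2`. -/
def IsBlock (B : ℕ × Multiset (List ((P × P) ⊕ I))) : Prop :=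
  (∃ w, B.2 = {w} ∧ wordVal pot W w = 1 ∧ Multiset.card (wordSides w) ≤ B.1 + 2) ∨
    SclLE (B.2.map (wordVal pot W)) ((B.1 - Multiset.card (B.2.bind wordSides) : ℝ) / 4)

/-- With `s` free sides, `(t - s) / 4` is `-χ / 2` of the block: a triangle counts -1/2 and each
side not yet glued gives back 1/2. Gluing two sides lowers `s` by 2 and raises the bound by 1/2,
which is the price of a split. A disc has `χ = 1` and would lead to the impossible bound -1/2, so
`IsBlock` keeps it apart, recording that its boundary value is trivial and that `s ≤ t + 2`. Two
sides of a disc glued to each other produce an annulus, whose boundary values are inverse up to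
conjugation and have scl 0. -/
theorem IsBlock.glue_word {t : ℕ} {A C : List ((P × P) ⊕ I)} {u v : P}
    {B : Multiset (List ((P × P) ⊕ I))}
    (h : IsBlock pot W (t, (.inl (u, v) :: A ++ .inl (v, u) :: C) ::ₘ B)) :
    IsBlock pot W (t, A ::ₘ C ::ₘ B) := by
  have hval : wordVal pot W (.inl (u, v) :: A ++ .inl (v, u) :: C) =
      (pot u * (pot v)⁻¹) * wordVal pot W A * (pot u * (pot v)⁻¹)⁻¹ * wordVal pot W C := by
    simp [sideVal, mul_assoc]
  rcases h with ⟨w, hw, h1, hs⟩ | h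
  · obtain ⟨rfl, rfl⟩ : (.inl (u, v) :: A ++ .inl (v, u) :: C) = w ∧ B = 0 := by
      have := congrArg Multiset.card hw
      simp only [Multiset.card_cons, Multiset.card_singleton] at this
      have hB : B = 0 := Multiset.card_eq_zero.1 (by omega)
      subst hB
      simpa using hw
    right
    rw [hval] at h1
    have h2 : SclLE (wordVal pot W A ::ₘ wordVal pot W C ::ₘ 0) 0 := by
      rw [Multiset.cons_swap]
      refine SclLE.conj (a := (wordVal pot W A)⁻¹) ?_ (isConj_iff.2 ⟨pot u * (pot v)⁻¹, ?_⟩)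
      · rw [Multiset.cons_swap]
        exact SclLE.zero.cons_inv _
      · rw [eq_inv_of_mul_eq_one_right h1]
        group
    refine SclLE.mono (by simpa using h2) ?_
    simp only [List.cons_append, wordSides_inl, wordSides_append, Multiset.card_cons,
      Multiset.card_add] at hs
    simp only [Multiset.cons_bind, Multiset.card_add, Multiset.zero_bind, Multiset.card_zero]
    have : ((Multiset.card (wordSides A) : ℝ) + (Multiset.card (wordSides C) + 1) + 1) ≤ t + 2 := by
      exact_mod_cast hs
    push_cast
    linarith
  · right
    simp only [Multiset.map_cons, hval] at h
    have h2 := h.split.conj (b := wordVal pot W A)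
      (isConj_iff.2 ⟨(pot u * (pot v)⁻¹)⁻¹, by group⟩)
    refine SclLE.mono (by simpa using h2) ?_
    simp
    linarith

/-- Two boundary words become one for the price 1/2 of a merge. The case of a disc is void, since a
disc has a single boundary word. -/
theorem IsBlock.glue_words {t : ℕ} {A C : List ((P × P) ⊕ I)} {u v : P}
    {B : Multiset (List ((P × P) ⊕ I))}
    (h : IsBlock pot W (t, (.inl (u, v) :: A) ::ₘ (.inl (v, u) :: C) ::ₘ B)) :
    IsBlock pot W (t, (A ++ C) ::ₘ B) := by
  rcases h with ⟨w, hw, h1, hs⟩ | h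
  · have := congrArg Multiset.card hw
    simp at this
  · right
    simp only [Multiset.map_cons, wordVal_cons, sideVal] at h
    have h2 := (h.conj (b := wordVal pot W A * (pot u * (pot v)⁻¹))
      (isConj_iff.2 ⟨(pot u * (pot v)⁻¹)⁻¹, by group⟩)).merge
    have h3 : wordVal pot W A * (pot u * (pot v)⁻¹) * (pot v * (pot u)⁻¹ * wordVal pot W C) =
      wordVal pot W (A ++ C) := by simp [mul_assoc]
    rw [h3] at h2
    refine SclLE.mono (by simpa using h2) ?_
    simp
    linarith

/-- Two discs form a disc. A disc attached to another block replaces one side by the rest of the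
boundary of the disc, which has the same value; no merge is needed, and `s ≤ t + 2` for the disc
ensures that the new bound is not smaller. Only two blocks that are not discs require a merge. -/
theorem IsBlock.glue_blocks {t t' : ℕ} {A C : List ((P × P) ⊕ I)} {u v : P}
    {B B' : Multiset (List ((P × P) ⊕ I))}
    (h : IsBlock pot W (t, (.inl (u, v) :: A) ::ₘ B))
    (h' : IsBlock pot W (t', (.inl (v, u) :: C) ::ₘ B')) :
    IsBlock pot W (t + t', (A ++ C) ::ₘ (B + B')) := by
  have hsingle : ∀ {w w' : List ((P × P) ⊕ I)} {B : Multiset (List ((P × P) ⊕ I))},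
      w ::ₘ B = {w'} → w = w' ∧ B = 0 := by
    intro w w' B hw
    have := congrArg Multiset.card hw
    simp only [Multiset.card_cons, Multiset.card_singleton] at this
    have hB : B = 0 := Multiset.card_eq_zero.1 (by omega)
    subst hB
    simpa using hw
  have hx : ∀ {u v : P} {A : List ((P × P) ⊕ I)}, wordVal pot W (.inl (u, v) :: A) = 1 →
      wordVal pot W A = pot v * (pot u)⁻¹ := by
    intro u v A h
    rw [wordVal_cons, sideVal] at h
    rw [← mul_eq_one_iff_inv_eq.1 h]
    simp
  rcases h with ⟨w, hw, h1, hs⟩ | h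
  · obtain ⟨rfl, rfl⟩ := hsingle hw
    have hA := hx h1
    simp only [wordSides_inl, Multiset.card_cons] at hs
    rcases h' with ⟨w', hw', h1', hs'⟩ | h'
    · obtain ⟨rfl, rfl⟩ := hsingle hw'
      have hC := hx h1'
      simp only [wordSides_inl, Multiset.card_cons] at hs'
      left
      refine ⟨A ++ C, by simp, by simp [hA, hC], ?_⟩
      simp only [wordSides_append, Multiset.card_add]
      omega
    · right
      simp only [Multiset.map_cons, wordVal_cons, sideVal, ← hA, ← wordVal_append] at h'
      refine SclLE.mono (by simpa using h') ?_
      have : ((Multiset.card (wordSides A) : ℝ) + 1) ≤ t + 2 := by exact_mod_cast hs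
      simp
      linarith
  · rcases h' with ⟨w', hw', h1', hs'⟩ | h'
    · obtain ⟨rfl, rfl⟩ := hsingle hw'
      have hC := hx h1'
      simp only [wordSides_inl, Multiset.card_cons] at hs'
      right
      simp only [Multiset.map_cons, wordVal_cons, sideVal, ← hC] at h
      have h2 := h.conj (b := wordVal pot W (A ++ C)) (isConj_iff.2 ⟨(wordVal pot W C)⁻¹, by
        simp⟩)
      refine SclLE.mono (by simpa using h2) ?_
      have : ((Multiset.card (wordSides C) : ℝ) + 1) ≤ t' + 2 := by exact_mod_cast hs'
      simp
      linarith
    · right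
      simp only [Multiset.map_cons, wordVal_cons, sideVal] at h h'
      have h1 := h.conj (b := wordVal pot W A * (pot u * (pot v)⁻¹))
        (isConj_iff.2 ⟨(pot u * (pot v)⁻¹)⁻¹, by group⟩)
      have h2 := h1.add h'
      rw [Multiset.cons_add, Multiset.add_cons] at h2
      have h3 := h2.merge
      have h4 : wordVal pot W A * (pot u * (pot v)⁻¹) * (pot v * (pot u)⁻¹ * wordVal pot W C) =
        wordVal pot W (A ++ C) := by simp [mul_assoc]
      rw [h4] at h3
      refine SclLE.mono (by simpa using h3) ?_
      simp
      linarith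

theorem IsBlock.rotate {t : ℕ} {A C : List ((P × P) ⊕ I)} {B : Multiset (List ((P × P) ⊕ I))}
    (h : IsBlock pot W (t, (A ++ C) ::ₘ B)) : IsBlock pot W (t, (C ++ A) ::ₘ B) := by
  rcases h with ⟨w, hw, h1, hs⟩ | h
  · have := congrArg Multiset.card hw
    simp only [Multiset.card_cons, Multiset.card_singleton] at this
    have hB : B = 0 := Multiset.card_eq_zero.1 (by omega)
    subst hB
    obtain rfl : A ++ C = w := by simpa using hw
    refine Or.inl ⟨C ++ A, by simp, ?_, by simpa [add_comm] using hs⟩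
    rw [wordVal_append] at h1 ⊢
    exact mul_eq_one_comm.1 h1
  · right
    simp only [Multiset.map_cons, wordVal_append] at h
    have := h.conj (b := wordVal pot W (C ++ A)) (isConj_iff.2 ⟨(wordVal pot W A)⁻¹, by simp⟩)
    refine SclLE.mono (by simpa using this) ?_
    simp [add_comm]

theorem exists_eq_append_of_mem_wordSides {a : P × P} {l : List ((P × P) ⊕ I)}
    (h : a ∈ wordSides l) : ∃ A C, l = A ++ .inl a :: C := by
  simp only [wordSides, Multiset.mem_coe, List.mem_filterMap] at h
  obtain ⟨x, hx, hx'⟩ := h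
  obtain ⟨A, C, rfl⟩ := List.append_of_mem hx
  rcases x with x | x
  · exact ⟨A, C, by simp at hx'; simp [hx']⟩
  · simp at hx'

variable (idx pot W) in
/-- A partially glued surface: a family of blocks whose boundary words are closed paths. -/
structure IsPatchwork (S : Multiset (ℕ × Multiset (List ((P × P) ⊕ I)))) : Prop where
  block : ∀ B ∈ S, IsBlock pot W B
  closed : ∀ B ∈ S, ∀ w ∈ B.2, ∃ i, IsSidePath idx i w i

/-- The free sides of a partially glued surface. -/
def patchSides (S : Multiset (ℕ × Multiset (List ((P × P) ⊕ I)))) : Multiset (P × P) :=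
  S.bind fun B => B.2.bind wordSides

/-- The loops covered by the boundary of a partially glued surface. -/
def patchLoops (S : Multiset (ℕ × Multiset (List ((P × P) ⊕ I)))) : Multiset I :=
  S.bind fun B => B.2.bind wordLoops

theorem isSidePath_rotate {A C : List ((P × P) ⊕ I)} (h : ∃ i, IsSidePath idx i (A ++ C) i) :
    ∃ i, IsSidePath idx i (C ++ A) i := by
  obtain ⟨i, hi⟩ := h
  obtain ⟨k, h1, h2⟩ := isSidePath_append.1 hi
  exact ⟨k, isSidePath_append.2 ⟨i, h2, h1⟩⟩

/-- Bring a free side to the front of its word. -/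
theorem IsPatchwork.exists_front {S : Multiset (ℕ × Multiset (List ((P × P) ⊕ I)))}
    (hS : IsPatchwork idx pot W S) {a : P × P} (ha : a ∈ patchSides S) :
    ∃ t A B S', IsPatchwork idx pot W ((t, (.inl a :: A) ::ₘ B) ::ₘ S') ∧
      patchSides S = patchSides ((t, (.inl a :: A) ::ₘ B) ::ₘ S') ∧
      patchLoops S = patchLoops ((t, (.inl a :: A) ::ₘ B) ::ₘ S') ∧
      (S.map Prod.fst).sum = (((t, (.inl a :: A) ::ₘ B) ::ₘ S').map Prod.fst).sum := by
  simp only [patchSides, Multiset.mem_bind] at ha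
  obtain ⟨⟨t, B⟩, hB, w, hw, haw⟩ := ha
  obtain ⟨S', rfl⟩ := Multiset.exists_cons_of_mem hB
  obtain ⟨B, rfl⟩ := Multiset.exists_cons_of_mem hw
  obtain ⟨A, C, rfl⟩ := exists_eq_append_of_mem_wordSides haw
  refine ⟨t, C ++ A, B, S', ⟨?_, ?_⟩, ?_, ?_, ?_⟩
  · intro B' hB'
    rcases Multiset.mem_cons.1 hB' with rfl | hB'
    · exact (hS.block _ (Multiset.mem_cons_self _ _)).rotate
    · exact hS.block _ (Multiset.mem_cons_of_mem hB')
  · intro B' hB' w hw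
    rcases Multiset.mem_cons.1 hB' with rfl | hB'
    · rcases Multiset.mem_cons.1 hw with rfl | hw
      · exact isSidePath_rotate (hS.closed _ (Multiset.mem_cons_self _ _) _
          (Multiset.mem_cons_self _ _))
      · exact hS.closed _ (Multiset.mem_cons_self _ _) _ (Multiset.mem_cons_of_mem hw)
    · exact hS.closed _ (Multiset.mem_cons_of_mem hB') _ hw
  · simp [patchSides, add_comm]
  · simp [patchLoops, add_comm]
  · simp

/-- Only side letters lead from one loop to another, so a path without them stays on a single loop.
-/
theorem isSidePath_of_wordSides_eq_zero {i j : I} {l : List ((P × P) ⊕ I)}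
    (h : IsSidePath idx i l j) (hl : wordSides l = 0) :
    wordVal pot W l = W i ^ l.length ∧ wordLoops l = l.length • {i} := by
  induction l generalizing i with
  | nil => simp [wordVal]
  | cons a l ih =>
    rcases a with a | k
    · simp at hl
    · obtain ⟨rfl, h⟩ := h
      obtain ⟨h1, h2⟩ := ih h (by simpa using hl)
      simp only [wordVal_cons, h1, wordLoops_inr, h2, List.length_cons, sideVal, pow_succ']
      simp [← Multiset.singleton_add, add_nsmul, add_comm]

/-- Once all sides are glued, every boundary word is a power of one loop, and `SclLE.of_pow` breaks
the power into separate loops for free. Discs only contribute a trivial element. -/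
theorem IsPatchwork.sclLE_of_sides_eq_zero {S : Multiset (ℕ × Multiset (List ((P × P) ⊕ I)))}
    (hS : IsPatchwork idx pot W S) (h0 : patchSides S = 0) :
    SclLE ((patchLoops S).map W) ((S.map Prod.fst).sum / 4 : ℝ) := by
  induction S using Multiset.induction with
  | empty => simpa [patchLoops] using SclLE.zero
  | cons B S ih =>
    have h0' : B.2.bind wordSides = 0 ∧ patchSides S = 0 := by
      simpa [patchSides] using h0
    have hS' : IsPatchwork idx pot W S := ⟨fun B' hB' => hS.block _ (Multiset.mem_cons_of_mem hB'),
      fun B' hB' => hS.closed _ (Multiset.mem_cons_of_mem hB')⟩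
    have h1 : SclLE (B.2.map (wordVal pot W)) ((B.1 : ℝ) / 4) := by
      rcases hS.block B (Multiset.mem_cons_self _ _) with ⟨w, hw, h1, -⟩ | h
      · rw [hw, Multiset.map_singleton, h1, ← Multiset.cons_zero, sclLE_one_cons]
        exact SclLE.zero.mono (by positivity)
      · simpa [h0'.1] using h
    have h2 : ∀ (m : Multiset G) (r : ℝ) (B' : Multiset (List ((P × P) ⊕ I))), B' ≤ B.2 →
        SclLE (B'.map (wordVal pot W) + m) r → SclLE ((B'.bind wordLoops).map W + m) r := by
      intro m r B' hB'
      induction B' using Multiset.induction generalizing m with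
      | empty => simp
      | cons w B' ih =>
        intro h
        have hw : w ∈ B.2 := Multiset.mem_of_le hB' (Multiset.mem_cons_self _ _)
        obtain ⟨i, hi⟩ := hS.closed B (Multiset.mem_cons_self _ _) w hw
        have hw0 : wordSides w = 0 := by
          rw [Multiset.eq_zero_iff_forall_notMem]
          intro a ha
          have : a ∈ B.2.bind wordSides := Multiset.mem_bind.2 ⟨w, hw, ha⟩
          simp [h0'.1] at this
        obtain ⟨h3, h4⟩ := isSidePath_of_wordSides_eq_zero (pot := pot) (W := W) hi hw0
        rw [Multiset.map_cons, h3, Multiset.cons_add] at h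
        have := h.of_pow
        rw [← add_assoc, add_comm (_ • _), add_assoc] at this
        have := ih _ ((Multiset.le_cons_self _ _).trans hB') this
        convert this using 1
        rw [Multiset.cons_bind, h4, Multiset.map_add, Multiset.map_nsmul, Multiset.map_singleton]
        abel
    have h3 := h2 0 _ B.2 le_rfl (by simpa using h1)
    have := h3.add (ih hS' h0'.2)
    simp only [patchLoops, Multiset.cons_bind, Multiset.map_add, Multiset.map_cons,
      Multiset.sum_cons, add_zero, Nat.cast_add] at this ⊢
    convert this using 1
    ring

/-- The pairs of sides are glued one after the other. Every gluing preserves the property of being a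
patchwork, the loops and the number of triangles, so the order of the gluings is irrelevant. -/
theorem IsPatchwork.sclLE {S : Multiset (ℕ × Multiset (List ((P × P) ⊕ I)))}
    (hS : IsPatchwork idx pot W S) (A : Multiset (P × P))
    (hA : patchSides S = A + A.map Prod.swap) :
    SclLE ((patchLoops S).map W) ((S.map Prod.fst).sum / 4 : ℝ) := by
  induction A using Multiset.induction generalizing S with
  | empty => exact hS.sclLE_of_sides_eq_zero (by simpa using hA)
  | cons a A ih =>
    obtain ⟨u, v⟩ := a
    obtain ⟨t, X, B, S', hS1, h1, h2, h3⟩ := hS.exists_front (a := (u, v)) (by simp [hA])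
    rw [h2, h3]
    rw [h1] at hA
    clear h1 h2 h3 hS
    have hA' : wordSides X + B.bind wordSides + patchSides S' =
        (v, u) ::ₘ (A + A.map Prod.swap) := by
      rw [← Multiset.cons_inj_right (u, v), Multiset.cons_swap (u, v) (v, u)]
      simpa [patchSides] using hA
    have hmem : (v, u) ∈ wordSides X ∨ (v, u) ∈ B.bind wordSides ∨ (v, u) ∈ patchSides S' := by
      have : (v, u) ∈ wordSides X + B.bind wordSides + patchSides S' := by simp [hA']
      simpa [or_assoc] using this
    have hblock := hS1.block _ (Multiset.mem_cons_self _ _)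
    have hblock' := fun B' hB' => hS1.block B' (Multiset.mem_cons_of_mem hB')
    have hclosed := hS1.closed _ (Multiset.mem_cons_self _ _)
    have hclosed' := fun B' hB' => hS1.closed B' (Multiset.mem_cons_of_mem hB')
    have hX := hclosed _ (Multiset.mem_cons_self _ _)
    have hB := fun w hw => hclosed w (Multiset.mem_cons_of_mem hw)
    obtain ⟨i, hiu, hi⟩ := hX
    subst hiu
    rcases hmem with hmem | hmem | hmem
    -- The partner side lies in the same boundary word.
    · obtain ⟨Y, Z, rfl⟩ := exists_eq_append_of_mem_wordSides hmem
      obtain ⟨k, hY, rfl, hZ⟩ := isSidePath_append.1 hi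
      have := @ih ((t, Y ::ₘ Z ::ₘ B) ::ₘ S') ⟨?_, ?_⟩ ?_
      · simpa [patchLoops, add_assoc] using this
      · intro B' hB'
        rcases Multiset.mem_cons.1 hB' with rfl | hB'
        · exact hblock.glue_word
        · exact hblock' _ hB'
      · intro B' hB' w hw
        rcases Multiset.mem_cons.1 hB' with rfl | hB'
        · rcases Multiset.mem_cons.1 hw with rfl | hw
          · exact ⟨_, hY⟩
          rcases Multiset.mem_cons.1 hw with rfl | hw
          · exact ⟨_, hZ⟩
          · exact hB _ hw
        · exact hclosed' _ hB' _ hw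
      · rw [← Multiset.cons_inj_right (v, u), ← hA']
        simp [patchSides, add_assoc]
    -- The partner side lies in another boundary word of the same block.
    · obtain ⟨w, hw, hvu⟩ := Multiset.mem_bind.1 hmem
      obtain ⟨B, rfl⟩ := Multiset.exists_cons_of_mem hw
      obtain ⟨Y, Z, rfl⟩ := exists_eq_append_of_mem_wordSides hvu
      rw [Multiset.cons_swap] at hblock
      have hb := hblock.rotate
      rw [List.cons_append, Multiset.cons_swap] at hb
      obtain ⟨k, hk⟩ := isSidePath_rotate (hB _ (Multiset.mem_cons_self _ _))
      obtain ⟨rfl, hk⟩ := hk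
      have := @ih ((t, (X ++ (Z ++ Y)) ::ₘ B) ::ₘ S') ⟨?_, ?_⟩ ?_
      · simpa [patchLoops, add_assoc, add_comm, add_left_comm] using this
      · intro B' hB'
        rcases Multiset.mem_cons.1 hB' with rfl | hB'
        · exact hb.glue_words
        · exact hblock' _ hB'
      · intro B' hB' w hw
        rcases Multiset.mem_cons.1 hB' with rfl | hB'
        · rcases Multiset.mem_cons.1 hw with rfl | hw
          · exact ⟨_, isSidePath_append.2 ⟨_, hi, hk⟩⟩
          · exact hB _ (Multiset.mem_cons_of_mem hw)
        · exact hclosed' _ hB' _ hw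
      · rw [← Multiset.cons_inj_right (v, u), ← hA']
        simp only [patchSides, Multiset.cons_bind, wordSides_append, wordSides_inl]
        rw [← Multiset.singleton_add, ← Multiset.singleton_add]
        abel
    -- The partner side lies in a different block.
    · obtain ⟨⟨t', B₂⟩, hB₂, w, hw, hvu⟩ : ∃ B' ∈ S', ∃ w ∈ B'.2, (v, u) ∈ wordSides w := by
        simpa only [patchSides, Multiset.mem_bind] using hmem
      obtain ⟨S', rfl⟩ := Multiset.exists_cons_of_mem hB₂
      obtain ⟨B₂, rfl⟩ := Multiset.exists_cons_of_mem hw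
      obtain ⟨Y, Z, rfl⟩ := exists_eq_append_of_mem_wordSides hvu
      have hb := (hblock' _ (Multiset.mem_cons_self _ _)).rotate
      rw [List.cons_append] at hb
      have hcl := hclosed' _ (Multiset.mem_cons_self _ _)
      obtain ⟨k, hk⟩ := isSidePath_rotate (hcl _ (Multiset.mem_cons_self _ _))
      obtain ⟨rfl, hk⟩ := hk
      have := @ih ((t + t', (X ++ (Z ++ Y)) ::ₘ (B + B₂)) ::ₘ S') ⟨?_, ?_⟩ ?_
      · simpa [patchLoops, add_assoc, add_comm, add_left_comm] using this
      · intro B' hB'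
        rcases Multiset.mem_cons.1 hB' with rfl | hB'
        · exact hblock.glue_blocks hb
        · exact hblock' _ (Multiset.mem_cons_of_mem hB')
      · intro B' hB' w hw
        rcases Multiset.mem_cons.1 hB' with rfl | hB'
        · rcases Multiset.mem_cons.1 hw with rfl | hw
          · exact ⟨_, isSidePath_append.2 ⟨_, hi, hk⟩⟩
          rcases Multiset.mem_add.1 hw with hw | hw
          · exact hB _ hw
          · exact hcl _ (Multiset.mem_cons_of_mem hw)
        · exact hclosed' _ (Multiset.mem_cons_of_mem hB') _ hw
      · rw [← Multiset.cons_inj_right (v, u), ← hA']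
        simp only [patchSides, Multiset.cons_bind, wordSides_append, wordSides_inl,
          Multiset.add_bind]
        rw [← Multiset.singleton_add, ← Multiset.singleton_add]
        abel

end Assembly

/-! ### Tilings of cyclic words by rectangles and triangles, and the upper bound on scl -/

section Tilings

variable {ι : Type v} {I : Type} {ws : I → Word ι}

/-- The inverse letter. -/
def flipLetter (a : ι × Bool) : ι × Bool := (a.1, !a.2)

@[simp] theorem flipLetter_flipLetter (a : ι × Bool) : flipLetter (flipLetter a) = a := by
  simp [flipLetter]

theorem flipLetter_ne (a : ι × Bool) : flipLetter a ≠ a := by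
  intro h
  have := congrArg Prod.snd h
  simp [flipLetter] at this

variable (ws) in
/-- Positions of letters in a family of cyclic words. -/
abbrev Pos : Type := Σ i, Fin (ws i).length

/-- The letter at a position. -/
def Pos.letter (p : Pos ws) : ι × Bool := (ws p.1)[p.2]

/-- The next position in cyclic order. -/
def Pos.next (p : Pos ws) : Pos ws :=
  ⟨p.1, ⟨(p.2 + 1) % (ws p.1).length, Nat.mod_lt _ (p.2.pos)⟩⟩

/-- The position is the last one of its word. -/
def Pos.IsLast (p : Pos ws) : Prop := (p.2 : ℕ) + 1 = (ws p.1).length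

instance (p : Pos ws) : Decidable p.IsLast := inferInstanceAs (Decidable (_ = _))

/-- The signed incidence of the oriented side `(a, b)` with `(u, v)`. -/
def sideSign (K : Type*) [Ring K] {P : Type*} [DecidableEq P] (u v a b : P) : K :=
  (if a = u ∧ b = v then 1 else 0) - (if a = v ∧ b = u then 1 else 0)

/-- A way to assemble a surface from `R a b` rectangles with letters at the positions `a` and `b`
on opposite sides and `T a b c` triangles with corners at `a`, `b`, `c`. -/
structure IsTiling [Fintype I] [DecidableEq I] {K : Type*} [Ring K] (R : Pos ws → Pos ws → K)
    (T : Pos ws → Pos ws → Pos ws → K) : Prop where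
  adj : ∀ a b, b.letter ≠ flipLetter a.letter → R a b = 0
  balance : ∀ u v, (∑ a, ∑ b, ∑ c, T a b c *
      (sideSign K u v a b + sideSign K u v b c + sideSign K u v c a)) +
    ∑ a, ∑ b, R a b * (sideSign K u v b.next a + sideSign K u v a.next b) = 0

/-- The number of rectangle sides at a position. -/
def sideCount [Fintype I] {K : Type*} [AddCommMonoid K] (R : Pos ws → Pos ws → K) (p : Pos ws) : K :=
  ∑ b, (R p b + R b p)

variable {F : Type u} [Group F] (b : FreeGroupBasis ι F)

theorem evalWord_append (w w' : Word ι) : evalWord b (w ++ w') = evalWord b w * evalWord b w' := by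
  simp [evalWord]

/-- The initial segment of a word before a position. -/
def Pos.pot (p : Pos ws) : F := evalWord b ((ws p.1).take p.2)

theorem evalWord_flipLetter (a : ι × Bool) : evalWord b [flipLetter a] = (evalWord b [a])⁻¹ := by
  rcases a with ⟨i, _ | _⟩ <;> simp [evalWord, flipLetter]

/-- Potentials are initial segments of the word. After the last letter they start again from 1, and
the complete word is split off as one turn around the loop. -/
theorem Pos.pot_mul_letter (p : Pos ws) : p.pot b * evalWord b [p.letter] =
    (if p.IsLast then evalWord b (ws p.1) else 1) * p.next.pot b := by
  obtain ⟨i, k, hk⟩ := p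
  have h1 : (ws i).take (k + 1) = (ws i).take k ++ [(ws i)[k]] := by simp
  have h2 : evalWord b ((ws i).take (k + 1)) =
    evalWord b ((ws i).take k) * evalWord b [(ws i)[k]] := by rw [h1, evalWord_append]
  by_cases h : Pos.IsLast (ws := ws) ⟨i, k, hk⟩
  · rw [if_pos h]
    simp only [Pos.IsLast] at h
    simp only [Pos.pot, Pos.letter, Pos.next, Fin.getElem_fin, ← h2, h]
    simp [evalWord]
  · rw [if_neg h, one_mul]
    simp only [Pos.IsLast] at h
    simp only [Pos.pot, Pos.letter, Pos.next, Fin.getElem_fin, ← h2,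
      Nat.mod_eq_of_lt (show k + 1 < (ws i).length by omega)]

theorem patchSides_add {P I : Type*} (S S' : Multiset (ℕ × Multiset (List ((P × P) ⊕ I)))) :
    patchSides (S + S') = patchSides S + patchSides S' := by simp [patchSides]

theorem patchLoops_add {P I : Type*} (S S' : Multiset (ℕ × Multiset (List ((P × P) ⊕ I)))) :
    patchLoops (S + S') = patchLoops S + patchLoops S' := by simp [patchLoops]

/-- The loop letter after a position. -/
def loopAfter (p : Pos ws) : List ((Pos ws × Pos ws) ⊕ I) := if p.IsLast then [.inr p.1] else []

/-- The tiles of a tiling. -/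
def tiles [Fintype I] (R : Pos ws → Pos ws → ℕ) (T : Pos ws → Pos ws → Pos ws → ℕ) :
    Multiset (ℕ × Multiset (List ((Pos ws × Pos ws) ⊕ I))) :=
  (∑ a, ∑ b, ∑ c, T a b c • {(1, {[.inl (a, b), .inl (b, c), .inl (c, a)]})}) +
    ∑ a, ∑ b, R a b • {(0, {.inl (b.next, a) :: loopAfter a ++ .inl (a.next, b) :: loopAfter b})}

@[simp] theorem wordSides_loopAfter (p : Pos ws) : wordSides (loopAfter p) = 0 := by
  unfold loopAfter
  split_ifs <;> simp

theorem isSidePath_loopAfter (p : Pos ws) : IsSidePath Sigma.fst p.1 (loopAfter p) p.1 := by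
  unfold loopAfter
  split_ifs <;> simp [IsSidePath]

theorem wordVal_loopAfter (p : Pos ws) : wordVal (Pos.pot b) (fun i => evalWord b (ws i))
    (loopAfter p) = if p.IsLast then evalWord b (ws p.1) else 1 := by
  unfold loopAfter
  split_ifs <;> simp [wordVal, sideVal]

variable [Fintype I] {R : Pos ws → Pos ws → ℕ} {T : Pos ws → Pos ws → Pos ws → ℕ}

/-- Each tile starts as a disc. Around a triangle the potentials cancel, and it has 3 = 1 + 2 sides;
around a rectangle the letters at its two positions remain, which are inverse by `h`, and it has 2 =
0 + 2 sides. -/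
theorem isPatchwork_tiles (h : ∀ a b, b.letter ≠ flipLetter a.letter → R a b = 0) :
    IsPatchwork Sigma.fst (Pos.pot b) (fun i => evalWord b (ws i)) (tiles R T) := by
  have hmem : ∀ B ∈ tiles R T, (∃ a b c, B = (1, {[.inl (a, b), .inl (b, c), .inl (c, a)]})) ∨
      ∃ a b, b.letter = flipLetter a.letter ∧ B = (0, {.inl (b.next, a) :: loopAfter a ++
        .inl (a.next, b) :: loopAfter b}) := by
    intro B hB
    rw [tiles, Multiset.mem_add] at hB
    rcases hB with hB | hB
    · simp only [Multiset.mem_sum, Finset.mem_univ, true_and] at hB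
      obtain ⟨a, b, c, hB⟩ := hB
      exact Or.inl ⟨a, b, c, by simpa using Multiset.mem_of_mem_nsmul hB⟩
    · simp only [Multiset.mem_sum, Finset.mem_univ, true_and] at hB
      obtain ⟨a, b, hB⟩ := hB
      refine Or.inr ⟨a, b, ?_, by simpa using Multiset.mem_of_mem_nsmul hB⟩
      by_contra hab
      simp [h a b hab] at hB
  constructor
  · intro B hB
    left
    rcases hmem B hB with ⟨x, y, z, rfl⟩ | ⟨x, y, hxy, rfl⟩
    · exact ⟨_, rfl, by simp [wordVal, sideVal], by simp⟩
    · refine ⟨_, rfl, ?_, by simp⟩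
      have hx := Pos.pot_mul_letter b x
      have hy := Pos.pot_mul_letter b y
      rw [← wordVal_loopAfter] at hx hy
      rw [hxy, evalWord_flipLetter] at hy
      simp only [wordVal_append, wordVal_cons, sideVal]
      rw [← mul_inv_eq_iff_eq_mul] at hx hy
      rw [← hx, ← hy]
      group
  · intro B hB w hw
    rcases hmem B hB with ⟨x, y, z, rfl⟩ | ⟨x, y, hxy, rfl⟩
    · rw [Multiset.mem_singleton] at hw
      subst hw
      exact ⟨x.1, by simp [IsSidePath]⟩
    · rw [Multiset.mem_singleton] at hw
      subst hw
      refine ⟨y.1, isSidePath_append.2 ⟨x.1, ?_, ?_⟩⟩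
      · exact ⟨rfl, isSidePath_loopAfter x⟩
      · exact ⟨rfl, isSidePath_loopAfter y⟩

theorem patchLoops_tiles : patchLoops (tiles R T) = ∑ p : Pos ws with p.IsLast, sideCount R p • {p.1} := by
  let φ : Multiset (ℕ × Multiset (List ((Pos ws × Pos ws) ⊕ I))) →+ Multiset I :=
    ⟨⟨patchLoops, by simp [patchLoops]⟩, patchLoops_add⟩
  have hφ : ∀ S, φ S = patchLoops S := fun _ => rfl
  rw [← hφ]
  have h1 : ∀ a b c : Pos ws, φ {(1, {[.inl (a, b), .inl (b, c), .inl (c, a)]})} = 0 := by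
    intro a b c
    simp [hφ, patchLoops]
  have h2 : ∀ a : Pos ws, wordLoops (loopAfter a) = if a.IsLast then {a.1} else 0 := by
    intro a
    unfold loopAfter
    split_ifs <;> simp
  have h3 : ∀ a b : Pos ws, φ {(0, {.inl (b.next, a) :: loopAfter a ++
      .inl (a.next, b) :: loopAfter b})} = (if a.IsLast then {a.1} else 0) +
        (if b.IsLast then {b.1} else 0) := by
    intro a b
    simp [hφ, patchLoops, h2, -List.cons_append]
  simp only [tiles, map_add, map_sum, map_nsmul, h1, h3, smul_zero, Finset.sum_const_zero, zero_add,
    smul_add, Finset.sum_add_distrib]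
  rw [Finset.sum_comm (f := fun a b : Pos ws => R a b • (if b.IsLast then {b.1} else (0 : Multiset I))),
    ← Finset.sum_add_distrib, Finset.sum_filter]
  refine Finset.sum_congr rfl fun p _ => ?_
  split_ifs with hp
  · rw [sideCount, Finset.sum_smul, ← Finset.sum_add_distrib]
    simp [add_nsmul]
  · simp

theorem sum_fst_tiles : ((tiles R T).map Prod.fst).sum = ∑ a, ∑ b, ∑ c, T a b c := by
  let φ : Multiset (ℕ × Multiset (List ((Pos ws × Pos ws) ⊕ I))) →+ ℕ :=
    ⟨⟨fun S => (S.map Prod.fst).sum, by simp⟩, by simp⟩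
  have hφ : ∀ S, φ S = (S.map Prod.fst).sum := fun _ => rfl
  rw [← hφ]
  have h1 : ∀ a b c : Pos ws, φ {(1, {[.inl (a, b), .inl (b, c), .inl (c, a)]})} = 1 := by
    intro a b c
    simp [hφ, -List.cons_append]
  have h3 : ∀ a b : Pos ws, φ {(0, {.inl (b.next, a) :: loopAfter a ++
      .inl (a.next, b) :: loopAfter b})} = 0 := by
    intro a b
    simp [hφ, -List.cons_append]
  simp only [tiles, map_add, map_sum, map_nsmul, h1, h3, Finset.sum_const_zero,
    smul_eq_mul, mul_one, mul_zero, add_zero]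

/-- The balance condition compares the multiplicities of `(u, v)` and `(v, u)` among the sides of
all tiles. -/
theorem patchSides_tiles [DecidableEq I] (h : IsTiling (fun a b => (R a b : ℤ)) (fun a b c => (T a b c : ℤ))) :
    (patchSides (tiles R T)).map Prod.swap = patchSides (tiles R T) := by
  ext ⟨u, v⟩
  let φ : Pos ws × Pos ws → Multiset (ℕ × Multiset (List ((Pos ws × Pos ws) ⊕ I))) →+ ℤ := fun x =>
    ⟨⟨fun S => ((patchSides S).count x : ℤ), by simp [patchSides]⟩, fun S S' => by
      simp [patchSides_add]⟩
  have hφ : ∀ x S, φ x S = ((patchSides S).count x : ℤ) := fun _ _ => rfl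
  have hswap : ((patchSides (tiles R T)).map Prod.swap).count (u, v) =
      (patchSides (tiles R T)).count (v, u) := by
    conv_lhs => rw [← Prod.swap_prod_mk]
    exact Multiset.count_map_eq_count' _ _ Prod.swap_injective _
  rw [hswap]
  suffices φ (u, v) (tiles R T) - φ (v, u) (tiles R T) = 0 by
    have h' : φ (v, u) (tiles R T) = φ (u, v) (tiles R T) := by omega
    rw [hφ, hφ] at h'
    exact_mod_cast h'
  have h1 : ∀ x (a b c : Pos ws), φ x {(1, {[.inl (a, b), .inl (b, c), .inl (c, a)]})} =
      (if (a, b) = x then 1 else 0) + (if (b, c) = x then 1 else 0) +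
        (if (c, a) = x then 1 else 0) := by
    intro x a b c
    simp only [hφ, patchSides, Multiset.singleton_bind,
      wordSides_inl, wordSides_nil, Multiset.count_cons, Multiset.count_zero, eq_comm (a := x)]
    push_cast
    ring
  have h3 : ∀ x (a b : Pos ws), φ x {(0, {.inl (b.next, a) :: loopAfter a ++
      .inl (a.next, b) :: loopAfter b})} =
      (if (b.next, a) = x then 1 else 0) + (if (a.next, b) = x then 1 else 0) := by
    intro x a b
    simp only [hφ, patchSides, Multiset.singleton_bind,
      wordSides_append, wordSides_loopAfter, List.cons_append, Multiset.zero_add,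
      wordSides_inl, Multiset.count_cons, Multiset.count_zero, eq_comm (a := x)]
    push_cast
    ring
  have hb := h.balance u v
  rw [← hb]
  simp only [tiles, map_add, map_sum, map_nsmul, h1, h3, sideSign, Prod.mk.injEq, nsmul_eq_mul]
  rw [add_sub_add_comm, ← Finset.sum_sub_distrib, ← Finset.sum_sub_distrib]
  congr 1
  · refine Finset.sum_congr rfl fun a _ => ?_
    rw [← Finset.sum_sub_distrib]
    refine Finset.sum_congr rfl fun b _ => ?_
    rw [← Finset.sum_sub_distrib]
    refine Finset.sum_congr rfl fun c _ => ?_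
    ring
  · refine Finset.sum_congr rfl fun a _ => ?_
    rw [← Finset.sum_sub_distrib]
    refine Finset.sum_congr rfl fun b _ => ?_
    ring

/-- A tiling bounds the stable commutator length of its boundary. -/
theorem IsTiling.sclLE [DecidableEq I] (h : IsTiling (fun a b => (R a b : ℤ)) (fun a b c => (T a b c : ℤ))) :
    SclLE (2 • ∑ p : Pos ws with p.IsLast, sideCount R p • {evalWord b (ws p.1)})
      (2 * ((∑ a, ∑ b, ∑ c, T a b c : ℕ) / 4)) := by
  have hS : IsPatchwork Sigma.fst (Pos.pot b) (fun i => evalWord b (ws i)) (tiles R T) :=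
    isPatchwork_tiles b fun x y hxy => by exact_mod_cast h.adj x y hxy
  -- Two copies are used because a side `(u, u)`, which equals its own reverse, may occur an odd
  -- number of times. In the doubled family the sides of one copy are matched with the reversed
  -- sides of the other.
  have hS2 : IsPatchwork Sigma.fst (Pos.pot b) (fun i => evalWord b (ws i)) (2 • tiles R T) :=
    ⟨fun B hB => hS.block B (Multiset.mem_of_mem_nsmul hB),
      fun B hB => hS.closed B (Multiset.mem_of_mem_nsmul hB)⟩
  have := hS2.sclLE (patchSides (tiles R T)) (by
    rw [patchSides_tiles h, two_nsmul, patchSides_add])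
  have hmap : Multiset.map (fun i => evalWord b (ws i))
      (∑ p : Pos ws with Pos.IsLast p, sideCount R p • ({p.1} : Multiset I)) =
      ∑ p : Pos ws with Pos.IsLast p, sideCount R p • {evalWord b (ws p.1)} := by
    rw [← Multiset.coe_mapAddMonoidHom, map_sum]
    simp [Multiset.map_nsmul]
  rw [two_nsmul, patchLoops_add, patchLoops_tiles, Multiset.map_add, Multiset.map_add,
    Multiset.sum_add, sum_fst_tiles, hmap, ← two_nsmul] at this
  convert this using 1
  push_cast
  ring

end Tilings

/-! ### Words folded onto graphs, the combinatorial form of commutator expressions -/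

section Foldings

variable {ι : Type v} {D V V' : Type}

/-- The darts of a list form a walk from one vertex to another. -/
def IsWalk (tail head : D → V) : V → List D → V → Prop
  | y, [], z => y = z
  | y, d :: l, z => tail d = y ∧ IsWalk tail head (head d) l z

theorem isWalk_append {tail head : D → V} {y z : V} {l l' : List D} :
    IsWalk tail head y (l ++ l') z ↔ ∃ m, IsWalk tail head y l m ∧ IsWalk tail head m l' z := by
  induction l generalizing y with
  | nil => simp [IsWalk]
  | cons d l ih => simp [IsWalk, ih, and_assoc]

theorem IsWalk.map {D' : Type} {tail head : D → V} {tail' head' : D' → V'} {y z : V} {l : List D}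
    (i : D → D') (h : V → V') (ht : ∀ d ∈ l, tail' (i d) = h (tail d))
    (hh : ∀ d ∈ l, head' (i d) = h (head d)) (H : IsWalk tail head y l z) :
    IsWalk tail' head' (h y) (l.map i) (h z) := by
  induction l generalizing y with
  | nil => simpa [IsWalk] using congrArg h H
  | cons d l ih =>
    simp only [List.mem_cons, forall_eq_or_imp] at ht hh
    refine ⟨by rw [ht.1, H.1], ?_⟩
    rw [hh.1]
    exact ih ht.2 hh.2 H.2

theorem IsWalk.imp {tail head : D → V} {tail' head' : D → V'} {y z : V} {l : List D}
    (h : V → V') (ht : ∀ d ∈ l, tail' d = h (tail d))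
    (hh : ∀ d ∈ l, head' d = h (head d)) (H : IsWalk tail head y l z) :
    IsWalk tail' head' (h y) l (h z) := by
  simpa using H.map id h ht hh

/-- A pairing of the letters of a word with inverse letters that folds the word to a walk on a
graph of rank at most `c`. -/
structure Folding (c : ℕ) (W : Word ι) where
  Dart : Type
  Vertex : Type
  lab : Dart → ι × Bool
  flip : Dart → Dart
  head : Dart → Vertex
  list : List Dart
  start : Vertex
  finish : Vertex
  nodup : list.Nodup
  map_lab : list.map lab = W
  flip_mem : ∀ d ∈ list, flip d ∈ list
  flip_flip : ∀ d ∈ list, flip (flip d) = d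
  lab_flip : ∀ d ∈ list, lab (flip d) = flipLetter (lab d)
  walk : IsWalk (head ∘ flip) head start list finish
  card_le : list.length + 2 ≤ 2 * {v | v = start ∨ ∃ d ∈ list, head d = v}.ncard + 2 * c

namespace Folding

variable {c : ℕ} {W : Word ι}

theorem finite_of_list (l : List D) (head : D → V) (y : V) :
    {v | v = y ∨ ∃ d ∈ l, head d = v}.Finite := by
  refine ((List.finite_toSet (y :: l.map head))).subset ?_
  rintro v (rfl | ⟨d, hd, rfl⟩)
  · simp
  · simp only [List.mem_cons, List.mem_map, Set.mem_ofPred_eq]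
    exact Or.inr ⟨d, hd, rfl⟩

theorem flip_ne (f : Folding c W) {d : f.Dart} (hd : d ∈ f.list) : f.flip d ≠ d := fun h =>
  flipLetter_ne (f.lab d) (by rw [← f.lab_flip d hd, h])

theorem exists_list (f : Folding c W) {A B : Word ι} (h : W = A ++ B) :
    ∃ P Q, f.list = P ++ Q ∧ P.map f.lab = A ∧ Q.map f.lab = B := by
  exact List.map_eq_append_iff.1 (f.map_lab.trans h)

theorem ncard_le_of_subset_insert {s t : Set V} (v : V) (ht : t.Finite) (h : s ⊆ insert v t) :
    s.ncard ≤ t.ncard + 1 :=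
  (Set.ncard_le_ncard h (ht.insert v)).trans (Set.ncard_insert_le v t)

/-- The folding of the empty word. -/
def nil : Folding 0 ([] : Word ι) where
  Dart := Empty
  Vertex := Unit
  lab := Empty.elim
  flip := id
  head := Empty.elim
  list := []
  start := ()
  finish := ()
  nodup := by simp
  map_lab := rfl
  flip_mem := by simp
  flip_flip := by simp
  lab_flip := by simp
  walk := rfl
  card_le := by simp

theorem mono {c' : ℕ} (f : Folding c W) (h : c ≤ c') : Nonempty (Folding c' W) :=
  ⟨{ f with card_le := f.card_le.trans (by omega) }⟩

/-- The two new letters run along a spike attached at the vertex `m` between `A` and `B`. One edge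
and one vertex are added, so the rank does not change. -/
theorem insert_pair {A B : Word ι} (f : Folding c (A ++ B)) (x : ι × Bool) :
    Nonempty (Folding c (A ++ x :: flipLetter x :: B)) := by
  obtain ⟨P, Q, hl, hA, hB⟩ := f.exists_list rfl
  have hw := f.walk
  have hm := f.flip_mem
  have hn := f.nodup
  have hff := f.flip_flip
  have hlf := f.lab_flip
  have hc := f.card_le
  rw [hl] at hw hm hn hff hlf hc
  obtain ⟨m, hP, hQ⟩ := isWalk_append.1 hw
  let lab' : f.Dart ⊕ Bool → ι × Bool := Sum.elim f.lab fun b => if b then x else flipLetter x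
  let head' : f.Dart ⊕ Bool → Option f.Vertex :=
    Sum.elim (fun d => some (f.head d)) fun b => if b then none else some m
  let flip' : f.Dart ⊕ Bool → f.Dart ⊕ Bool := Sum.map f.flip not
  let list' : List (f.Dart ⊕ Bool) := P.map .inl ++ .inr true :: .inr false :: Q.map .inl
  have hmem : ∀ d, (Sum.inl d ∈ list' ↔ d ∈ P ++ Q) := by simp [list']
  have hr : ∀ b, (Sum.inr b ∈ list') := by simp [list']
  have himp : ∀ y z l, IsWalk (f.head ∘ f.flip) f.head y l z →
      IsWalk (head' ∘ flip') head' (some y) (l.map Sum.inl) (some z) := fun y z l h =>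
    h.map Sum.inl some (fun _ _ => rfl) fun _ _ => rfl
  refine ⟨⟨f.Dart ⊕ Bool, Option f.Vertex, lab', flip', head', list', some f.start, some f.finish,
    ?_, ?_, ?_, ?_, ?_, ?_, ?_⟩⟩
  · have h1 : (P.map Sum.inl ++ Q.map Sum.inl : List (f.Dart ⊕ Bool)).Nodup := by
      rw [← List.map_append]
      exact hn.map Sum.inl_injective
    have h2 : (.inr true :: .inr false :: (P.map Sum.inl ++ Q.map Sum.inl) :
      List (f.Dart ⊕ Bool)).Nodup := by simp [h1]
    refine (List.Perm.nodup_iff ?_).1 h2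
    exact (List.perm_middle.trans (List.Perm.cons _ List.perm_middle)).symm
  · simp [list', lab', Function.comp_def, hA, hB]
  · rintro (d | b) hd
    · exact (hmem _).2 (hm d ((hmem d).1 hd))
    · exact hr _
  · rintro (d | b) hd
    · exact congrArg Sum.inl (hff d ((hmem d).1 hd))
    · simp [flip']
  · rintro (d | b) hd
    · exact hlf d ((hmem d).1 hd)
    · cases b <;> simp [flip', lab']
  · exact isWalk_append.2 ⟨some m, himp _ _ _ hP, rfl, rfl, himp _ _ _ hQ⟩
  · have h1 : insert none (some '' {v | v = f.start ∨ ∃ d ∈ P ++ Q, f.head d = v}) ⊆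
        {v | v = some f.start ∨ ∃ d ∈ list', head' d = v} := by
      rintro v (rfl | ⟨v, rfl | ⟨d, hd, rfl⟩, rfl⟩)
      · exact Or.inr ⟨.inr true, hr _, rfl⟩
      · exact Or.inl rfl
      · exact Or.inr ⟨.inl d, (hmem d).2 hd, rfl⟩
    have h2 := Set.ncard_le_ncard h1 (finite_of_list list' head' (some f.start))
    rw [Set.ncard_insert_of_notMem (by simp) ((finite_of_list _ _ _).image _),
      Set.ncard_image_of_injective _ (Option.some_injective _)] at h2
    simp only [list', List.length_append, List.length_cons, List.length_map] at *
    omega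

/-- If the two letters are paired with each other, their edge is dropped. Otherwise they run over
two edges that carry the same letter into a common vertex; a Stallings fold makes these edges one,
and the former partners of the two letters become partners of each other. In both cases two letters
and at most one vertex are lost. -/
theorem delete_pair {A B : Word ι} {x : ι × Bool} (f : Folding c (A ++ x :: flipLetter x :: B)) :
    Nonempty (Folding c (A ++ B)) := by
  obtain ⟨P, Q', hl, hA, hQ'⟩ := f.exists_list rfl
  obtain ⟨d₁, Q'', rfl, hx, hQ''⟩ := List.map_eq_cons_iff.1 hQ'
  obtain ⟨d₂, Q, rfl, hlab, hB⟩ := List.map_eq_cons_iff.1 hQ''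
  replace hlab := hlab.trans (congrArg flipLetter hx.symm)
  have hw := f.walk
  have hm := f.flip_mem
  have hn := f.nodup
  have hff := f.flip_flip
  have hlf := f.lab_flip
  have hc := f.card_le
  have hne := fun d => f.flip_ne (d := d)
  rw [hl] at hw hm hn hff hlf hc hne
  have hperm : (P ++ d₁ :: d₂ :: Q).Perm (d₁ :: d₂ :: (P ++ Q)) :=
    List.perm_middle.trans (List.Perm.cons _ List.perm_middle)
  have hmem : ∀ d, d ∈ P ++ d₁ :: d₂ :: Q ↔ d = d₁ ∨ d = d₂ ∨ d ∈ P ++ Q := fun d => by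
    rw [hperm.mem_iff]; simp
  have hn' := hperm.nodup_iff.1 hn
  simp only [List.nodup_cons, List.mem_cons, not_or] at hn'
  obtain ⟨⟨h12, h1⟩, h2, hnPQ⟩ := hn'
  obtain ⟨m, hP, ht1, ht2, hQ⟩ := isWalk_append.1 hw
  simp only [Function.comp_apply] at ht1 ht2
  have m1 := (hmem d₁).2 (Or.inl rfl)
  have m2 := (hmem d₂).2 (Or.inr (Or.inl rfl))
  have mPQ : ∀ d ∈ P ++ Q, d ∈ P ++ d₁ :: d₂ :: Q := fun d hd => (hmem d).2 (Or.inr (Or.inr hd))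
  have ne1 : ∀ d ∈ P ++ Q, d ≠ d₁ := fun d hd h => h1 (h ▸ hd)
  have ne2 : ∀ d ∈ P ++ Q, d ≠ d₂ := fun d hd h => h2 (h ▸ hd)
  have hlen : (P ++ d₁ :: d₂ :: Q).length = (P ++ Q).length + 2 := by simp; omega
  have hinj : ∀ a ∈ P ++ d₁ :: d₂ :: Q, ∀ b ∈ P ++ d₁ :: d₂ :: Q, f.flip a = f.flip b → a = b :=
    fun a ha b hb h => by rw [← hff a ha, ← hff b hb, h]
  by_cases h : d₂ = f.flip d₁
  · have hflip : ∀ d ∈ P ++ Q, f.flip d ∈ P ++ Q := by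
      intro d hd
      rcases (hmem _).1 (hm d (mPQ d hd)) with h' | h' | h'
      · exact (ne2 d hd (by rw [h, ← h', hff d (mPQ d hd)])).elim
      · exact (ne1 d hd (hinj d (mPQ d hd) d₁ m1 (by rw [h', h]))).elim
      · exact h'
    refine ⟨⟨f.Dart, f.Vertex, f.lab, f.flip, f.head, P ++ Q, f.start, f.finish, hnPQ,
      by simp [hA, hB],
      hflip, fun d hd => hff d (mPQ d hd), fun d hd => hlf d (mPQ d hd), ?_, ?_⟩⟩
    · refine isWalk_append.2 ⟨m, hP, ?_⟩
      rwa [← ht1, ← h]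
    · have : {v | v = f.start ∨ ∃ d ∈ P ++ d₁ :: d₂ :: Q, f.head d = v} ⊆
          insert (f.head d₁) {v | v = f.start ∨ ∃ d ∈ P ++ Q, f.head d = v} := by
        rintro v (rfl | ⟨d, hd, rfl⟩)
        · exact Or.inr (Or.inl rfl)
        · rcases (hmem d).1 hd with rfl | rfl | hd
          · exact Or.inl rfl
          · right
            -- The vertex `m` between `P` and `Q` is still visited, either as the start or as the
            -- head of the last dart of `P`. Hence only the vertex `f.head d₁` can be lost.
            have hm2 : f.head d = m := by rw [← ht1, ← h]
            rw [hm2]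
            rcases List.eq_nil_or_concat P with rfl | ⟨P', p, rfl⟩
            · exact Or.inl hP.symm
            · rw [List.concat_eq_append] at hP ⊢
              obtain ⟨m', -, -, hp⟩ := isWalk_append.1 hP
              exact Or.inr ⟨p, by simp, hp⟩
          · exact Or.inr (Or.inr ⟨d, hd, rfl⟩)
      have := ncard_le_of_subset_insert _ (finite_of_list _ _ _) this
      omega
  · classical
    have h' : d₁ ≠ f.flip d₂ := fun e => h (by rw [e, hff d₂ m2])
    have e1 : f.flip d₁ ∈ P ++ Q := by
      rcases (hmem _).1 (hm d₁ m1) with e | e | e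
      · exact (hne _ m1 e).elim
      · exact (h e.symm).elim
      · exact e
    have e2 : f.flip d₂ ∈ P ++ Q := by
      rcases (hmem _).1 (hm d₂ m2) with e | e | e
      · exact (h' e.symm).elim
      · exact (hne _ m2 e).elim
      · exact e
    have e12 : f.flip d₁ ≠ f.flip d₂ := fun e => h12 (hinj _ m1 _ m2 e)
    let flip' : f.Dart → f.Dart := fun d =>
      if d = f.flip d₁ then f.flip d₂ else if d = f.flip d₂ then f.flip d₁ else f.flip d
    -- The folded edges share the vertex `f.head d₁`; the fold identifies their other ends `m` and
    -- `f.head d₂`.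
    let q : f.Vertex → f.Vertex := fun v => if v = f.head d₂ then m else v
    have f1 : flip' (f.flip d₁) = f.flip d₂ := by simp [flip']
    have f2 : flip' (f.flip d₂) = f.flip d₁ := by simp [flip', e12.symm]
    have f3 : ∀ d, d ≠ f.flip d₁ → d ≠ f.flip d₂ → flip' d = f.flip d := by
      intro d h3 h4; simp [flip', h3, h4]
    have n3 : ∀ d ∈ P ++ Q, d ≠ f.flip d₁ → d ≠ f.flip d₂ → f.flip d ∈ P ++ Q ∧
        f.flip d ≠ f.flip d₁ ∧ f.flip d ≠ f.flip d₂ := by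
      intro d hd h3 h4
      refine ⟨?_, fun e => ne1 d hd (hinj _ (mPQ d hd) _ m1 e),
        fun e => ne2 d hd (hinj _ (mPQ d hd) _ m2 e)⟩
      rcases (hmem _).1 (hm d (mPQ d hd)) with e | e | e
      · exact (h3 (by rw [← e, hff d (mPQ d hd)])).elim
      · exact (h4 (by rw [← e, hff d (mPQ d hd)])).elim
      · exact e
    have qm : q m = m := by simp [q]
    have q2 : q (f.head d₂) = m := by simp [q]
    have htail : ∀ d ∈ P ++ Q, ((q ∘ f.head) ∘ flip') d = q ((f.head ∘ f.flip) d) := by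
      intro d hd
      simp only [Function.comp_apply]
      by_cases h3 : d = f.flip d₁
      · rw [h3, f1, hff d₁ m1, ht2]
      by_cases h4 : d = f.flip d₂
      · rw [h4, f2, hff d₂ m2, ht1, q2, qm]
      rw [f3 d h3 h4]
    refine ⟨⟨f.Dart, f.Vertex, f.lab, flip', q ∘ f.head, P ++ Q, q f.start, q f.finish, hnPQ,
      by simp [hA, hB], ?_, ?_, ?_, ?_, ?_⟩⟩
    · intro d hd
      by_cases h3 : d = f.flip d₁
      · rwa [h3, f1]
      by_cases h4 : d = f.flip d₂
      · rwa [h4, f2]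
      rw [f3 d h3 h4]
      exact (n3 d hd h3 h4).1
    · intro d hd
      by_cases h3 : d = f.flip d₁
      · rw [h3, f1, f2]
      by_cases h4 : d = f.flip d₂
      · rw [h4, f2, f1]
      obtain ⟨-, h5, h6⟩ := n3 d hd h3 h4
      rw [f3 d h3 h4, f3 _ h5 h6, hff d (mPQ d hd)]
    · intro d hd
      by_cases h3 : d = f.flip d₁
      · rw [h3, f1, hlf d₁ m1, hlf d₂ m2, hlab]
      by_cases h4 : d = f.flip d₂
      · rw [h4, f2, hlf d₁ m1, hlf d₂ m2, hlab]; simp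
      rw [f3 d h3 h4, hlf d (mPQ d hd)]
    · refine isWalk_append.2 ⟨m, ?_, ?_⟩
      · rw [← qm]
        exact hP.imp q (fun d hd => htail d (by simp [hd])) fun d hd => rfl
      · rw [← q2]
        exact hQ.imp q (fun d hd => htail d (by simp [hd])) fun d hd => rfl
    · have : {v | v = f.start ∨ ∃ d ∈ P ++ d₁ :: d₂ :: Q, f.head d = v} ⊆
          insert (f.head d₂) {v | v = q f.start ∨ ∃ d ∈ P ++ Q, (q ∘ f.head) d = v} := by
        intro v hv
        by_cases hv2 : v = f.head d₂
        · exact Or.inl hv2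
        have hqv : q v = v := by simp [q, hv2]
        right
        rcases hv with rfl | ⟨d, hd, rfl⟩
        · exact Or.inl hqv.symm
        · rcases (hmem d).1 hd with rfl | rfl | hd
          · exact Or.inr ⟨f.flip d₂, e2, by rw [← hqv, ← ht2]; rfl⟩
          · exact (hv2 rfl).elim
          · exact Or.inr ⟨d, hd, hqv⟩
      have := ncard_le_of_subset_insert _ (finite_of_list _ _ _) this
      omega

/-- When the junctions `p`, `q` and `r` are identified, the two inner subwords become closed walks
at a single vertex and may be run through in either order. At most two vertices are lost, which
explains `c + 2`. -/
theorem swap {A B C E : Word ι} (f : Folding c (A ++ (B ++ (C ++ E)))) :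
    Nonempty (Folding (c + 2) (A ++ (C ++ (B ++ E)))) := by
  classical
  obtain ⟨P, Q', hl, hA, hQ'⟩ := f.exists_list rfl
  obtain ⟨Q, R', rfl, hB, hR'⟩ := List.map_eq_append_iff.1 hQ'
  obtain ⟨R, S, rfl, hC, hE⟩ := List.map_eq_append_iff.1 hR'
  have hw := f.walk
  rw [hl] at hw
  obtain ⟨p, hP, hw⟩ := isWalk_append.1 hw
  obtain ⟨q, hQ, hw⟩ := isWalk_append.1 hw
  obtain ⟨r, hR, hS⟩ := isWalk_append.1 hw
  let h : f.Vertex → f.Vertex := fun v => if v = q ∨ v = r then p else v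
  have hp : h p = p := by simp [h]
  have hq : h q = p := by simp [h]
  have hr : h r = p := by simp [h]
  have himp : ∀ y z l, IsWalk (f.head ∘ f.flip) f.head y l z →
      IsWalk ((h ∘ f.head) ∘ f.flip) (h ∘ f.head) (h y) l (h z) := fun y z l H =>
    H.imp h (fun _ _ => rfl) fun _ _ => rfl
  have hperm : (P ++ (R ++ (Q ++ S))).Perm f.list := by
    rw [hl]
    refine List.Perm.append_left P ?_
    simpa using List.Perm.append_right S (List.perm_append_comm : (R ++ Q).Perm (Q ++ R))
  refine ⟨⟨f.Dart, f.Vertex, f.lab, f.flip, h ∘ f.head, P ++ (R ++ (Q ++ S)), h f.start,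
    h f.finish, hperm.nodup_iff.2 f.nodup, by simp [hA, hB, hC, hE], fun d hd => hperm.mem_iff.2
      (f.flip_mem d (hperm.mem_iff.1 hd)), fun d hd => f.flip_flip d (hperm.mem_iff.1 hd),
      fun d hd => f.lab_flip d (hperm.mem_iff.1 hd), ?_, ?_⟩⟩
  · refine isWalk_append.2 ⟨p, hp ▸ himp _ _ _ hP, isWalk_append.2 ⟨p, ?_, isWalk_append.2
      ⟨p, ?_, hr ▸ himp _ _ _ hS⟩⟩⟩
    · have := himp _ _ _ hR
      rwa [hq, hr] at this
    · have := himp _ _ _ hQ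
      rwa [hp, hq] at this
  · have hc := f.card_le
    rw [hperm.length_eq]
    have : {v | v = f.start ∨ ∃ d ∈ f.list, f.head d = v} ⊆ insert q (insert r
        {v | v = h f.start ∨ ∃ d ∈ P ++ (R ++ (Q ++ S)), (h ∘ f.head) d = v}) := by
      intro v hv
      by_cases hv2 : v = q ∨ v = r
      · rcases hv2 with hv2 | hv2
        · exact Or.inl hv2
        · exact Or.inr (Or.inl hv2)
      have hqv : h v = v := by simp [h, hv2]
      right; right
      rcases hv with rfl | ⟨d, hd, rfl⟩
      · exact Or.inl hqv.symm
      · exact Or.inr ⟨d, hperm.mem_iff.2 hd, hqv⟩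
    have h1 := ncard_le_of_subset_insert _ ((finite_of_list _ _ _).insert _) this
    have h2 := Set.ncard_insert_le r {v | v = h f.start ∨ ∃ d ∈ P ++ (R ++ (Q ++ S)), (h ∘ f.head) d = v}
    omega

theorem delete_inv {A B U : Word ι} (f : Folding c (A ++ (U ++ (FreeGroup.invRev U ++ B)))) :
    Nonempty (Folding c (A ++ B)) := by
  induction U using List.reverseRecOn with
  | nil => exact ⟨f⟩
  | append_singleton U x ih =>
    have h : A ++ (U ++ [x] ++ (FreeGroup.invRev (U ++ [x]) ++ B)) =
        (A ++ U) ++ x :: flipLetter x :: (FreeGroup.invRev U ++ B) := by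
      simp [FreeGroup.invRev, flipLetter]
    rw [h] at f
    obtain ⟨f⟩ := f.delete_pair
    exact ih (by simpa using f)

/-- Undoing the cancellations one by one, starting from the empty word, grows a tree. -/
theorem of_red (h : FreeGroup.Red W []) : Nonempty (Folding 0 W) := by
  induction h using Relation.ReflTransGen.head_induction_on with
  | refl => exact ⟨nil⟩
  | head h _ ih =>
    obtain ⟨f⟩ := ih
    rcases h with ⟨⟩
    exact f.insert_pair _

end Folding

variable {F : Type u} [Group F] (b : FreeGroupBasis ι F)

theorem repr_evalWord (w : Word ι) : b.repr (evalWord b w) = FreeGroup.mk w := by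
  induction w with
  | nil => exact map_one _
  | cons a w ih =>
    have : evalWord b (a :: w) = (if a.2 then b a.1 else (b a.1)⁻¹) * evalWord b w := by
      simp [evalWord]
    rw [this, map_mul, ih]
    rcases a with ⟨i, _ | _⟩
    · simp only [Bool.false_eq_true, if_false, map_inv, FreeGroupBasis.repr_apply_coe, FreeGroup.of,
        FreeGroup.inv_mk, FreeGroup.mul_mk]
      rfl
    · simp only [if_true, FreeGroupBasis.repr_apply_coe, FreeGroup.of, FreeGroup.mul_mk]
      rfl

theorem evalWord_surjective : Function.Surjective (evalWord b) := fun g => by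
  classical
  refine ⟨(b.repr g).toWord, b.repr.injective ?_⟩
  rw [repr_evalWord, FreeGroup.mk_toWord]

theorem evalWord_eq_iff {w w' : Word ι} :
    evalWord b w = evalWord b w' ↔ FreeGroup.mk w = FreeGroup.mk w' := by
  rw [← repr_evalWord b, ← repr_evalWord b, b.repr.injective.eq_iff]

theorem evalWord_invRev (w : Word ι) : evalWord b (FreeGroup.invRev w) = (evalWord b w)⁻¹ := by
  apply b.repr.injective
  rw [repr_evalWord, map_inv, repr_evalWord, FreeGroup.inv_mk]

theorem folding_of_eval_eq_one {w : Word ι} (h : evalWord b w = 1) : Nonempty (Folding 0 w) := by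
  apply Folding.of_red
  rw [show (1 : F) = evalWord b [] by simp [evalWord], evalWord_eq_iff, FreeGroup.Red.exact] at h
  obtain ⟨c, h1, h2⟩ := h
  rwa [FreeGroup.Red.nil_iff.1 h2] at h1

/-- One `swap` turns a factor `U w U⁻¹` into `w U U⁻¹`, and then the conjugator cancels, so each
factor costs 2. The prefix `A` collects the factors that are already free of their conjugators. -/
theorem folding_of_conjProd {l : List (Word ι)} {g : F} {A : Word ι} {c : ℕ}
    (h : ConjProd (l.map (evalWord b)) g)
    (H : ∀ B, evalWord b B = g → Nonempty (Folding c (A ++ B))) :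
    Nonempty (Folding (c + 2 * l.length) (A ++ l.flatten)) := by
  induction l generalizing A c g with
  | nil => exact H [] (by rw [conjProd_nil.1 h]; simp [evalWord])
  | cons w l ih =>
    rw [List.map_cons, conjProd_cons] at h
    obtain ⟨u, h, hl, rfl⟩ := h
    obtain ⟨U, rfl⟩ := evalWord_surjective b u
    obtain ⟨f⟩ := ih (A := A ++ w) (c := c + 2) hl fun B hB => by
      obtain ⟨f⟩ := H (U ++ (w ++ (FreeGroup.invRev U ++ B))) (by
        simp [evalWord_append, evalWord_invRev, hB, mul_assoc])
      obtain ⟨f⟩ := f.swap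
      have f' : Folding (c + 2) ((A ++ w) ++ (U ++ (FreeGroup.invRev U ++ B))) := by
        simpa using f
      exact f'.delete_inv
    refine (by simpa using f : Folding _ _).mono ?_
    simp; omega

/-- Multiplying `w` by the inverse of the first commutator spells the remaining product, which folds
by induction. A single `swap` puts the two entries of the commutator next to their inverses, where
they cancel and leave `w`; thus one commutator costs 2. -/
theorem folding_of_commProd {k : ℕ} {g : F} (h : CommProd k g) {w : Word ι} (hw : evalWord b w = g) :
    Nonempty (Folding (2 * k) w) := by
  obtain ⟨l, hl, rfl⟩ := h
  suffices ∀ w, evalWord b w = (l.map fun p => ⁅p.1, p.2⁆).prod →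
      Nonempty (Folding (2 * l.length) w) by
    obtain ⟨f⟩ := this w hw
    exact f.mono (by omega)
  clear hw hl
  induction l with
  | nil =>
    intro w h
    exact folding_of_eval_eq_one b (by simpa using h)
  | cons p l ih =>
    intro w h
    obtain ⟨X, hX⟩ := evalWord_surjective b p.1
    obtain ⟨Y, hY⟩ := evalWord_surjective b p.2
    obtain ⟨f⟩ := ih (Y ++ (X ++ (FreeGroup.invRev Y ++ (FreeGroup.invRev X ++ w)))) (by
      simp [evalWord_append, evalWord_invRev, hX, hY, h, commutatorElement_def, mul_assoc])
    obtain ⟨f⟩ := f.swap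
    obtain ⟨f⟩ := Folding.delete_inv (A := []) f
    obtain ⟨f⟩ := Folding.delete_inv (A := []) f
    exact ⟨f⟩

end Foldings

/-! ### From bounds on commutator length to rational tilings -/

section Extraction

variable {ι : Type v} {I : Type} [Fintype I] [DecidableEq I] {ws : I → Word ι}

theorem sum_indicator₃ {X P : Type*} [Fintype P] [DecidableEq P] (s : Finset X) (p q r : X → P)
    (f : P → P → P → ℚ) :
    ∑ a, ∑ b, ∑ c, (∑ x ∈ s, if p x = a ∧ q x = b ∧ r x = c then (1 : ℚ) else 0) * f a b c =
      ∑ x ∈ s, f (p x) (q x) (r x) := by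
  have : ∀ x, f (p x) (q x) (r x) =
      ∑ a, ∑ b, ∑ c, (if p x = a ∧ q x = b ∧ r x = c then (1 : ℚ) else 0) * f a b c := by
    intro x
    simp [ite_and]
  simp_rw [this, Finset.sum_mul]
  symm
  rw [Finset.sum_comm]
  refine Finset.sum_congr rfl fun a _ => ?_
  rw [Finset.sum_comm]
  refine Finset.sum_congr rfl fun b _ => ?_
  rw [Finset.sum_comm]

theorem sum_indicator₂ {X P : Type*} [Fintype P] [DecidableEq P] (s : Finset X) (p q : X → P)
    (f : P → P → ℚ) :
    ∑ a, ∑ b, (∑ x ∈ s, if p x = a ∧ q x = b then (1 : ℚ) else 0) * f a b =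
      ∑ x ∈ s, f (p x) (q x) := by
  have : ∀ x, f (p x) (q x) =
      ∑ a, ∑ b, (if p x = a ∧ q x = b then (1 : ℚ) else 0) * f a b := by
    intro x
    simp [ite_and]
  simp_rw [this, Finset.sum_mul]
  symm
  rw [Finset.sum_comm]
  refine Finset.sum_congr rfl fun a _ => ?_
  rw [Finset.sum_comm]

theorem sideSign_swap {P : Type*} [DecidableEq P] (u v a b : P) :
    sideSign ℚ u v b a = - sideSign ℚ u v a b := by
  simp only [sideSign, and_comm (a := b = u), and_comm (a := b = v)]
  ring

theorem sideSign_self {P : Type*} [DecidableEq P] (u v a : P) : sideSign ℚ u v a a = 0 := by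
  simp only [sideSign, and_comm (a := a = u)]
  ring

/-- A set of letters with a successor permutation and a pairing of inverse letters yields a
rational tiling, whose triangles subdivide the polygons dual to the vertices. -/
theorem exists_isTiling_of_perm {X V : Type} [Fintype X] [DecidableEq X]
    (S φ : Equiv.Perm X) (t : X → Pos ws) (hφ : ∀ x, φ (φ x) = x)
    (hlet : ∀ x, (t (φ x)).letter = flipLetter (t x).letter) (hnext : ∀ x, t (S x) = (t x).next)
    (hred : ∀ p : Pos ws, p.next.letter ≠ flipLetter p.letter)
    (vert : X → V) (hvert : ∀ x, vert (S (φ x)) = vert x) :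
    ∃ (R : Pos ws → Pos ws → ℚ) (T : Pos ws → Pos ws → Pos ws → ℚ), IsTiling R T ∧
      (∀ a b, 0 ≤ R a b) ∧ (∀ a b c, 0 ≤ T a b c) ∧
      (∀ p, sideCount R p = ∑ x, if t x = p then 1 else 0) ∧
      ∑ a, ∑ b, ∑ c, T a b c + 2 * (Set.range vert).ncard ≤ Fintype.card X := by
  -- The cycles of `ρ` are the vertices of a ribbon graph: the partner of `x` ends where `x` starts,
  -- so the letter after it starts there too.
  set ρ : Equiv.Perm X := φ.trans S with hρ
  have hρx : ∀ x, ρ x = S (φ x) := fun x => rfl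
  let rep : X → X := fun x => (Quotient.mk (Equiv.Perm.SameCycle.setoid ρ) x).out
  have hrep : ∀ x, ρ.SameCycle (rep x) x := fun x => Quotient.mk_out (s := Equiv.Perm.SameCycle.setoid ρ) x
  have hrep_eq : ∀ x y, ρ.SameCycle x y → rep x = rep y := fun x y h =>
    congrArg Quotient.out (Quotient.sound (s := Equiv.Perm.SameCycle.setoid ρ) h)
  have hrepρ : ∀ x, rep (ρ x) = rep x := fun x => hrep_eq _ _
    (Equiv.Perm.sameCycle_apply_left.2 (Equiv.Perm.SameCycle.refl _ _))
  have hreprep : ∀ x, rep (rep x) = rep x := fun x => hrep_eq _ _ (hrep x)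
  have hvz : ∀ (n : ℕ) x, vert ((ρ ^ n) x) = vert x := by
    intro n
    induction n with
    | zero => simp
    | succ n ih =>
      intro x
      rw [pow_succ, Equiv.Perm.mul_apply, ih, hρx, hvert]
  have hvrep : ∀ x, vert (rep x) = vert x := fun x => by
    obtain ⟨n, -, -, hn⟩ := (hrep x).exists_pow_eq''
    conv_rhs => rw [← hn, hvz]
  -- A vertex with only one letter would come from two consecutive letters that cancel, contrary to
  -- `hred`.
  have hfix : ∀ x, ρ x ≠ x := by
    intro x hx
    have h1 := hlet (φ x)
    rw [hφ] at h1
    have h2 := hnext (φ x)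
    rw [← hρx, hx] at h2
    exact hred (t (φ x)) (by rw [← h2, h1])
  -- The polygon dual to a cycle is divided by the diagonals from its corner `rep x`. The two
  -- polygon sides at this corner span no triangle, so a cycle of length `l` yields `l - 2`
  -- triangles.
  set s : Finset X := {x | x ≠ rep x ∧ ρ x ≠ rep x} with hs
  have hcard : s.card + 2 * (Set.range vert).ncard ≤ Fintype.card X := by
    set A : Finset X := {x | x = rep x} with hA
    set B : Finset X := {x | ρ x = rep x} with hB
    have hAB : A.card = B.card := by
      symm
      refine Finset.card_bij (fun x _ => ρ x) ?_ (fun x _ y _ h => ρ.injective h) ?_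
      · intro x hx
        simpa [hA, hB, hrepρ] using hx
      · intro y hy
        obtain ⟨x, rfl⟩ := ρ.surjective y
        exact ⟨x, by simpa [hA, hB, hrepρ] using hy, rfl⟩
    have hd : Disjoint A B := by
      rw [Finset.disjoint_left]
      intro x hx hx'
      simp only [hA, hB, Finset.mem_filter, Finset.mem_univ, true_and] at hx hx'
      exact hfix x (hx'.trans hx.symm)
    have hsc : s = (A ∪ B)ᶜ := by
      ext x
      simp [hs, hA, hB]
    have h1 : s.card + (A.card + B.card) = Fintype.card X := by
      rw [hsc, ← Finset.card_union_of_disjoint hd, Finset.card_compl_add_card]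
    have h2 : (Set.range vert).ncard ≤ A.card := by
      have : Set.range vert ⊆ vert '' (A : Set X) := by
        rintro _ ⟨x, rfl⟩
        exact ⟨rep x, by simp [hA, hreprep], hvrep x⟩
      calc (Set.range vert).ncard ≤ (vert '' (A : Set X)).ncard := Set.ncard_le_ncard this
            (Set.toFinite _)
        _ ≤ (A : Set X).ncard := Set.ncard_image_le (Set.toFinite _)
        _ = A.card := Set.ncard_coe_finset A
    omega
  -- Every rectangle is seen once from `x` and once from `φ x`, hence the factor 1/2.
  refine ⟨fun a b => (1 / 2) * ∑ x : X, if t x = a ∧ t (φ x) = b then (1 : ℚ) else 0,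
    fun a b c => ∑ x ∈ s, if t (rep x) = a ∧ t x = b ∧ t (ρ x) = c then (1 : ℚ) else 0,
    ⟨?_, ?_⟩, ?_, ?_, ?_, ?_⟩
  · intro a b hab
    rw [Finset.sum_eq_zero, mul_zero]
    intro x _
    rw [if_neg]
    rintro ⟨rfl, rfl⟩
    exact hab (hlet x)
  · intro u v
    rw [sum_indicator₃ s (fun x => t (rep x)) t (fun x => t (ρ x))
      fun a b c => sideSign ℚ u v a b + sideSign ℚ u v b c + sideSign ℚ u v c a]
    simp only [mul_assoc, ← Finset.mul_sum]
    rw [sum_indicator₂ Finset.univ t (fun x => t (φ x))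
      fun a b => sideSign ℚ u v b.next a + sideSign ℚ u v a.next b]
    -- The degenerate triangles outside `s` have zero signed boundary, so the sum may run over all
    -- `x`. Then the diagonals cancel along the cycles of `ρ`, and the outer sides cancel against
    -- the sides of the rectangles.
    have h1 : ∑ x ∈ s, (sideSign ℚ u v (t (rep x)) (t x) + sideSign ℚ u v (t x) (t (ρ x)) +
        sideSign ℚ u v (t (ρ x)) (t (rep x))) = ∑ x, (sideSign ℚ u v (t (rep x)) (t x) +
          sideSign ℚ u v (t x) (t (ρ x)) + sideSign ℚ u v (t (ρ x)) (t (rep x))) := by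
      refine Finset.sum_subset (Finset.subset_univ _) fun x _ hx => ?_
      simp only [hs, Finset.mem_filter, Finset.mem_univ, true_and, not_and_or, not_not] at hx
      rcases hx with hx | hx
      · rw [← hx, sideSign_self, sideSign_swap u v (t x) (t (ρ x))]
        ring
      · rw [hx, sideSign_self, sideSign_swap u v (t x) (t (rep x))]
        ring
    have h2 : ∑ x, sideSign ℚ u v (t (ρ x)) (t (rep x)) =
        - ∑ x, sideSign ℚ u v (t (rep x)) (t x) := by
      rw [← Equiv.sum_comp ρ fun x => sideSign ℚ u v (t (rep x)) (t x), ← Finset.sum_neg_distrib]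
      refine Finset.sum_congr rfl fun x _ => ?_
      rw [hrepρ, sideSign_swap]
    have h3 : ∀ x, (t (φ x)).next = t (ρ x) := fun x => by rw [hρx, hnext]
    have h4 : ∑ x, sideSign ℚ u v (t x).next (t (φ x)) = ∑ x, sideSign ℚ u v (t (ρ x)) (t x) := by
      rw [← Equiv.sum_comp φ fun x => sideSign ℚ u v (t x).next (t (φ x))]
      simp only [hφ, h3]
    have h5 : ∑ x, sideSign ℚ u v (t x) (t (ρ x)) = - ∑ x, sideSign ℚ u v (t (ρ x)) (t x) := by
      rw [← Finset.sum_neg_distrib]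
      exact Finset.sum_congr rfl fun x _ => sideSign_swap _ _ _ _
    rw [h1, Finset.sum_add_distrib, Finset.sum_add_distrib, h2, Finset.sum_add_distrib, h4, h5]
    simp only [h3]
    ring
  · intro a b
    exact mul_nonneg (by norm_num) (Finset.sum_nonneg fun x _ => by split_ifs <;> norm_num)
  · intro a b c
    exact Finset.sum_nonneg fun x _ => by split_ifs <;> norm_num
  · intro p
    have h1 : ∑ b, ∑ x : X, (if t x = p ∧ t (φ x) = b then (1 : ℚ) else 0) =
        ∑ x, if t x = p then 1 else 0 := by
      rw [Finset.sum_comm]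
      refine Finset.sum_congr rfl fun x _ => ?_
      simp [ite_and]
    have h2 : ∑ b, ∑ x : X, (if t x = b ∧ t (φ x) = p then (1 : ℚ) else 0) =
        ∑ x, if t x = p then 1 else 0 := by
      rw [Finset.sum_comm, ← Equiv.sum_comp φ]
      refine Finset.sum_congr rfl fun x _ => ?_
      simp [hφ, ite_and]
    rw [sideCount, Finset.sum_add_distrib, ← Finset.mul_sum, ← Finset.mul_sum, h1, h2]
    ring
  · have := sum_indicator₃ s (fun x => t (rep x)) t (fun x => t (ρ x)) fun _ _ _ => 1
    simp only [mul_one] at this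
    rw [this]
    simp only [Finset.sum_const, nsmul_eq_mul, mul_one]
    exact_mod_cast hcard

theorem exists_of_map_eq_flatten {α β : Type*} {f : α → β} {l : List α} {L : List (List β)}
    (h : l.map f = L.flatten) : ∃ l' : List (List α), l'.flatten = l ∧ l'.map (List.map f) = L := by
  induction L generalizing l with
  | nil => exact ⟨[], by simpa using h.symm, rfl⟩
  | cons w L ih =>
    rw [List.flatten_cons, List.map_eq_append_iff] at h
    obtain ⟨a, r, rfl, rfl, hr⟩ := h
    obtain ⟨l', rfl, rfl⟩ := ih hr
    exact ⟨a :: l', rfl, rfl⟩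

/-- The set `J` consists of the end points of the blocks. Their number is bounded by the number of
blocks alone, so identifying them later makes every block a closed walk at a bounded price. -/
theorem IsWalk.exists_junctions {D V : Type} {tail head : D → V} {y z : V} {l : List (List D)}
    (h : IsWalk tail head y l.flatten z) : ∃ J : Finset V, y ∈ J ∧ J.card ≤ l.length + 1 ∧
      ∀ B ∈ l, ∃ p ∈ J, ∃ q ∈ J, IsWalk tail head p B q := by
  classical
  induction l generalizing y with
  | nil => exact ⟨{y}, by simp⟩
  | cons B l ih =>
    obtain ⟨m, h1, h2⟩ := isWalk_append.1 h
    obtain ⟨J, hm, hJ, H⟩ := ih h2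
    refine ⟨insert y J, by simp, (Finset.card_insert_le _ _).trans (by simpa using hJ), ?_⟩
    rintro B' hB'
    rcases List.mem_cons.1 hB' with rfl | hB'
    · exact ⟨y, by simp, m, by simp [hm], h1⟩
    · obtain ⟨p, hp, q, hq, hw⟩ := H B' hB'
      exact ⟨p, by simp [hp], q, by simp [hq], hw⟩

theorem IsWalk.getElem {D V : Type} {tail head : D → V} {y z : V} {l : List D}
    (h : IsWalk tail head y l z) : (∀ h0 : 0 < l.length, tail l[0] = y ∧ head l[l.length - 1] = z) ∧
      ∀ r (hr : r + 1 < l.length), tail l[r + 1] = head l[r] := by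
  induction l generalizing y with
  | nil => simp
  | cons d l ih =>
    obtain ⟨h1, h2⟩ := h
    obtain ⟨h3, h4⟩ := ih h2
    rcases l with _ | ⟨e, l⟩
    · exact ⟨fun _ => ⟨h1, h2⟩, by simp⟩
    · refine ⟨fun _ => ⟨h1, ?_⟩, fun r hr => ?_⟩
      · simpa using (h3 (by simp)).2
      · rcases r with _ | r
        · exact (h3 (by simp)).1
        · exact h4 r (by simpa using hr)

theorem IsWalk.getElem_mod {D V : Type} {tail head : D → V} {y : V} {l : List D}
    (h : IsWalk tail head y l y) (r : ℕ) (hr : r < l.length) :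
    tail (l[(r + 1) % l.length]'(Nat.mod_lt _ (by omega))) = head l[r] := by
  obtain ⟨h1, h2⟩ := h.getElem
  by_cases hr' : r + 1 < l.length
  · simp only [Nat.mod_eq_of_lt hr', h2 r hr']
  · have : r + 1 = l.length := by omega
    obtain ⟨h3, h4⟩ := h1 (by omega)
    simp only [this, Nat.mod_self, h3]
    rw [← h4]
    congr 2
    omega

theorem getElem?_flatten_replicate {α : Type*} (w : List α) (n r : ℕ) (hr : r < n * w.length) :
    (List.replicate n w).flatten[r]? = w[r % w.length]? := by
  induction n generalizing r with
  | zero => simp at hr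
  | succ n ih =>
    rw [List.replicate_succ, List.flatten_cons]
    have hr' : r < n * w.length + w.length := by rwa [← Nat.succ_mul]
    by_cases h : r < w.length
    · rw [List.getElem?_append_left h, Nat.mod_eq_of_lt h]
    · rw [List.getElem?_append_right (by omega), ih (r - w.length) (by omega),
        ← Nat.mod_eq_sub_mod (by omega : r ≥ w.length)]

theorem coe_finRotate_eq_mod {n : ℕ} (i : Fin n) : (finRotate n i : ℕ) = (i + 1) % n := by
  rcases n with _ | n
  · exact i.elim0
  · rw [finRotate_apply, Fin.val_add]
    simp

theorem card_filter_mod {m n L s : ℕ} (hm : m = n * L) (hs : s < L) :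
    ∑ r : Fin m, (if (r : ℕ) % L = s then (1 : ℚ) else 0) = n := by
  subst hm
  rw [Fin.sum_univ_eq_sum_range fun r => if r % L = s then (1 : ℚ) else 0, Finset.sum_boole]
  have := Nat.count_modEq_card (n * L) (show 0 < L by omega) s
  rw [Nat.count_eq_card_filter_range] at this
  simp only [Nat.ModEq, Nat.mod_eq_of_lt hs, Nat.mul_mod_left, Nat.not_lt_zero, if_false,
    Nat.mul_div_cancel n (show 0 < L by omega), add_zero] at this
  exact_mod_cast this

omit [Fintype I] [DecidableEq I] in
theorem Pos.next_letter_ne (h : ∀ i, FreeGroup.IsCyclicallyReduced (ws i)) (p : Pos ws) :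
    p.next.letter ≠ flipLetter p.letter := by
  obtain ⟨i, k, hk⟩ := p
  obtain ⟨h1, h2⟩ := h i
  intro he
  simp only [Pos.letter, Pos.next, Fin.getElem_fin] at he
  by_cases hk' : k + 1 < (ws i).length
  · simp only [Nat.mod_eq_of_lt hk'] at he
    have := List.isChain_iff_getElem.1 h1 k hk'
    rw [he] at this
    simp [flipLetter] at this
  · have hk2 : k + 1 = (ws i).length := by omega
    simp only [hk2, Nat.mod_self] at he
    have := h2 (ws i)[k] (by rw [List.getLast?_eq_getElem?]; simp [← hk2]) (ws i)[0]
      (by rw [List.head?_eq_getElem?]; simp)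
    rw [he] at this
    simp [flipLetter] at this

omit [Fintype I] in
theorem sum_getElem_eq_count (l : List I) (i : I) :
    ∑ j : Fin l.length, (if l[j.1] = i then (1 : ℚ) else 0) = l.count i := by
  rw [Fin.sum_univ_fun_getElem l fun x => if x = i then (1 : ℚ) else 0]
  induction l with
  | nil => simp
  | cons a l ih =>
    by_cases h : a = i <;> simp [ih, h, add_comm]

/-- The position in a cyclic word with a given number. -/
def Pos.ofMod (i : I) (r : ℕ) (h : 0 < (ws i).length) : Pos ws := ⟨i, ⟨r % _, Nat.mod_lt _ h⟩⟩

omit [Fintype I] [DecidableEq I] in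
theorem Pos.next_ofMod (i : I) (r : ℕ) (h : 0 < (ws i).length) :
    (Pos.ofMod i r h).next = Pos.ofMod i (r + 1) h := by
  simp [Pos.next, Pos.ofMod]

omit [Fintype I] [DecidableEq I] in
theorem Pos.ofMod_congr {i : I} {r r' : ℕ} (h : 0 < (ws i).length)
    (hr : r % (ws i).length = r' % (ws i).length) : Pos.ofMod i r h = Pos.ofMod i r' h := by
  simp [Pos.ofMod, hr]

variable {F : Type u} [Group F] (b : FreeGroupBasis ι F)

theorem evalWord_flatten_replicate (w : Word ι) (n : ℕ) :
    evalWord b (List.replicate n w).flatten = evalWord b w ^ n := by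
  induction n with
  | zero => simp [evalWord]
  | succ n ih => rw [List.replicate_succ, List.flatten_cons, evalWord_append, ih, pow_succ']

/-- Every surface bounding powers of cyclically reduced words gives rise to a rational tiling. -/
theorem exists_isTiling_of_bounds (hws : ∀ i, FreeGroup.IsCyclicallyReduced (ws i)) (l : List I)
    (n k : ℕ) (h : Bounds k ((l.map fun i => evalWord b (ws i) ^ n : List F) : Multiset F)) :
    ∃ (R : Pos ws → Pos ws → ℚ) (T : Pos ws → Pos ws → Pos ws → ℚ), IsTiling R T ∧
      (∀ a b, 0 ≤ R a b) ∧ (∀ a b c, 0 ≤ T a b c) ∧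
      (∀ p, sideCount R p = n * l.count p.1) ∧
      ∑ a, ∑ b, ∑ c, T a b c ≤ 4 * k + 6 * l.length + 4 := by
  classical
  obtain ⟨l', hl', g, hg, hk⟩ := h
  replace hg := hg.perm (Multiset.coe_eq_coe.1 hl')
  have hpow : ∀ i, evalWord b (ws i) ^ n = evalWord b (List.replicate n (ws i)).flatten := by
    exact fun i => (evalWord_flatten_replicate b _ _).symm
  have hmap : (l.map fun i => evalWord b (ws i) ^ n) =
      (l.map fun i => (List.replicate n (ws i)).flatten).map (evalWord b) := by
    simp [hpow]
  rw [hmap] at hg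
  obtain ⟨f⟩ := folding_of_conjProd b (A := []) (c := 2 * k) hg fun B hB =>
    folding_of_commProd b hk hB
  rw [List.length_map] at f
  obtain ⟨L, hL, hLlab⟩ := exists_of_map_eq_flatten (f.map_lab.trans (List.nil_append _))
  have hw := f.walk
  rw [← hL] at hw
  obtain ⟨J, hJ, hJc, hJw⟩ := hw.exists_junctions
  have hLl : L.length = l.length := by simpa using congrArg List.length hLlab
  have hLj : ∀ j (hj : j < L.length), L[j].map f.lab =
      (List.replicate n (ws (l[j]'(hLl ▸ hj)))).flatten := by
    intro j hj
    have := List.getElem_of_eq hLlab (i := j) (by simpa using hj)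
    simpa using this
  have hlen : ∀ j (hj : j < L.length), L[j].length = n * (ws (l[j]'(hLl ▸ hj))).length := by
    intro j hj
    simpa using congrArg List.length (hLj j hj)
  have hpos : ∀ j (hj : j < L.length), 0 < L[j].length → 0 < (ws (l[j]'(hLl ▸ hj))).length := by
    intro j hj hr
    refine Nat.pos_of_ne_zero fun h => ?_
    rw [hlen j hj, h] at hr
    simp at hr
  have hl2 : ∀ j < L.length, j < l.length := fun j hj => hLl ▸ hj
  let X : Type := Σ j : Fin L.length, Fin L[j.1].length
  let dart : X → f.Dart := fun x => L[x.1.1][x.2.1]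
  have hdart : ∀ x, dart x ∈ f.list := fun x => by
    rw [← hL, List.mem_flatten]
    exact ⟨_, List.getElem_mem _, List.getElem_mem _⟩
  have hsurj : ∀ d ∈ f.list, ∃ x, dart x = d := by
    intro d hd
    rw [← hL, List.mem_flatten] at hd
    obtain ⟨B, hB, hd⟩ := hd
    obtain ⟨j, hj, rfl⟩ := List.getElem_of_mem hB
    obtain ⟨r, hr, rfl⟩ := List.getElem_of_mem hd
    exact ⟨⟨⟨j, hj⟩, ⟨r, hr⟩⟩, rfl⟩
  have hnd := f.nodup
  rw [← hL, List.nodup_flatten] at hnd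
  have hinj : Function.Injective dart := by
    rintro ⟨⟨j, hj⟩, ⟨r, hr⟩⟩ ⟨⟨j', hj'⟩, ⟨r', hr'⟩⟩ he
    have hjj : j = j' := by
      by_contra hne
      have hd : List.Disjoint L[j] L[j'] := by
        rcases Nat.lt_or_gt_of_ne hne with h | h
        · exact List.pairwise_iff_getElem.1 hnd.2 j j' hj hj' h
        · exact (List.pairwise_iff_getElem.1 hnd.2 j' j hj' hj h).symm
      refine hd (List.getElem_mem hr) ?_
      have : L[j][r] = L[j'][r'] := he
      rw [this]
      exact List.getElem_mem hr'
    subst hjj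
    have : r = r' := (hnd.1 _ (List.getElem_mem hj)).getElem_inj_iff.1 he
    subst this
    rfl
  choose φ₀ hφ₀ using fun x : X => hsurj (f.flip (dart x)) (f.flip_mem _ (hdart x))
  have hφφ : Function.Involutive φ₀ := fun x => hinj (by
    rw [hφ₀, hφ₀, f.flip_flip _ (hdart x)])
  let φ : Equiv.Perm X := hφφ.toPerm
  let S : Equiv.Perm X := Equiv.sigmaCongrRight fun j => finRotate _
  have hS : ∀ j (hj : j < L.length) r, S ⟨⟨j, hj⟩, r⟩ = ⟨⟨j, hj⟩, finRotate _ r⟩ :=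
    fun _ _ _ => rfl
  let t : X → Pos ws := fun x => Pos.ofMod (l[x.1.1]'(hl2 _ x.1.2)) x.2.1
    (hpos x.1.1 x.1.2 x.2.pos)
  have hlett : ∀ x, (t x).letter = f.lab (dart x) := by
    rintro ⟨⟨j, hj⟩, ⟨r, hr⟩⟩
    have h1 := hLj j hj
    have hr' : r < n * (ws (l[j]'(hLl ▸ hj))).length := by
      rw [← hlen j hj]
      exact hr
    have h2 := getElem?_flatten_replicate (ws (l[j]'(hLl ▸ hj))) n r hr'
    have hr2 : r < L[j].length := hr
    rw [← h1, List.getElem?_map, List.getElem?_eq_getElem hr2,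
      List.getElem?_eq_getElem (Nat.mod_lt _ (hpos j hj (by omega)))] at h2
    simpa [t, dart, Pos.letter, Pos.ofMod] using h2.symm
  have hnext : ∀ x, t (S x) = (t x).next := by
    rintro ⟨⟨j, hj⟩, r⟩
    have h0 : (finRotate _ r : ℕ) = (r + 1) % L[j].length := coe_finRotate_eq_mod r
    simp only [t, hS]
    rw [Pos.next_ofMod]
    refine Pos.ofMod_congr _ ?_
    rw [h0]
    exact Nat.mod_mod_of_dvd _ ⟨n, (hlen j hj).trans (mul_comm _ _)⟩
  -- All junctions are identified with the start. Every block becomes a closed walk, so that the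
  -- cyclic successor `S` within a block is compatible with the vertices. This loses at most
  -- `l.length + 1` vertices, whatever `n` is.
  let q : f.Vertex → f.Vertex := fun v => if v ∈ J then f.start else v
  have hblock : ∀ B ∈ L, IsWalk (q ∘ f.head ∘ f.flip) (q ∘ f.head) f.start B f.start := by
    intro B hB
    obtain ⟨y, hy, z, hz, hyz⟩ := hJw B hB
    have := hyz.imp (tail' := q ∘ f.head ∘ f.flip) (head' := q ∘ f.head) q (fun _ _ => rfl)
      fun _ _ => rfl
    simpa [q, hy, hz] using this
  obtain ⟨R, T, hRT, hR, hT, hside, hsum⟩ := exists_isTiling_of_perm S φ t hφφ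
    (fun x => by
      rw [hlett, hlett, ← f.lab_flip _ (hdart x)]
      exact congrArg f.lab (hφ₀ x)) hnext (Pos.next_letter_ne hws)
    (fun x => q (f.head (f.flip (dart x)))) (by
      intro x
      have h1 : ∀ x, q (f.head (f.flip (dart (S x)))) = q (f.head (dart x)) := by
        rintro ⟨⟨j, hj⟩, r⟩
        have h0 : (finRotate _ r : ℕ) = (r + 1) % L[j].length := coe_finRotate_eq_mod r
        have := (hblock L[j] (List.getElem_mem hj)).getElem_mod r r.2
        simp only [Function.comp_apply] at this
        simp only [dart, hS, h0, this]
      rw [h1]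
      exact congrArg (fun d => q (f.head d)) (hφ₀ x))
  refine ⟨R, T, hRT, hR, hT, fun p => ?_, ?_⟩
  · rw [hside, Fintype.sum_sigma]
    have h1 : ∀ j : Fin L.length, (∑ r : Fin L[j.1].length, if t ⟨j, r⟩ = p then (1 : ℚ) else 0) =
        n * if l[j.1]'(hl2 _ j.2) = p.1 then 1 else 0 := by
      rintro ⟨j, hj⟩
      obtain ⟨i, s⟩ := p
      by_cases hi : l[j]'(hLl ▸ hj) = i
      · subst hi
        have : ∀ r : Fin L[j].length, t ⟨⟨j, hj⟩, r⟩ = ⟨l[j]'(hLl ▸ hj), s⟩ ↔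
            (r : ℕ) % (ws (l[j]'(hLl ▸ hj))).length = s := by
          intro r
          simp only [t, Pos.ofMod, Sigma.mk.injEq, heq_eq_eq, true_and, Fin.ext_iff]
        simp only [this, if_true, mul_one]
        exact card_filter_mod (hlen j hj) s.2
      · rw [if_neg hi, mul_zero]
        refine Finset.sum_eq_zero fun r _ => if_neg fun h => hi ?_
        exact congrArg Sigma.fst h
    simp only [h1, ← Finset.mul_sum]
    rw [← sum_getElem_eq_count, ← Equiv.sum_comp (finCongr hLl)]
    rfl
  · have hX : Fintype.card X = f.list.length := by
      rw [← hL, List.length_flatten, Fintype.card_sigma]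
      simp only [Fintype.card_fin]
      exact Fin.sum_univ_fun_getElem L List.length
    have hsub : {v | v = f.start ∨ ∃ d ∈ f.list, f.head d = v} ⊆
        (J : Set f.Vertex) ∪ Set.range fun x => q (f.head (f.flip (dart x))) := by
      intro v hv
      by_cases hvJ : v ∈ J
      · exact Or.inl hvJ
      rcases hv with rfl | ⟨d, hd, rfl⟩
      · exact (hvJ hJ).elim
      · obtain ⟨x, hx⟩ := hsurj _ (f.flip_mem d hd)
        exact Or.inr ⟨x, by simp only [hx, f.flip_flip d hd, q, hvJ, if_false]⟩
    have h1 := Set.ncard_le_ncard hsub (J.finite_toSet.union (Set.finite_range _))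
    have h2 := Set.ncard_union_le (J : Set f.Vertex) (Set.range fun x => q (f.head (f.flip (dart x))))
    rw [Set.ncard_coe_finset] at h2
    have h3 := f.card_le
    rw [hX] at hsum
    -- The junctions account for `2 * (l.length + 1)`, and the folding, of rank at most `2 * k + 2 *
    -- l.length`, for `2 * (2 * k + 2 * l.length) - 2`.
    have h4 : f.list.length ≤ 2 * (Set.range fun x => q (f.head (f.flip (dart x)))).ncard +
        4 * k + 6 * l.length := by omega
    have h5 : (f.list.length : ℚ) ≤ 2 * (Set.range fun x => q (f.head (f.flip (dart x)))).ncard +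
        4 * k + 6 * l.length := by exact_mod_cast h4
    linarith

end Extraction

/-! ### Fourier–Motzkin elimination and parametric minimization -/

section FourierMotzkin

variable {V : Type} [DecidableEq V]

/-- A homogeneous linear inequality `0 ≤ ∑ zᵢ xᵢ` in sparse form. -/
abbrev Row (V : Type) : Type := List (V × ℤ)

/-- The value of the linear form of a row. -/
def Row.eval (x : V → ℚ) (r : Row V) : ℚ := (r.map fun e => (e.2 : ℚ) * x e.1).sum

/-- The coefficient of a variable in a row. -/
def Row.coef (v : V) (r : Row V) : ℤ := (r.map fun e => if e.1 = v then e.2 else 0).sum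

/-- Multiplication of a row by an integer. -/
def Row.scale (z : ℤ) (r : Row V) : Row V := r.map fun e => (e.1, z * e.2)

omit [DecidableEq V] in
@[simp] theorem Row.eval_nil (x : V → ℚ) : Row.eval x [] = 0 := rfl

omit [DecidableEq V] in
@[simp] theorem Row.eval_cons (x : V → ℚ) (e : V × ℤ) (r : Row V) :
    Row.eval x (e :: r) = e.2 * x e.1 + Row.eval x r := by simp [Row.eval]

omit [DecidableEq V] in
@[simp] theorem Row.eval_append (x : V → ℚ) (r r' : Row V) :
    Row.eval x (r ++ r') = Row.eval x r + Row.eval x r' := by simp [Row.eval]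

omit [DecidableEq V] in
@[simp] theorem Row.eval_scale (x : V → ℚ) (z : ℤ) (r : Row V) :
    Row.eval x (r.scale z) = z * Row.eval x r := by
  induction r with
  | nil => simp [Row.scale]
  | cons e r ih =>
    have : Row.scale z (e :: r) = (e.1, z * e.2) :: Row.scale z r := rfl
    rw [this, Row.eval_cons, Row.eval_cons, ih]
    push_cast
    ring

@[simp] theorem Row.coef_nil (v : V) : Row.coef v [] = 0 := rfl

@[simp] theorem Row.coef_cons (v : V) (e : V × ℤ) (r : Row V) :
    Row.coef v (e :: r) = (if e.1 = v then e.2 else 0) + Row.coef v r := by simp [Row.coef]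

theorem Row.eval_update (x : V → ℚ) (v : V) (q : ℚ) (r : Row V) :
    Row.eval (Function.update x v q) r = Row.eval x r + r.coef v * (q - x v) := by
  induction r with
  | nil => simp
  | cons e r ih =>
    rw [Row.eval_cons, Row.eval_cons, Row.coef_cons, ih]
    by_cases h : e.1 = v
    · subst h
      simp only [Function.update_self, if_true]
      push_cast
      ring
    · simp only [Function.update_of_ne h, if_neg h]
      push_cast
      ring

/-- Elimination of a variable from a system of inequalities. -/
def elimVar (v : V) (rows : List (Row V)) : List (Row V) :=
  rows.filter (fun r => r.coef v = 0) ++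
    (rows.filter fun r => 0 < r.coef v).flatMap fun r =>
      (rows.filter fun r => r.coef v < 0).map fun r' =>
        r.scale (- r'.coef v) ++ r'.scale (r.coef v)

/-- All inequalities of a system hold. -/
def Sat (rows : List (Row V)) (x : V → ℚ) : Prop := ∀ r ∈ rows, 0 ≤ Row.eval x r

theorem exists_between_lists {α : Type*} (s t : List α) (f g : α → ℚ)
    (h : ∀ a ∈ s, ∀ b ∈ t, f a ≤ g b) : ∃ q, (∀ a ∈ s, f a ≤ q) ∧ ∀ b ∈ t, q ≤ g b := by
  induction s with
  | nil =>
    induction t with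
    | nil => exact ⟨0, by simp⟩
    | cons b t ih =>
      obtain ⟨q, -, hq⟩ := ih (by simp)
      exact ⟨min (g b) q, by simp, by simpa using fun b' hb' => Or.inr (hq b' hb')⟩
  | cons a s ih =>
    obtain ⟨q, h1, h2⟩ := ih fun a ha b hb => h a (by simp [ha]) b hb
    exact ⟨max (f a) q, by simpa using fun a' ha' => Or.inr (h1 a' ha'),
      fun b hb => max_le (h a (by simp) b hb) (h2 b hb)⟩

/-- Rows with a positive coefficient of `v` bound this variable from below, rows with a negative one
from above. A value in between exists exactly if no lower bound exceeds an upper bound, and this is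
what the combinations of rows in `elimVar` express. -/
theorem sat_elimVar (v : V) (rows : List (Row V)) (x : V → ℚ) :
    Sat (elimVar v rows) x ↔ ∃ q, Sat rows (Function.update x v q) := by
  simp only [Sat, elimVar, List.mem_append, List.mem_filter, List.mem_flatMap, List.mem_map,
    decide_eq_true_eq]
  constructor
  · intro h
    obtain ⟨q, h1, h2⟩ := exists_between_lists (rows.filter fun r => 0 < r.coef v)
      (rows.filter fun r => r.coef v < 0) (fun r => x v - Row.eval x r / r.coef v)
      (fun r => x v - Row.eval x r / r.coef v) (by
        intro r hr r' hr'
        simp only [List.mem_filter, decide_eq_true_eq] at hr hr'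
        have := h _ (Or.inr ⟨r, hr, r', hr', rfl⟩)
        simp only [Row.eval_append, Row.eval_scale] at this
        have p1 : (0 : ℚ) < r.coef v := by exact_mod_cast hr.2
        have p2 : (r'.coef v : ℚ) < 0 := by exact_mod_cast hr'.2
        rw [sub_le_sub_iff_left, div_le_iff_of_neg p2, div_mul_eq_mul_div, div_le_iff₀ p1]
        push_cast at this
        linarith)
    refine ⟨q, fun r hr => ?_⟩
    rw [Row.eval_update]
    rcases lt_trichotomy (r.coef v) 0 with hc | hc | hc
    · have := h2 r (by simp [hr, hc])
      have p2 : (r.coef v : ℚ) < 0 := by exact_mod_cast hc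
      have h3 : Row.eval x r / r.coef v ≤ x v - q := by linarith
      rw [div_le_iff_of_neg p2] at h3
      linarith
    · rw [hc]
      simpa using h r (Or.inl ⟨hr, hc⟩)
    · have := h1 r (by simp [hr, hc])
      have p2 : (0 : ℚ) < r.coef v := by exact_mod_cast hc
      have h3 : x v - q ≤ Row.eval x r / r.coef v := by linarith
      rw [le_div_iff₀ p2] at h3
      linarith
  · rintro ⟨q, h⟩ r (⟨hr, hc⟩ | ⟨r, ⟨hr, hc⟩, r', ⟨hr', hc'⟩, rfl⟩)
    · have := h r hr
      rw [Row.eval_update, hc] at this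
      simpa using this
    · have h1 := h r hr
      have h2 := h r' hr'
      rw [Row.eval_update] at h1 h2
      simp only [Row.eval_append, Row.eval_scale]
      have p1 : (0 : ℚ) ≤ r.coef v := by exact_mod_cast hc.le
      have p2 : (0 : ℚ) ≤ - r'.coef v := by
        have : (r'.coef v : ℚ) < 0 := by exact_mod_cast hc'
        linarith
      have h3 := mul_nonneg p2 h1
      have h4 := mul_nonneg p1 h2
      push_cast
      linarith

/-- Elimination of a list of variables. -/
def elimVars (vs : List V) (rows : List (Row V)) : List (Row V) :=
  vs.foldl (fun rows v => elimVar v rows) rows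

theorem sat_elimVars (vs : List V) (rows : List (Row V)) (x : V → ℚ) :
    Sat (elimVars vs rows) x ↔ ∃ x', (∀ v ∉ vs, x' v = x v) ∧ Sat rows x' := by
  induction vs generalizing rows with
  | nil =>
    simp only [elimVars, List.foldl_nil, List.not_mem_nil, not_false_eq_true, forall_const]
    constructor
    · exact fun h => ⟨x, fun _ => rfl, h⟩
    · rintro ⟨x', hx, h⟩
      rwa [← funext hx]
  | cons v vs ih =>
    have : elimVars (v :: vs) rows = elimVars vs (elimVar v rows) := rfl
    rw [this, ih]
    simp only [sat_elimVar]
    constructor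
    · rintro ⟨x', hx', q, h⟩
      refine ⟨_, fun w hw => ?_, h⟩
      simp only [List.mem_cons, not_or] at hw
      rw [Function.update_of_ne hw.1, hx' w hw.2]
    · rintro ⟨x', hx', h⟩
      refine ⟨Function.update x' v (if v ∈ vs then x' v else x v), fun w hw => ?_, x' v, by simpa⟩
      by_cases hwv : w = v
      · subst hwv
        simp [hw]
      · rw [Function.update_of_ne hwv]
        exact hx' w (by simp [hw, hwv])

/-- The functionals in the parameters `t` whose maximum is the least possible value of `s`. -/
def lowerBounds (s : V) (t : ℕ → V) (k : ℕ) (rows : List (Row V)) : List (List Frac) :=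
  ((List.range k).map fun _ => (0, 0)) :: (rows.filter fun r => 0 < r.coef s).map fun r =>
    (List.range k).map fun j => (- r.coef (t j), (r.coef s).toNat - 1)

theorem Row.eval_eq_sum {s : V} {t : ℕ → V} (ht : Function.Injective t) (hs : ∀ j, t j ≠ s)
    (k : ℕ) (x : V → ℚ) (hx : ∀ v, v ≠ s → (∀ j < k, v ≠ t j) → x v = 0) (r : Row V) :
    Row.eval x r = r.coef s * x s + ∑ j : Fin k, (r.coef (t j) : ℚ) * x (t j) := by
  induction r with
  | nil => simp
  | cons e r ih =>
    rw [Row.eval_cons, ih]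
    simp only [Row.coef_cons]
    push_cast
    simp only [add_mul, Finset.sum_add_distrib]
    have : (e.2 : ℚ) * x e.1 = (if e.1 = s then (e.2 : ℚ) else 0) * x s +
        ∑ j : Fin k, (if e.1 = t j then (e.2 : ℚ) else 0) * x (t j) := by
      by_cases h : e.1 = s
      · rw [Finset.sum_eq_zero, if_pos h, h, add_zero]
        intro j _
        rw [if_neg (fun h' => hs j (by rw [← h', h])), zero_mul]
      · rw [if_neg h, zero_mul, zero_add]
        by_cases h' : ∃ j < k, e.1 = t j
        · obtain ⟨j, hj, h'⟩ := h'
          rw [Finset.sum_eq_single ⟨j, hj⟩, if_pos h', h']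
          · intro i _ hi
            rw [if_neg, zero_mul]
            intro h''
            exact hi (Fin.ext (ht (h''.symm.trans h')))
          · simp
        · push Not at h'
          rw [hx _ h h', mul_zero, Finset.sum_eq_zero]
          intro j _
          rw [if_neg (h' j j.2), zero_mul]
    rw [this]
    ring

/-- The value of a rational vector, read as a linear functional. -/
def evalVec (k : ℕ) (y : List Frac) (t : Fin k → ℚ) : ℚ := ∑ j : Fin k, (y.getD j (0, 0)).val * t j

/-- The second entry of a code is the denominator minus 1, hence `c.toNat - 1`. -/
theorem Frac.val_ofCoef (a c : ℤ) (hc : 0 < c) : Frac.val (- a, c.toNat - 1) = - (a / c) := by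
  have h1 : ((c.toNat - 1 : ℕ) : ℚ) + 1 = c := by
    have : c.toNat - 1 + 1 = c.toNat := by omega
    have h2 : ((c.toNat : ℤ) : ℚ) = c := by rw [Int.toNat_of_nonneg hc.le]
    rw [← h2]
    exact_mod_cast this
  simp only [Frac.val, h1]
  push_cast
  ring

/-- Correctness of the elimination method for parametric minimization. -/
theorem lowerBounds_spec {s : V} {t : ℕ → V} (ht : Function.Injective t) (hs : ∀ j, t j ≠ s)
    {k : ℕ} {vs : List V} (hvs : ∀ v ∈ vs, v ≠ s ∧ ∀ j, v ≠ t j)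
    {rows : List (Row V)} {P : (Fin k → ℚ) → ℚ → Prop}
    (hP : ∀ a c, P a c ↔ ∃ x, (∀ j : Fin k, x (t j) = a j) ∧ x s = c ∧ Sat rows x)
    (hrows : ∀ r ∈ rows, ∀ e ∈ r, e.1 ∈ vs ∨ e.1 = s ∨ ∃ j < k, e.1 = t j)
    (hpos : ∀ a c, P a c → 0 ≤ c) :
    (∀ y ∈ lowerBounds s t k (elimVars vs rows), y.length = k) ∧
    ∀ a c, P a c → (∀ y ∈ lowerBounds s t k (elimVars vs rows), evalVec k y a ≤ c) ∧
      ∃ y ∈ lowerBounds s t k (elimVars vs rows), P a (evalVec k y a) := by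
  set E := elimVars vs rows with hE
  have hlen : ∀ y ∈ lowerBounds s t k E, y.length = k := by
    intro y hy
    simp only [lowerBounds, List.mem_cons, List.mem_map] at hy
    rcases hy with rfl | ⟨r, -, rfl⟩ <;> simp
  refine ⟨hlen, fun a c hac => ?_⟩
  -- After the elimination only `s` and the first `k` parameters matter. All remaining coordinates
  -- may be set to 0, because by `hrows` no row involves them.
  have hsat : ∀ c, P a c ↔ ∀ r ∈ E, 0 ≤ r.coef s * c + ∑ j : Fin k, (r.coef (t j) : ℚ) * a j := by
    intro c
    classical
    let x : V → ℚ := fun v => if v = s then c else if h : ∃ j : Fin k, v = t j then a h.choose else 0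
    have hxs : x s = c := by simp [x]
    have hxt : ∀ j : Fin k, x (t j) = a j := by
      intro j
      have h : ∃ i : Fin k, t j = t i := ⟨j, rfl⟩
      simp only [x, if_neg (hs j), dif_pos h]
      congr 1
      exact Fin.ext (ht h.choose_spec.symm)
    have hx0 : ∀ v, v ≠ s → (∀ j < k, v ≠ t j) → x v = 0 := by
      intro v hv hv'
      simp only [x, if_neg hv]
      rw [dif_neg]
      rintro ⟨j, hj⟩
      exact hv' j j.2 hj
    have h1 : (∀ r ∈ E, 0 ≤ r.coef s * c + ∑ j : Fin k, (r.coef (t j) : ℚ) * a j) ↔ Sat E x := by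
      refine forall₂_congr fun r _ => ?_
      rw [Row.eval_eq_sum ht hs k x hx0, hxs]
      simp only [hxt]
    rw [h1, hE, sat_elimVars, hP]
    constructor
    · rintro ⟨x', h2, h3, h4⟩
      refine ⟨fun v => if v ∈ vs ∨ v = s ∨ ∃ j < k, v = t j then x' v else 0, ?_, ?_⟩
      · intro v hv
        beta_reduce
        by_cases hvs : v = s
        · subst hvs
          rw [if_pos (by simp), h3, hxs]
        · by_cases hj : ∃ j < k, v = t j
          · rw [if_pos (Or.inr (Or.inr hj))]
            obtain ⟨j, hj, rfl⟩ := hj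
            rw [h2 ⟨j, hj⟩, hxt ⟨j, hj⟩]
          · rw [if_neg (by rintro (h | h | h); exacts [hv h, hvs h, hj h]), hx0 v hvs fun j hj' h => hj ⟨j, hj', h⟩]
      · intro r hr
        have h5 := h4 r hr
        have h7 : Row.eval (fun v => if v ∈ vs ∨ v = s ∨ ∃ j < k, v = t j then x' v else 0) r =
            Row.eval x' r := by
          unfold Row.eval
          congr 1
          refine List.map_congr_left fun e he => ?_
          simp only [if_pos (hrows r hr e he)]
        rwa [h7]
    · rintro ⟨x', h2, h3⟩
      refine ⟨x', fun j => ?_, ?_, h3⟩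
      · rw [h2 _ fun h => (hvs _ h).2 j rfl, hxt]
      · rw [h2 _ fun h => (hvs _ h).1 rfl, hxs]
  have hy : ∀ y, y ∈ lowerBounds s t k E ↔ y = ((List.range k).map fun _ => (0, 0)) ∨
      ∃ r ∈ E, 0 < r.coef s ∧
        y = (List.range k).map fun j => (- r.coef (t j), (r.coef s).toNat - 1) := by
    intro y
    simp only [lowerBounds, List.mem_cons, List.mem_map, List.mem_filter, decide_eq_true_eq]
    refine or_congr Iff.rfl (exists_congr fun r => ?_)
    rw [and_assoc]
    simp only [eq_comm]
  have hget : ∀ (f : ℕ → Frac) (j : Fin k), ((List.range k).map f).getD j (0, 0) = f j := by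
    intro f j
    simp [List.getD]
  have hv0 : evalVec k ((List.range k).map fun _ => (0, 0)) a = 0 := by
    simp [evalVec, Frac.val]
  have hvr : ∀ r : Row V, 0 < r.coef s → evalVec k ((List.range k).map fun j =>
      (- r.coef (t j), (r.coef s).toNat - 1)) a =
        - (∑ j : Fin k, (r.coef (t j) : ℚ) * a j) / r.coef s := by
    intro r hr
    simp only [evalVec, hget, Frac.val_ofCoef _ _ hr]
    rw [neg_div, Finset.sum_div, ← Finset.sum_neg_distrib]
    exact Finset.sum_congr rfl fun j _ => by ring
  have hle : ∀ c, P a c → ∀ y ∈ lowerBounds s t k E, evalVec k y a ≤ c := by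
    intro c hc y hyE
    rcases (hy y).1 hyE with rfl | ⟨r, hr, hrs, rfl⟩
    · rw [hv0]
      exact hpos a c hc
    · have hrs' : (0 : ℚ) < r.coef s := by exact_mod_cast hrs
      have := (hsat c).1 hc r hr
      rw [hvr r hrs, div_le_iff₀ hrs']
      linarith
  refine ⟨hle c hac, ?_⟩
  -- The largest lower bound is itself feasible. Rows with a positive coefficient of `s` hold by
  -- maximality; those with a negative coefficient bound `s` from above and hold because they hold
  -- at the larger value `c`. The zero functional at the head of the list ensures that there is a
  -- maximum.
  obtain ⟨y, hyE, hmax⟩ := Finset.exists_max_image (lowerBounds s t k E).toFinset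
    (fun y => evalVec k y a) ⟨_, by simpa using (hy _).2 (Or.inl rfl)⟩
  rw [List.mem_toFinset] at hyE
  refine ⟨y, hyE, (hsat _).2 fun r hr => ?_⟩
  have h0 := (hsat c).1 hac r hr
  rcases lt_trichotomy (r.coef s) 0 with h | h | h
  · have h' : (r.coef s : ℚ) < 0 := by exact_mod_cast h
    nlinarith [hle c hac y hyE]
  · rw [h] at h0 ⊢
    simpa using h0
  · have h' : (0 : ℚ) < r.coef s := by exact_mod_cast h
    have := hmax _ (List.mem_toFinset.2 ((hy _).2 (Or.inr ⟨r, hr, h, rfl⟩)))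
    rw [hvr r h, div_le_iff₀ h'] at this
    linarith

end FourierMotzkin

/-! ### The linear program of tilings in coded form -/

section Program

/-- Codes for positions of letters in a family of words and their inverses. -/
abbrev PosCode : Type := (ℕ × Bool) × ℕ

/-- The variables of the linear program: triangles, rectangles, and the cost and the parameters. -/
abbrev LPVar : Type := ((PosCode × PosCode × PosCode) ⊕ (PosCode × PosCode)) ⊕ Option ℕ

set_option synthInstance.maxSize 1000 in
instance : DecidableEq LPVar := inferInstance

/-- A term of a formal chain: the number of the chain, the coefficient, the word. -/
abbrev Entry : Type := (ℕ × Frac) × Word ℕ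

/-- The words of the entries and their inverses. -/
def codeWord (E : List Entry) (i : ℕ × Bool) : Word ℕ :=
  if i.2 then (E.map Prod.snd).getD i.1 [] else FreeGroup.invRev ((E.map Prod.snd).getD i.1 [])

/-- All positions. -/
def allPos (E : List Entry) : List PosCode :=
  (List.range E.length).flatMap fun i => [true, false].flatMap fun ε =>
    (List.range (codeWord E (i, ε)).length).map fun k => ((i, ε), k)

/-- The letter at a position. -/
def codeLetter (E : List Entry) (p : PosCode) : ℕ × Bool := (codeWord E p.1).getD p.2 (0, false)

/-- The next position. -/
def codeNext (E : List Entry) (p : PosCode) : PosCode :=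
  (p.1, (p.2 + 1) % (codeWord E p.1).length)

/-- All pairs of positions. -/
def allPairs (E : List Entry) : List (PosCode × PosCode) :=
  (allPos E).flatMap fun a => (allPos E).map fun b => (a, b)

/-- All triples of positions. -/
def allTriples (E : List Entry) : List (PosCode × PosCode × PosCode) :=
  (allPos E).flatMap fun a => (allPairs E).map fun x => (a, x)

/-- The inequality `0 ≤ T` for a triangle. -/
def triangleRow (x : PosCode × PosCode × PosCode) : Row LPVar := [(.inl (.inl x), 1)]

/-- The inequality `0 ≤ ± R` for a rectangle. -/
def rectangleRow (z : ℤ) (x : PosCode × PosCode) : Row LPVar := [(.inl (.inr x), z)]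

/-- The balance condition at a pair of positions. -/
def balanceRow (E : List Entry) (y : PosCode × PosCode) : Row LPVar :=
  ((allTriples E).map fun x => (.inl (.inl x), sideSign ℤ y.1 y.2 x.1 x.2.1 +
    sideSign ℤ y.1 y.2 x.2.1 x.2.2 + sideSign ℤ y.1 y.2 x.2.2 x.1)) ++
  (allPairs E).map fun x => (.inl (.inr x), sideSign ℤ y.1 y.2 (codeNext E x.2) x.1 +
    sideSign ℤ y.1 y.2 (codeNext E x.1) x.2)

/-- A multiple of the number of rectangle sides at a position. -/
def sideRow (E : List Entry) (z : ℤ) (p : PosCode) : Row LPVar :=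
  ((allPos E).map fun b => (.inl (.inr (p, b)), z)) ++
    (allPos E).map fun b => (.inl (.inr (b, p)), z)

/-- The difference of the degree over a word and its prescribed value. -/
def degreeRow (E : List Entry) (i : ℕ) : Row LPVar :=
  sideRow E ((E.map fun e => ((e.1.2.2 + 1 : ℕ) : ℤ)).getD i 0)
      ((i, true), (codeWord E (i, true)).length - 1) ++
    (sideRow E (- (E.map fun e => ((e.1.2.2 + 1 : ℕ) : ℤ)).getD i 0)
      ((i, false), (codeWord E (i, false)).length - 1) ++
    [(.inr (some ((E.map fun e => e.1.1).getD i 0)), - (E.map fun e => e.1.2.1).getD i 0)])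

/-- The comparison of the cost with the number of triangles. -/
def costRow (E : List Entry) : Row LPVar :=
  (.inr none, 4) :: (allTriples E).map fun x => (.inl (.inl x), -1)

/-- The linear program of tilings. -/
def tilingRows (E : List Entry) : List (Row LPVar) :=
  (allTriples E).map triangleRow ++ ((allPairs E).map (rectangleRow 1) ++
    (((allPairs E).filter fun x => codeLetter E x.2 ≠ flipLetter (codeLetter E x.1)).map
      (rectangleRow (-1)) ++ ((allPairs E).map (balanceRow E) ++
    (((List.range E.length).filter fun i => codeWord E (i, true) ≠ []).flatMap
      (fun i => [degreeRow E i, (degreeRow E i).scale (-1)]) ++ [costRow E]))))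

/-- The variables to be eliminated. -/
def tilingVars (E : List Entry) : List LPVar :=
  (allTriples E).map (fun x => .inl (.inl x)) ++ (allPairs E).map fun x => .inl (.inr x)

/-- The functionals whose maximum is the least cost of a tiling. -/
def tilingBounds (k : ℕ) (E : List Entry) : List (List Frac) :=
  lowerBounds (.inr none) (fun j => .inr (some j)) k (elimVars (tilingVars E) (tilingRows E))

end Program

/-! ### The coded program describes exactly the rational tilings -/

section Correctness

variable {ι : Type v}

/-- The number of boundary components of a tiling that read a given word. -/
def lastCount {I : Type} [Fintype I] [DecidableEq I] {ws : I → Word ι} {K : Type*} [AddCommMonoid K]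
    (R : Pos ws → Pos ws → K) (i : I) : K := ∑ p : Pos ws with p.IsLast ∧ p.1 = i, sideCount R p

/-- A tiling with prescribed degrees and with bounded cost. -/
structure IsSolution {κ : Type} [Fintype κ] [DecidableEq κ] (ws : κ × Bool → Word ι) (x : κ → ℚ)
    (c : ℚ) (R : Pos ws → Pos ws → ℚ) (T : Pos ws → Pos ws → Pos ws → ℚ) : Prop where
  tiling : IsTiling R T
  rectangle_nonneg : ∀ a b, 0 ≤ R a b
  triangle_nonneg : ∀ a b c, 0 ≤ T a b c
  degree : ∀ i, ws (i, true) ≠ [] → lastCount R (i, true) - lastCount R (i, false) = x i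
  cost : ∑ a, ∑ b, ∑ c, T a b c ≤ 4 * c

variable {E : List Entry} {ws : Fin E.length × Bool → Word ι} {name : ι → ℕ}

/-- The code of a position. -/
def Pos.code (p : Pos ws) : PosCode := ((p.1.1, p.1.2), p.2)

theorem Pos.code_injective : Function.Injective (Pos.code (E := E) (ws := ws)) := by
  rintro ⟨⟨i, ε⟩, k⟩ ⟨⟨i', ε'⟩, k'⟩ h
  simp only [Pos.code, Prod.mk.injEq, Fin.val_inj] at h
  obtain ⟨⟨rfl, rfl⟩, h⟩ := h
  congr
  exact Fin.ext h

theorem sum_map_flatMap {α β : Type*} (l : List α) (f : α → List β) (h : β → ℚ) :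
    ((l.flatMap f).map h).sum = (l.map fun a => ((f a).map h).sum).sum := by
  induction l with
  | nil => rfl
  | cons a l ih => simp [ih]

theorem sum_map_range (n : ℕ) (f : ℕ → ℚ) : ((List.range n).map f).sum = ∑ i : Fin n, f i := by
  induction n with
  | zero => simp
  | succ n ih => simp [List.range_succ, Fin.sum_univ_castSucc, ih]

/-- The words of a list of entries are obtained from the given words by renaming the letters. -/
def IsCoding (name : ι → ℕ) (E : List Entry) (ws : Fin E.length × Bool → Word ι) : Prop :=
  ∀ i, (ws i).map (fun a => (name a.1, a.2)) = codeWord E (i.1, i.2)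

theorem IsCoding.length_eq (hc : IsCoding name E ws) (i : Fin E.length × Bool) :
    (ws i).length = (codeWord E (i.1, i.2)).length := by rw [← hc i, List.length_map]

theorem sum_allPos (hc : IsCoding name E ws) (f : PosCode → ℚ) :
    ((allPos E).map f).sum = ∑ p : Pos (ws), f p.code := by
  rw [Fintype.sum_sigma, Fintype.sum_prod_type, allPos, sum_map_flatMap, sum_map_range]
  refine Finset.sum_congr rfl fun i _ => ?_
  rw [sum_map_flatMap, Fintype.sum_bool]
  simp only [List.map_cons, List.map_nil, List.sum_cons, List.sum_nil, add_zero, List.map_map,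
    Function.comp_def]
  congr 1
  · rw [sum_map_range, ← hc.length_eq (i, true)]
    rfl
  · rw [sum_map_range, ← hc.length_eq (i, false)]
    rfl

theorem sum_allPairs (hc : IsCoding name E ws) (f : PosCode × PosCode → ℚ) : ((allPairs E).map f).sum =
    ∑ a : Pos (ws), ∑ b : Pos (ws), f (a.code, b.code) := by
  rw [allPairs, sum_map_flatMap, sum_allPos hc]
  refine Finset.sum_congr rfl fun a _ => ?_
  rw [List.map_map, sum_allPos hc]
  rfl

theorem sum_allTriples (hc : IsCoding name E ws) (f : PosCode × PosCode × PosCode → ℚ) : ((allTriples E).map f).sum =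
    ∑ a : Pos (ws), ∑ b : Pos (ws), ∑ c : Pos (ws),
      f (a.code, b.code, c.code) := by
  rw [allTriples, sum_map_flatMap, sum_allPos hc]
  refine Finset.sum_congr rfl fun a _ => ?_
  rw [List.map_map, sum_allPairs hc]
  rfl

theorem mem_allPos (hc : IsCoding name E ws) {p : PosCode} : p ∈ allPos E ↔ ∃ q : Pos (ws), q.code = p := by
  simp only [allPos, List.mem_flatMap, List.mem_range, List.mem_map]
  constructor
  · rintro ⟨i, hi, ε, -, k, hk, rfl⟩
    exact ⟨⟨(⟨i, hi⟩, ε), ⟨k, by rw [hc.length_eq]; exact hk⟩⟩, rfl⟩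
  · rintro ⟨⟨⟨i, ε⟩, k⟩, rfl⟩
    exact ⟨i, i.2, ε, by cases ε <;> simp, k, k.2.trans_eq (hc.length_eq _), rfl⟩

theorem forall_allPos (hc : IsCoding name E ws) {P : PosCode → Prop} :
    (∀ p ∈ allPos E, P p) ↔ ∀ q : Pos (ws), P q.code := by
  simp only [mem_allPos hc, forall_exists_index, forall_apply_eq_imp_iff]

theorem forall_allPairs (hc : IsCoding name E ws) {P : PosCode × PosCode → Prop} :
    (∀ p ∈ allPairs E, P p) ↔ ∀ a b : Pos (ws), P (a.code, b.code) := by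
  rw [← forall_allPos hc (P := fun p => ∀ b : Pos (ws), P (p, b.code))]
  simp only [allPairs, List.mem_flatMap, List.mem_map]
  constructor
  · exact fun h a ha b => h _ ⟨a, ha, b.code, (mem_allPos hc).2 ⟨b, rfl⟩, rfl⟩
  · rintro h p ⟨a, ha, b, hb, rfl⟩
    obtain ⟨b, rfl⟩ := (mem_allPos hc).1 hb
    exact h a ha b

theorem forall_allTriples (hc : IsCoding name E ws) {P : PosCode × PosCode × PosCode → Prop} :
    (∀ p ∈ allTriples E, P p) ↔
      ∀ a b c : Pos (ws), P (a.code, b.code, c.code) := by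
  rw [← forall_allPos hc (P := fun p => ∀ b c : Pos (ws), P (p, b.code, c.code))]
  simp only [allTriples, List.mem_flatMap, List.mem_map]
  constructor
  · exact fun h a ha => (forall_allPairs hc (P := fun x => P (a, x))).1 fun x hx =>
      h _ ⟨a, ha, x, hx, rfl⟩
  · rintro h p ⟨a, ha, x, hx, rfl⟩
    exact (forall_allPairs hc (P := fun x => P (a, x))).2 (h a ha) x hx

theorem Pos.code_next (hc : IsCoding name E ws) (p : Pos ws) : p.next.code = codeNext E p.code := by
  simp [Pos.code, Pos.next, codeNext, hc.length_eq]

theorem codeLetter_code (hc : IsCoding name E ws) (p : Pos ws) :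
    codeLetter E p.code = (name p.letter.1, p.letter.2) := by
  obtain ⟨i, k, hk⟩ := p
  simp [Pos.letter, codeLetter, Pos.code, ← hc i, hk]

/-- The letters that occur in a family of words. -/
def wordLetters {I : Type} (ws : I → Word ι) : Set ι := {i | ∃ j, ∃ a ∈ ws j, a.1 = i}

theorem Pos.letter_mem {I : Type} {ws : I → Word ι} (p : Pos ws) : p.letter.1 ∈ wordLetters ws :=
  ⟨p.1, p.letter, List.getElem_mem _, rfl⟩

/-- The rows of the program depend on the letters only through this comparison, so the renaming has
to be injective on the letters that occur, and nothing more. -/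
theorem adj_iff (hc : IsCoding name E ws) (hn : Set.InjOn name (wordLetters ws)) (a b : Pos ws) :
    b.letter ≠ flipLetter a.letter ↔
      codeLetter E b.code ≠ flipLetter (codeLetter E a.code) := by
  rw [not_iff_not, codeLetter_code hc, codeLetter_code hc]
  simp only [flipLetter, Prod.ext_iff]
  rw [hn.eq_iff b.letter_mem a.letter_mem]

theorem sideSign_code (u v a b : Pos (ws)) :
    ((sideSign ℤ u.code v.code a.code b.code : ℤ) : ℚ) = sideSign ℚ u v a b := by
  simp only [sideSign, Pos.code_injective.eq_iff]
  push_cast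
  rfl

theorem sideSign_swap' {P : Type*} [DecidableEq P] (u v a b : P) :
    sideSign ℚ v u a b = - sideSign ℚ u v a b := by
  simp [sideSign]

theorem eval_map {V α : Type} (x : V → ℚ) (l : List α) (f : α → V × ℤ) :
    Row.eval x (l.map f) = (l.map fun a => ((f a).2 : ℚ) * x (f a).1).sum := by
  simp [Row.eval, Function.comp_def]

variable (x : LPVar → ℚ)

theorem eval_balanceRow (hc : IsCoding name E ws) (u v : Pos (ws)) :
    Row.eval x (balanceRow E (u.code, v.code)) =
      (∑ a : Pos (ws), ∑ b : Pos (ws), ∑ c : Pos (ws),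
        x (.inl (.inl (a.code, b.code, c.code))) *
          (sideSign ℚ u v a b + sideSign ℚ u v b c + sideSign ℚ u v c a)) +
      ∑ a : Pos (ws), ∑ b : Pos (ws), x (.inl (.inr (a.code, b.code))) *
        (sideSign ℚ u v b.next a + sideSign ℚ u v a.next b) := by
  rw [balanceRow, Row.eval_append, eval_map, eval_map, sum_allTriples hc, sum_allPairs hc]
  push_cast
  simp only [← Pos.code_next hc, sideSign_code]
  congr 1
  · exact Finset.sum_congr rfl fun a _ => Finset.sum_congr rfl fun b _ =>
      Finset.sum_congr rfl fun c _ => mul_comm _ _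
  · exact Finset.sum_congr rfl fun a _ => Finset.sum_congr rfl fun b _ => mul_comm _ _

theorem eval_sideRow (hc : IsCoding name E ws) (z : ℤ) (p : Pos (ws)) :
    Row.eval x (sideRow E z p.code) = z * sideCount (fun a b : Pos (ws) =>
      x (.inl (.inr (a.code, b.code)))) p := by
  rw [sideRow, Row.eval_append, eval_map, eval_map, sum_allPos hc, sum_allPos hc, sideCount,
    Finset.sum_add_distrib, mul_add, Finset.mul_sum, Finset.mul_sum]

theorem lastCount_eq {I : Type} [Fintype I] [DecidableEq I] {ws : I → Word ι} {K : Type*}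
    [AddCommMonoid K] (R : Pos ws → Pos ws → K) (p : Pos ws) (hp : p.IsLast) :
    lastCount R p.1 = sideCount R p := by
  rw [lastCount]
  have : (Finset.univ.filter fun q : Pos ws => q.IsLast ∧ q.1 = p.1) = {p} := by
    ext q
    simp only [Finset.mem_filter, Finset.mem_univ, true_and, Finset.mem_singleton]
    constructor
    · rintro ⟨h1, h2⟩
      obtain ⟨i, k⟩ := p
      obtain ⟨i', k'⟩ := q
      simp only at h2
      subst h2
      simp only [Pos.IsLast] at hp h1
      congr
      exact Fin.ext (by omega)
    · rintro rfl
      exact ⟨hp, rfl⟩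
  rw [this, Finset.sum_singleton]

theorem length_codeWord_false (i : ℕ) :
    (codeWord E (i, false)).length = (codeWord E (i, true)).length := by
  simp [codeWord, FreeGroup.invRev]

/-- The row is multiplied by the denominator of the prescribed coefficient, so that its entries are
integers. The word must be nonempty because its last position represents the boundary components
that read it. -/
theorem eval_degreeRow (hc : IsCoding name E ws) (i : Fin E.length) (hi : codeWord E (i, true) ≠ []) :
    Row.eval x (degreeRow E i) = ((E[i].1.2.2 : ℚ) + 1) *
      (lastCount (fun a b : Pos (ws) => x (.inl (.inr (a.code, b.code)))) (i, true) -
       lastCount (fun a b : Pos (ws) => x (.inl (.inr (a.code, b.code)))) (i, false) -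
        E[i].1.2.val * x (.inr (some E[i].1.1))) := by
  have hl : 0 < (codeWord E (i, true)).length := List.length_pos_iff.2 hi
  let p : ∀ ε : Bool, Pos (ws) := fun ε => ⟨(i, ε), (codeWord E (i, ε)).length - 1, by
    rw [hc.length_eq]
    cases ε <;> simp only [length_codeWord_false] <;> omega⟩
  have hp : ∀ ε, (p ε).IsLast := fun ε => by
    simp only [Pos.IsLast, p, hc.length_eq]
    cases ε <;> first | (rw [length_codeWord_false]; omega) | omega
  have h1 := lastCount_eq (fun a b : Pos (ws) => x (.inl (.inr (a.code, b.code)))) _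
    (hp true)
  have h2 := lastCount_eq (fun a b : Pos (ws) => x (.inl (.inr (a.code, b.code)))) _
    (hp false)
  have h3 : (((i : ℕ), true), (codeWord E (i, true)).length - 1) = (p true).code := rfl
  have h4 : (((i : ℕ), false), (codeWord E (i, false)).length - 1) = (p false).code := rfl
  change lastCount _ (i, true) = _ at h1
  change lastCount _ (i, false) = _ at h2
  rw [degreeRow, Row.eval_append, Row.eval_append, h3, h4, eval_sideRow x hc, eval_sideRow x hc, h1, h2]
  have h5 : (E.map fun e => ((e.1.2.2 + 1 : ℕ) : ℤ)).getD i 0 = ((E[i].1.2.2 + 1 : ℕ) : ℤ) := by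
    simp [List.getD]
  have h6 : (E.map fun e => e.1.2.1).getD i 0 = E[i].1.2.1 := by simp [List.getD]
  have h7 : (E.map fun e => e.1.1).getD i 0 = E[i].1.1 := by simp [List.getD]
  rw [h5, h6, h7]
  simp only [Row.eval_cons, Row.eval_nil, Frac.val]
  have : ((E[i].1.2.2 : ℚ) + 1) ≠ 0 := by positivity
  push_cast
  field_simp
  ring

theorem sat_tilingRows (hc : IsCoding name E ws) (hn : Set.InjOn name (wordLetters ws)) : Sat (tilingRows E) x ↔
    IsSolution (ws) (fun i => E[i].1.2.val * x (.inr (some E[i].1.1)))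
      (x (.inr none)) (fun a b => x (.inl (.inr (a.code, b.code))))
      fun a b c => x (.inl (.inl (a.code, b.code, c.code))) := by
  have hT : (∀ r ∈ (allTriples E).map triangleRow, 0 ≤ Row.eval x r) ↔
      ∀ a b c : Pos (ws), 0 ≤ x (.inl (.inl (a.code, b.code, c.code))) := by
    rw [List.forall_mem_map, ← forall_allTriples hc (P := fun y => 0 ≤ x (.inl (.inl y)))]
    simp [triangleRow]
  have hR : (∀ r ∈ (allPairs E).map (rectangleRow 1), 0 ≤ Row.eval x r) ↔
      ∀ a b : Pos (ws), 0 ≤ x (.inl (.inr (a.code, b.code))) := by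
    rw [List.forall_mem_map, ← forall_allPairs hc (P := fun y => 0 ≤ x (.inl (.inr y)))]
    simp [rectangleRow]
  have hA : (∀ r ∈ ((allPairs E).filter fun y => codeLetter E y.2 ≠ flipLetter (codeLetter E y.1)).map
      (rectangleRow (-1)), 0 ≤ Row.eval x r) ↔ ∀ a b : Pos (ws),
        b.letter ≠ flipLetter a.letter → x (.inl (.inr (a.code, b.code))) ≤ 0 := by
    simp only [adj_iff hc hn]
    rw [List.forall_mem_map, ← forall_allPairs hc (P := fun y =>
      codeLetter E y.2 ≠ flipLetter (codeLetter E y.1) → x (.inl (.inr y)) ≤ 0)]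
    simp [rectangleRow]
  have hB : (∀ r ∈ (allPairs E).map (balanceRow E), 0 ≤ Row.eval x r) ↔
      ∀ u v : Pos (ws), Row.eval x (balanceRow E (u.code, v.code)) = 0 := by
    rw [List.forall_mem_map, forall_allPairs hc]
    constructor
    -- Exchanging `u` and `v` negates the row, so the inequalities for all pairs amount to
    -- equations.
    · intro h u v
      refine le_antisymm ?_ (h u v)
      have := h v u
      rw [eval_balanceRow x hc] at this ⊢
      simp only [sideSign_swap' u v, ← neg_add, mul_neg, Finset.sum_neg_distrib] at this
      linarith
    · exact fun h u v => (h u v).ge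
  have hD : (∀ r ∈ ((List.range E.length).filter fun i => codeWord E (i, true) ≠ []).flatMap
      (fun i => [degreeRow E i, (degreeRow E i).scale (-1)]), 0 ≤ Row.eval x r) ↔
      ∀ i : Fin E.length, ws (i, true) ≠ [] →
        lastCount (fun a b : Pos (ws) => x (.inl (.inr (a.code, b.code)))) (i, true) -
        lastCount (fun a b : Pos (ws) => x (.inl (.inr (a.code, b.code)))) (i, false) =
          E[i].1.2.val * x (.inr (some E[i].1.1)) := by
    have h1 : ∀ i : Fin E.length, ws (i, true) ≠ [] ↔ codeWord E (i, true) ≠ [] := by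
      intro i
      rw [← hc (i, true)]
      simp
    simp only [List.mem_flatMap, List.mem_filter, List.mem_range, decide_eq_true_eq,
      forall_exists_index, and_imp]
    constructor
    · intro h i hi
      have h2 := h _ i i.2 ((h1 i).1 hi) (List.mem_cons_self)
      have h3 := h _ i i.2 ((h1 i).1 hi) (List.mem_cons_of_mem _ List.mem_cons_self)
      rw [Row.eval_scale] at h3
      rw [eval_degreeRow x hc i ((h1 i).1 hi)] at h2 h3
      have h4 : (0 : ℚ) < (E[i].1.2.2 : ℚ) + 1 := by positivity
      push_cast at h3
      have h5 := le_antisymm (by linarith) h2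
      rcases mul_eq_zero.1 h5 with h6 | h6
      · exact absurd h6 h4.ne'
      · linarith
    · intro h r i hi hi' hr
      have h2 : Row.eval x (degreeRow E i) = 0 := by
        have := eval_degreeRow x hc ⟨i, hi⟩ hi'
        rw [h ⟨i, hi⟩ ((h1 ⟨i, hi⟩).2 hi')] at this
        simpa using this
      simp only [List.mem_cons, List.not_mem_nil, or_false] at hr
      rcases hr with rfl | rfl <;> simp [h2]
  have hC : Row.eval x (costRow E) = 4 * x (.inr none) - ∑ a : Pos (ws),
      ∑ b : Pos (ws), ∑ c : Pos (ws),
        x (.inl (.inl (a.code, b.code, c.code))) := by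
    rw [costRow, Row.eval_cons, eval_map, sum_allTriples hc]
    push_cast
    simp only [neg_mul, one_mul, Finset.sum_neg_distrib]
    ring
  have : Sat (tilingRows E) x ↔
      (∀ r ∈ (allTriples E).map triangleRow, 0 ≤ Row.eval x r) ∧
      (∀ r ∈ (allPairs E).map (rectangleRow 1), 0 ≤ Row.eval x r) ∧
      (∀ r ∈ ((allPairs E).filter fun y => codeLetter E y.2 ≠ flipLetter (codeLetter E y.1)).map
        (rectangleRow (-1)), 0 ≤ Row.eval x r) ∧
      (∀ r ∈ (allPairs E).map (balanceRow E), 0 ≤ Row.eval x r) ∧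
      (∀ r ∈ ((List.range E.length).filter fun i => codeWord E (i, true) ≠ []).flatMap
        (fun i => [degreeRow E i, (degreeRow E i).scale (-1)]), 0 ≤ Row.eval x r) ∧
      0 ≤ Row.eval x (costRow E) := by
    simp only [Sat, tilingRows, List.forall_mem_append, List.forall_mem_singleton]
  rw [this, hT, hR, hA, hB, hD, hC]
  constructor
  · rintro ⟨h1, h2, h3, h4, h5, h6⟩
    exact ⟨⟨fun a b hab => le_antisymm (h3 a b hab) (h2 a b), fun u v => by
      rw [← eval_balanceRow x hc]; exact h4 u v⟩, h2, h1, h5, by linarith⟩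
  · rintro ⟨⟨h3, h4⟩, h2, h1, h5, h6⟩
    exact ⟨h1, h2, fun a b hab => (h3 a b hab).le, fun u v => by
      rw [eval_balanceRow x hc]; exact h4 u v, h5, by linarith⟩

/-- Correctness of the linear program. -/
theorem tilingBounds_spec (hc : IsCoding name E ws)
    (hn : Set.InjOn name (wordLetters ws)) (k : ℕ) (hk : ∀ e ∈ E, e.1.1 < k)
    (P : (Fin k → ℚ) → ℚ → Prop)
    (hP : ∀ a c, P a c ↔ ∃ R T, IsSolution (ws)
      (fun i => E[i].1.2.val * a ⟨E[i].1.1, hk _ (List.getElem_mem _)⟩) c R T) :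
    (∀ y ∈ tilingBounds k E, y.length = k) ∧
    ∀ a c, P a c → (∀ y ∈ tilingBounds k E, evalVec k y a ≤ c) ∧
      ∃ y ∈ tilingBounds k E, P a (evalVec k y a) := by
  refine lowerBounds_spec (s := (.inr none : LPVar)) (t := fun j => (.inr (some j) : LPVar)) (fun i j h => by simpa using h) (by simp) ?_ ?_ ?_ ?_
  · intro v hv
    simp only [tilingVars, List.mem_append, List.mem_map] at hv
    rcases hv with ⟨y, -, rfl⟩ | ⟨y, -, rfl⟩ <;> simp
  · intro a c
    rw [hP]
    constructor
    · rintro ⟨R, T, h⟩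
      let cT : Pos (ws) × Pos (ws) × Pos (ws) →
        PosCode × PosCode × PosCode := Prod.map Pos.code (Prod.map Pos.code Pos.code)
      let cR : Pos (ws) × Pos (ws) → PosCode × PosCode :=
        Prod.map Pos.code Pos.code
      have hcT : Function.Injective cT :=
        Pos.code_injective.prodMap (Pos.code_injective.prodMap Pos.code_injective)
      have hcR : Function.Injective cR := Pos.code_injective.prodMap Pos.code_injective
      let x : LPVar → ℚ := Sum.elim (Sum.elim
        (Function.extend cT (fun y => T y.1 y.2.1 y.2.2) 0)
        (Function.extend cR (fun y => R y.1 y.2) 0))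
        fun o => o.elim c fun j => if hj : j < k then a ⟨j, hj⟩ else 0
      have hxT : ∀ u v w : Pos (ws), x (.inl (.inl (u.code, v.code, w.code))) = T u v w :=
        fun u v w => hcT.extend_apply (fun y => T y.1 y.2.1 y.2.2) 0 (u, v, w)
      have hxR : ∀ u v : Pos (ws), x (.inl (.inr (u.code, v.code))) = R u v :=
        fun u v => hcR.extend_apply (fun y => R y.1 y.2) 0 (u, v)
      have hxa : ∀ j : Fin k, x (.inr (some j)) = a j := fun j => by simp [x]
      refine ⟨x, hxa, rfl, (sat_tilingRows x hc hn).2 ?_⟩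
      simp only [hxT, hxR]
      convert h using 2 with i
      · exact congrArg _ (hxa ⟨E[i].1.1, hk _ (List.getElem_mem _)⟩)
      · rfl
    · rintro ⟨x, hx, hxc, h⟩
      refine ⟨fun a b => x (.inl (.inr (a.code, b.code))),
        fun a b c => x (.inl (.inl (a.code, b.code, c.code))), ?_⟩
      convert (sat_tilingRows x hc hn).1 h using 2 with i
      · exact congrArg _ (hx ⟨E[i].1.1, hk _ (List.getElem_mem _)⟩).symm
      · exact hxc.symm
  · have hTm : ∀ y ∈ allTriples E, (.inl (.inl y) : LPVar) ∈ tilingVars E := fun y hy => by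
      simp [tilingVars, hy]
    have hRm : ∀ y ∈ allPairs E, (.inl (.inr y) : LPVar) ∈ tilingVars E := fun y hy => by
      simp [tilingVars, hy]
    have hR2 : ∀ a ∈ allPos E, ∀ b ∈ allPos E, (a, b) ∈ allPairs E := fun a ha b hb => by
      simp [allPairs, ha, hb]
    have hlast : ∀ i < E.length, codeWord E (i, true) ≠ [] → ∀ ε,
        ((i, ε), (codeWord E (i, ε)).length - 1) ∈ allPos E := by
      intro i hi hw ε
      have hl : 0 < (codeWord E (i, true)).length := List.length_pos_iff.2 hw
      simp only [allPos, List.mem_flatMap, List.mem_range, List.mem_map]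
      refine ⟨i, hi, ε, by cases ε <;> simp, _, ?_, rfl⟩
      cases ε <;> first | (rw [length_codeWord_false]; omega) | omega
    have hside : ∀ z, ∀ p ∈ allPos E, ∀ e ∈ sideRow E z p, e.1 ∈ tilingVars E := by
      intro z p hp e he
      simp only [sideRow, List.mem_append, List.mem_map] at he
      rcases he with ⟨b, hb, rfl⟩ | ⟨b, hb, rfl⟩
      · exact hRm _ (hR2 _ hp _ hb)
      · exact hRm _ (hR2 _ hb _ hp)
    have hdeg : ∀ i < E.length, codeWord E (i, true) ≠ [] → ∀ e ∈ degreeRow E i,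
        e.1 ∈ tilingVars E ∨ e.1 = .inr none ∨ ∃ j < k, e.1 = .inr (some j) := by
      intro i hi hw e he
      simp only [degreeRow, List.mem_append, List.mem_singleton] at he
      rcases he with he | he | rfl
      · exact Or.inl (hside _ _ (hlast i hi hw true) e he)
      · exact Or.inl (hside _ _ (hlast i hi hw false) e he)
      · refine Or.inr (Or.inr ⟨_, ?_, rfl⟩)
        have : (E.map fun e => e.1.1).getD i 0 = E[i].1.1 := by simp [List.getD, hi]
        rw [this]
        exact hk _ (List.getElem_mem _)
    intro r hr e he
    simp only [tilingRows, List.mem_append, List.mem_map, List.mem_filter, List.mem_flatMap,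
      List.mem_singleton, List.mem_range, decide_eq_true_eq] at hr
    rcases hr with ⟨y, hy, rfl⟩ | ⟨y, hy, rfl⟩ | ⟨y, ⟨hy, -⟩, rfl⟩ | ⟨y, hy, rfl⟩ |
      ⟨i, ⟨hi, hw⟩, hr⟩ | rfl
    · rw [triangleRow, List.mem_singleton] at he
      exact Or.inl (he ▸ hTm y hy)
    · rw [rectangleRow, List.mem_singleton] at he
      exact Or.inl (he ▸ hRm y hy)
    · rw [rectangleRow, List.mem_singleton] at he
      exact Or.inl (he ▸ hRm y hy)
    · simp only [balanceRow, List.mem_append, List.mem_map] at he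
      rcases he with ⟨y, hy, rfl⟩ | ⟨y, hy, rfl⟩
      · exact Or.inl (hTm y hy)
      · exact Or.inl (hRm y hy)
    · simp only [List.mem_cons, List.not_mem_nil, or_false] at hr
      rcases hr with rfl | rfl
      · exact hdeg i hi hw e he
      · simp only [Row.scale, List.mem_map] at he
        obtain ⟨e, he, rfl⟩ := he
        exact hdeg i hi hw e he
    · simp only [costRow, List.mem_cons, List.mem_map] at he
      rcases he with rfl | ⟨y, hy, rfl⟩
      · exact Or.inr (Or.inl rfl)
      · exact Or.inl (hTm y hy)
  · intro a c h
    obtain ⟨R, T, h⟩ := (hP a c).1 h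
    have h1 := h.cost
    have h2 : 0 ≤ ∑ a, ∑ b, ∑ c, T a b c := Finset.sum_nonneg fun _ _ => Finset.sum_nonneg fun _ _ =>
      Finset.sum_nonneg fun _ _ => h.triangle_nonneg _ _ _
    linarith

end Correctness

/-! ### Sums with signs, and the stable limit -/

section Signed

variable {G : Type u} [Group G] {κ : Type} [DecidableEq κ]

/-- The elements of a family and their inverses. -/
def signed (γ : κ → G) (i : κ × Bool) : G := if i.2 then γ i.1 else (γ i.1)⁻¹

/-- The coefficients of a multiset of signed indices. -/
def net (m : Multiset (κ × Bool)) (i : κ) : ℚ := m.count (i, true) - m.count (i, false)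

omit [DecidableEq κ] in
theorem signed_flip (γ : κ → G) (i : κ × Bool) : signed γ (i.1, !i.2) = (signed γ i)⁻¹ := by
  rcases i with ⟨i, _ | _⟩ <;> simp [signed]

/-- A nontrivial element of `B` has its inverse in `B` too, and the two are glued together
(`SclLE.of_cons_inv`); trivial elements can simply be dropped, so no balance is required of them. -/
theorem SclLE.of_balanced {γ : κ → G} {r : ℝ} {M : Multiset (κ × Bool)} (B : Multiset (κ × Bool))
    (hB : ∀ i, γ i ≠ 1 → B.count (i, true) = B.count (i, false))
    (h : SclLE ((B + M).map (signed γ)) r) : SclLE (M.map (signed γ)) r := by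
  induction hn : Multiset.card B using Nat.strong_induction_on generalizing B with
  | _ n ih =>
    subst hn
    rcases Multiset.empty_or_exists_mem B with rfl | ⟨a, ha⟩
    · simpa using h
    · obtain ⟨B, rfl⟩ := Multiset.exists_cons_of_mem ha
      by_cases h1 : γ a.1 = 1
      · refine ih _ (by simp) B (fun i hi => ?_) ?_ rfl
        · have hai : ∀ ε, a ≠ (i, ε) := by
            rintro ε rfl
            exact hi h1
          have := hB i hi
          rwa [Multiset.count_cons_of_ne (hai _).symm, Multiset.count_cons_of_ne (hai _).symm] at this
        · have : signed γ a = 1 := by simp [signed, h1]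
          simpa [this, sclLE_one_cons] using h
      · have hc : (a.1, !a.2) ∈ B := by
          have h2 := hB a.1 h1
          rw [← Multiset.count_pos]
          rcases a with ⟨i, _ | _⟩
          · rw [Multiset.count_cons_self, Multiset.count_cons_of_ne (by simp)] at h2
            change 0 < B.count (i, true)
            have h3 : B.count (i, true) = B.count (i, false) + 1 := h2
            omega
          · rw [Multiset.count_cons_self, Multiset.count_cons_of_ne (by simp)] at h2
            change 0 < B.count (i, false)
            have h3 : B.count (i, true) + 1 = B.count (i, false) := h2
            omega
        obtain ⟨B, rfl⟩ := Multiset.exists_cons_of_mem hc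
        refine ih _ (by simp) B (fun i hi => ?_) ?_ rfl
        · have h2 := hB i hi
          rcases a with ⟨j, _ | _⟩ <;> simp only [Multiset.count_cons, Prod.mk.injEq] at h2 <;>
            by_cases hij : i = j <;> simp_all
        · have h2 : SclLE (signed γ a ::ₘ (signed γ a)⁻¹ ::ₘ (B + M).map (signed γ)) r := by
            rw [← signed_flip]
            simpa using h
          exact h2.of_cons_inv

omit [DecidableEq κ] in
theorem SclLE.add_pairs {γ : κ → G} {r : ℝ} {M : Multiset (κ × Bool)}
    (h : SclLE (M.map (signed γ)) r) (B : Multiset (κ × Bool)) :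
    SclLE ((M + B.map (fun i => (i.1, !i.2)) + B).map (signed γ)) r := by
  induction B using Multiset.induction with
  | empty => simpa using h
  | cons a B ih =>
    have := ih.cons_inv (signed γ a)
    rw [← signed_flip] at this
    simp only [Multiset.map_add, Multiset.map_cons, Multiset.map_map, Multiset.add_cons,
      Multiset.cons_add] at this ⊢
    exact this

/-- A bound on `scl` depends only on the coefficients of the nontrivial elements. -/
theorem SclLE.of_net_eq {γ : κ → G} {r : ℝ} {M M' : Multiset (κ × Bool)}
    (hM : ∀ i, γ i ≠ 1 → net M i = net M' i) (h : SclLE (M.map (signed γ)) r) :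
    SclLE (M'.map (signed γ)) r := by
  -- `M` together with the reverse of `M'` is balanced, and the inverse pairs formed by `M'` and its
  -- reverse can be added without cost. Removing the balanced part leaves `M'`.
  refine SclLE.of_balanced (M + M'.map fun i => (i.1, !i.2)) (fun i hi => ?_) (h.add_pairs M')
  have hinj : Function.Injective fun i : κ × Bool => (i.1, !i.2) := by
    rintro ⟨i, ε⟩ ⟨j, δ⟩ hij
    simpa using hij
  have h1 := Multiset.count_map_eq_count' _ M' hinj (i, false)
  have h2 := Multiset.count_map_eq_count' _ M' hinj (i, true)
  simp only [Bool.not_false, Bool.not_true] at h1 h2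
  have h3 := hM i hi
  simp only [net] at h3
  rw [Multiset.count_add, Multiset.count_add, h1, h2]
  have : ((M.count (i, true) + M'.count (i, false) : ℕ) : ℚ) =
      ((M.count (i, false) + M'.count (i, true) : ℕ) : ℚ) := by
    push_cast
    linarith
  exact_mod_cast this

omit [DecidableEq κ] in
theorem Bounds.map_conj {k : ℕ} {f f' : κ → G} {m : Multiset κ} {m' : Multiset G}
    (hf : ∀ i ∈ m, IsConj (f i) (f' i)) (h : Bounds k (m.map f + m')) :
    Bounds k (m.map f' + m') := by
  induction m using Multiset.induction generalizing m' with
  | empty => simpa using h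
  | cons a m ih =>
    rw [Multiset.map_cons, Multiset.cons_add] at h ⊢
    rw [← Multiset.add_cons]
    refine ih (fun i hi => hf i (by simp [hi])) ?_
    rw [Multiset.add_cons]
    exact h.conj (hf a (by simp))

omit [DecidableEq κ] in
theorem Bounds.map_conj_pow {k n : ℕ} {f f' : κ → G} {m : Multiset κ}
    (hf : ∀ i ∈ m, IsConj (f i) (f' i)) (h : Bounds k ((m.map f).map (· ^ n))) :
    Bounds k ((m.map f').map (· ^ n)) := by
  rw [Multiset.map_map] at h ⊢
  have := Bounds.map_conj (f := (· ^ n) ∘ f) (f' := (· ^ n) ∘ f') (m' := 0)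
    (fun i hi => (hf i hi).pow n) (by simpa using h)
  simpa using this

omit [DecidableEq κ] in
theorem SclLE.map_conj {r : ℝ} {f f' : κ → G} {m : Multiset κ}
    (hf : ∀ i ∈ m, IsConj (f i) (f' i)) (h : SclLE (m.map f) r) : SclLE (m.map f') r :=
  h.imp 0 fun _ _ hk => hk.map_conj_pow hf

omit [DecidableEq κ] in
theorem isConj_signed {γ γ' : κ → G} (h : ∀ i, IsConj (γ i) (γ' i)) (i : κ × Bool) :
    IsConj (signed γ i) (signed γ' i) := by
  rcases i with ⟨i, _ | _⟩
  · obtain ⟨c, hc⟩ := isConj_iff.1 (h i)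
    exact isConj_iff.2 ⟨c, by simp [signed, ← hc, mul_assoc]⟩
  · exact h i

theorem Bounds.nsmul {k : ℕ} {m : Multiset G} (h : Bounds k m) (n : ℕ) : Bounds (n * k) (n • m) := by
  induction n with
  | zero => simpa using Bounds.zero
  | succ n ih => rw [Nat.succ_mul, succ_nsmul]; exact ih.add h

/-- Finiteness for `m` passes to all powers; this is the hypothesis on remainders in
`SclLE.of_nsmul`. -/
theorem Bounds.exists_pow {k : ℕ} {m : Multiset G} (h : Bounds k m) (n : ℕ) :
    ∃ k, Bounds k (m.map (· ^ n)) :=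
  ⟨_, by simpa using Bounds.map_pow (m := 0) (by simpa using h.nsmul n)⟩

/-- The stable commutator length of a multiset exists and has the given value. -/
structure HasScl (m : Multiset G) (r : ℝ) : Prop where
  nonneg : 0 ≤ r
  upper : SclLE m r
  lower : ∃ c : ℝ, ∀ n k : ℕ, Bounds k (m.map (· ^ n)) → r * n ≤ k + c

theorem HasScl.tendsto {l : List G} {r : ℝ} (h : HasScl (l : Multiset G) r) :
    Tendsto (fun n : ℕ => (clSum (l.map (· ^ n)) : ℝ≥0∞) / (n : ℝ≥0∞)) atTop
      (𝓝 (ENNReal.ofReal r)) := by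
  obtain ⟨c, hc⟩ := h.lower
  obtain ⟨d, hd⟩ := h.upper
  have hK : ∀ n : ℕ, ∃ K : ℕ, clSum (l.map (· ^ n)) = K ∧ r * n - c ≤ K ∧ (K : ℝ) ≤ r * n + d := by
    intro n
    obtain ⟨k, hk, hb⟩ := hd n
    rw [Multiset.map_coe, bounds_coe] at hb
    obtain ⟨K, hK⟩ := ENat.ne_top_iff_exists.1 (ne_top_of_le_ne_top (ENat.natCast_ne_top k) hb)
    refine ⟨K, hK.symm, ?_, ?_⟩
    · have := hc n K (by rw [Multiset.map_coe, bounds_coe, hK])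
      linarith
    · rw [← hK] at hb
      have : (K : ℝ) ≤ k := by exact_mod_cast hb
      linarith
  choose K hK1 hK2 hK3 using hK
  have h1 : Tendsto (fun n : ℕ => (K n : ℝ) / n) atTop (𝓝 r) := by
    have t1 : Tendsto (fun n : ℕ => r - c / n) atTop (𝓝 (r - 0)) :=
      tendsto_const_nhds.sub (tendsto_const_div_atTop_nhds_zero_nat c)
    have t2 : Tendsto (fun n : ℕ => r + d / n) atTop (𝓝 (r + 0)) :=
      tendsto_const_nhds.add (tendsto_const_div_atTop_nhds_zero_nat (d : ℝ))
    rw [sub_zero] at t1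
    rw [add_zero] at t2
    refine tendsto_of_tendsto_of_tendsto_of_le_of_le' t1 t2 ?_ ?_
    · filter_upwards [eventually_gt_atTop 0] with n hn
      have hn' : (0 : ℝ) < n := by exact_mod_cast hn
      rw [le_div_iff₀ hn', sub_mul, div_mul_cancel₀ _ hn'.ne']
      exact hK2 n
    · filter_upwards [eventually_gt_atTop 0] with n hn
      have hn' : (0 : ℝ) < n := by exact_mod_cast hn
      rw [div_le_iff₀ hn', add_mul, div_mul_cancel₀ _ hn'.ne']
      exact hK3 n
  refine (ENNReal.tendsto_ofReal h1).congr' ?_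
  filter_upwards [eventually_gt_atTop 0] with n hn
  have hn' : (0 : ℝ) < n := by exact_mod_cast hn
  rw [hK1, ENNReal.ofReal_div_of_pos hn', ENNReal.ofReal_natCast, ENNReal.ofReal_natCast]
  rfl

theorem HasScl.sclSum_eq {l : List G} {r : ℝ} (h : HasScl (l : Multiset G) r) :
    (sclSum l).toReal = r := by
  rw [sclSum, h.tendsto.liminf_eq, ENNReal.toReal_ofReal h.nonneg]

end Signed

/-! ### Solutions of the program and bounds on scl -/

section Solutions

variable {ι : Type v} {I : Type} [Fintype I] [DecidableEq I] {ws : I → Word ι}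

theorem exists_common_denominator {α : Type*} [Fintype α] (f : α → ℚ) (hf : ∀ a, 0 ≤ f a) :
    ∃ N : ℕ, 0 < N ∧ ∃ n : α → ℕ, ∀ a, (n a : ℚ) = N * f a := by
  classical
  refine ⟨∏ a, (f a).den, Finset.prod_pos fun a _ => (f a).pos,
    fun a => (f a).num.toNat * ∏ a' ∈ Finset.univ.erase a, (f a').den, fun a => ?_⟩
  have h1 : (((f a).num.toNat : ℤ) : ℚ) = (f a).num := by
    rw [Int.toNat_of_nonneg (Rat.num_nonneg.2 (hf a))]
  rw [← Finset.mul_prod_erase _ _ (Finset.mem_univ a)]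
  push_cast at h1 ⊢
  rw [h1]
  have h2 : ((f a).num : ℚ) = f a * (f a).den := (Rat.mul_den_eq_num _).symm
  rw [h2]
  ring

theorem IsTiling.of_cast {R : Pos ws → Pos ws → ℤ} {T : Pos ws → Pos ws → Pos ws → ℤ}
    (h : IsTiling (fun a b => (R a b : ℚ)) (fun a b c => (T a b c : ℚ))) : IsTiling R T := by
  refine ⟨fun a b hab => by exact_mod_cast h.adj a b hab, fun u v => ?_⟩
  have := h.balance u v
  simp only [sideSign] at this ⊢
  exact_mod_cast this

theorem IsTiling.smul {R : Pos ws → Pos ws → ℚ} {T : Pos ws → Pos ws → Pos ws → ℚ}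
    (h : IsTiling R T) (q : ℚ) : IsTiling (fun a b => q * R a b) (fun a b c => q * T a b c) := by
  refine ⟨fun a b hab => by rw [h.adj a b hab, mul_zero], fun u v => ?_⟩
  simp only [mul_assoc, ← Finset.mul_sum, ← mul_add]
  rw [h.balance u v, mul_zero]

theorem lastCount_smul (R : Pos ws → Pos ws → ℚ) (q : ℚ) (i : I) :
    lastCount (fun a b => q * R a b) i = q * lastCount R i := by
  simp only [lastCount, sideCount, ← mul_add, ← Finset.mul_sum]

theorem lastCount_natCast (R : Pos ws → Pos ws → ℕ) (i : I) :
    lastCount (fun a b => (R a b : ℚ)) i = (lastCount R i : ℕ) := by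
  simp [lastCount, sideCount]

variable {κ : Type} [Fintype κ] [DecidableEq κ] {ws : κ × Bool → Word ι} {x : κ → ℚ} {c : ℚ}
  {R : Pos ws → Pos ws → ℚ} {T : Pos ws → Pos ws → Pos ws → ℚ}

theorem IsSolution.smul (h : IsSolution ws x c R T) {q : ℚ} (hq : 0 ≤ q) :
    IsSolution ws (fun i => q * x i) (q * c) (fun a b => q * R a b) (fun a b c => q * T a b c) where
  tiling := h.tiling.smul q
  rectangle_nonneg a b := mul_nonneg hq (h.rectangle_nonneg a b)
  triangle_nonneg a b c := mul_nonneg hq (h.triangle_nonneg a b c)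
  degree i hi := by rw [lastCount_smul, lastCount_smul, ← mul_sub, h.degree i hi]
  cost := by
    simp only [← Finset.mul_sum]
    have := mul_le_mul_of_nonneg_left h.cost hq
    linarith

theorem IsSolution.cost_nonneg (h : IsSolution ws x c R T) : 0 ≤ c := by
  have h1 := h.cost
  have h2 : 0 ≤ ∑ a, ∑ b, ∑ c, T a b c := Finset.sum_nonneg fun _ _ => Finset.sum_nonneg fun _ _ =>
    Finset.sum_nonneg fun _ _ => h.triangle_nonneg _ _ _
  linarith

/-- Clearing denominators in a solution. -/
theorem IsSolution.exists_nat (h : IsSolution ws x c R T) : ∃ N : ℕ, 0 < N ∧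
    ∃ (R' : Pos ws → Pos ws → ℕ) (T' : Pos ws → Pos ws → Pos ws → ℕ),
      IsTiling (fun a b => (R' a b : ℤ)) (fun a b c => (T' a b c : ℤ)) ∧
      IsSolution ws (fun i => N * x i) (N * c) (fun a b => (R' a b : ℚ))
        (fun a b c => (T' a b c : ℚ)) := by
  obtain ⟨N, hN, n, hn⟩ := exists_common_denominator
    (Sum.elim (fun y : Pos ws × Pos ws => R y.1 y.2)
      fun y : Pos ws × Pos ws × Pos ws => T y.1 y.2.1 y.2.2) (by
        rintro (y | y)
        · exact h.rectangle_nonneg _ _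
        · exact h.triangle_nonneg _ _ _)
  have h1 := h.smul (q := N) (by positivity)
  have hR : (fun a b => (N : ℚ) * R a b) = fun a b => ((n (.inl (a, b)) : ℕ) : ℚ) := by
    funext a b
    rw [hn]; rfl
  have hT : (fun a b c => (N : ℚ) * T a b c) = fun a b c => ((n (.inr (a, b, c)) : ℕ) : ℚ) := by
    funext a b c
    rw [hn]; rfl
  rw [hR, hT] at h1
  refine ⟨N, hN, _, _, IsTiling.of_cast ?_, h1⟩
  exact_mod_cast h1.tiling

variable {F : Type u} [Group F] (b : FreeGroupBasis ι F)

theorem sum_last_eq (R : Pos ws → Pos ws → ℕ) :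
    ∑ p : Pos ws with p.IsLast, sideCount R p • ({p.1} : Multiset (κ × Bool)) =
      ∑ i, lastCount R i • {i} := by
  simp only [lastCount, Finset.sum_smul, Finset.sum_filter]
  rw [Finset.sum_comm]
  refine Finset.sum_congr rfl fun p _ => ?_
  by_cases hp : p.IsLast <;> simp [hp, ite_smul]

omit [Fintype κ] [DecidableEq κ] in
theorem evalWord_signed (hinv : ∀ i, ws (i, false) = FreeGroup.invRev (ws (i, true))) :
    (fun i => evalWord b (ws i)) = signed fun i => evalWord b (ws (i, true)) := by
  funext ⟨i, ε⟩
  cases ε <;> simp [signed, hinv, evalWord_invRev]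

/-- Solutions of the linear program bound `scl` from above. -/
theorem IsSolution.sclLE (hinv : ∀ i, ws (i, false) = FreeGroup.invRev (ws (i, true)))
    (h : IsSolution ws x c R T) (m : Multiset (κ × Bool))
    (hm : ∀ i, ws (i, true) ≠ [] → net m i = x i) (hb : ∃ k, Bounds k (m.map fun i => evalWord b (ws i))) :
    SclLE (m.map fun i => evalWord b (ws i)) c := by
  obtain ⟨N, hN, R', T', hRT, hs⟩ := h.exists_nat
  have h1 := hRT.sclLE b
  have h2 : (∑ p : Pos ws with p.IsLast, sideCount R' p • ({evalWord b (ws p.1)} : Multiset F)) =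
      Multiset.map (fun i => evalWord b (ws i))
        (∑ i, lastCount R' i • ({i} : Multiset (κ × Bool))) := by
    rw [← sum_last_eq, ← Multiset.coe_mapAddMonoidHom, map_sum]
    simp [Multiset.map_nsmul]
  have hcount : ∀ i, (∑ i, lastCount R' i • ({i} : Multiset (κ × Bool))).count i = lastCount R' i := by
    intro i
    rw [Multiset.count_sum', Finset.sum_eq_single i]
    · simp
    · intro j _ hj
      simp [hj.symm]
    · simp
  rw [h2, ← Multiset.map_nsmul] at h1
  have hc0 : (0 : ℝ) ≤ c := by exact_mod_cast h.cost_nonneg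
  obtain ⟨k, hk⟩ := hb
  -- Clearing denominators multiplies the sum by `N`, and `IsTiling.sclLE` doubles it once more. The
  -- boundary of the tiling agrees with `2 * N` copies of `m` in the net coefficients of nontrivial
  -- elements only, which is enough for `SclLE.of_net_eq`.
  refine SclLE.of_nsmul (N := 2 * N) (by omega) ?_ hc0 fun n => hk.exists_pow n
  rw [← Multiset.map_nsmul]
  rw [evalWord_signed b hinv] at h1 ⊢
  refine SclLE.of_net_eq ?_ (h1.mono ?_)
  · intro i hi
    have hw : ws (i, true) ≠ [] := by
      intro h0
      simp [h0, evalWord] at hi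
    have := hs.degree i hw
    rw [lastCount_natCast, lastCount_natCast] at this
    simp only [net, Multiset.count_nsmul, hcount]
    have h3 := hm i hw
    simp only [net] at h3
    push_cast
    rw [← mul_sub, this, mul_assoc, mul_assoc, ← mul_sub, ← mul_sub, h3]
  · have := hs.cost
    have h3 : ((∑ a, ∑ b, ∑ c, T' a b c : ℕ) : ℝ) ≤ 4 * (N * c) := by
      have h4 : ((∑ a, ∑ b, ∑ c, T' a b c : ℕ) : ℚ) ≤ 4 * (N * c) := by
        push_cast
        exact this
      exact_mod_cast h4
    push_cast at h3 ⊢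
    linarith

/-- Bounds on commutator lengths of powers yield solutions of the linear program. -/
theorem exists_isSolution_of_bounds (hws : ∀ i, FreeGroup.IsCyclicallyReduced (ws i))
    (hinv : ∀ i, ws (i, false) = FreeGroup.invRev (ws (i, true)))
    (l : List (κ × Bool)) (n k : ℕ)
    (h : Bounds k (((l : Multiset (κ × Bool)).map fun i => evalWord b (ws i)).map (· ^ n))) :
    ∃ R T, IsSolution ws (fun i => n * net l i) (k + (6 * l.length + 4) / 4) R T := by
  obtain ⟨R, T, h1, h2, h3, h4, h5⟩ := exists_isTiling_of_bounds b hws l n k (by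
    simpa [Function.comp_def] using h)
  have hlast : ∀ i, ws i ≠ [] → lastCount R i = n * (l : Multiset (κ × Bool)).count i := by
    intro i hi
    have hl : 0 < (ws i).length := List.length_pos_iff.2 hi
    have h6 := h4 ⟨i, (ws i).length - 1, by omega⟩
    rw [Multiset.coe_count, ← h6]
    exact lastCount_eq R ⟨i, (ws i).length - 1, by omega⟩ (by simp only [Pos.IsLast]; omega)
  refine ⟨R, T, h1, h2, h3, fun i hi => ?_, by linarith⟩
  have hi' : ws (i, false) ≠ [] := by
    rw [hinv, ← List.length_pos_iff, FreeGroup.invRev_length]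
    exact List.length_pos_iff.2 hi
  rw [hlast _ hi, hlast _ hi', net, mul_sub]

end Solutions

/-! ### Cyclic reduction of words -/

section Reduction

variable {ι : Type v} [DecidableEq ι]

/-- Multiplication of a reduced word by a letter. -/
def pushLetter (a : ι × Bool) (w : Word ι) : Word ι :=
  if w.head? = some (flipLetter a) then w.tail else a :: w

/-- Cancellation of the first letter of a word against the last one. -/
def trim (w : Word ι) : Word ι :=
  if w.getLast? = w.head?.map flipLetter then w.tail.dropLast else w

/-- The cyclically reduced word of the conjugacy class of a word. -/
def cyclicReduce (w : Word ι) : Word ι := trim^[w.length] (w.foldr pushLetter [])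

omit [DecidableEq ι] in
theorem eq_flipLetter {a b : ι × Bool} (h : ¬ (a.1 = b.1 → a.2 = b.2)) : a = flipLetter b := by
  rcases a with ⟨i, _ | _⟩ <;> rcases b with ⟨j, _ | _⟩ <;> simp [flipLetter] at h ⊢ <;> exact h

theorem isReduced_pushLetter (a : ι × Bool) {w : Word ι} (hw : FreeGroup.IsReduced w) :
    FreeGroup.IsReduced (pushLetter a w) := by
  rw [pushLetter]
  split_ifs with h
  · exact hw.tail
  · refine List.isChain_cons.2 ⟨fun y hy => ?_, hw⟩
    by_contra h2
    rw [eq_flipLetter fun h3 => h2 fun h4 => (h3 h4.symm).symm] at hy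
    exact h hy

theorem isReduced_foldr_pushLetter (w : Word ι) : FreeGroup.IsReduced (w.foldr pushLetter []) := by
  induction w with
  | nil => exact List.isChain_nil
  | cons a w ih => exact isReduced_pushLetter a ih

theorem length_foldr_pushLetter (w : Word ι) : (w.foldr pushLetter []).length ≤ w.length := by
  induction w with
  | nil => simp
  | cons a w ih =>
    rw [List.foldr_cons, pushLetter]
    split_ifs <;> simp <;> omega

/-- Either the two ends cancel and a nonempty word gets shorter, or they do not and the word is
cyclically reduced and stays fixed. As many rounds as there are letters therefore suffice. -/
theorem isCyclicallyReduced_iterate_trim {w : Word ι} {n : ℕ} (hw : FreeGroup.IsReduced w)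
    (hn : w.length ≤ n) : FreeGroup.IsCyclicallyReduced (trim^[n] w) := by
  induction n generalizing w with
  | zero => simp_all
  | succ n ih =>
    by_cases h : w.getLast? = w.head?.map flipLetter
    · rw [Function.iterate_succ_apply, trim, if_pos h]
      refine ih (hw.tail.infix (List.dropLast_prefix _).isInfix) ?_
      simp
      omega
    · rw [Function.iterate_fixed (by rw [trim, if_neg h])]
      refine ⟨hw, fun a ha b hb => ?_⟩
      by_contra h2
      rw [eq_flipLetter h2] at ha
      rw [Option.mem_def] at ha hb
      exact h (by rw [ha, hb]; rfl)

theorem isCyclicallyReduced_cyclicReduce (w : Word ι) :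
    FreeGroup.IsCyclicallyReduced (cyclicReduce w) :=
  isCyclicallyReduced_iterate_trim (isReduced_foldr_pushLetter w) (length_foldr_pushLetter w)

theorem pushLetter_subset (a : ι × Bool) (w : Word ι) : pushLetter a w ⊆ a :: w := by
  rw [pushLetter]
  split_ifs
  · exact fun x hx => List.mem_cons_of_mem _ (List.mem_of_mem_tail hx)
  · exact List.Subset.refl _

theorem foldr_pushLetter_subset (w : Word ι) : w.foldr pushLetter [] ⊆ w := by
  induction w with
  | nil => simp
  | cons a w ih =>
    exact List.Subset.trans (pushLetter_subset a _) (List.cons_subset_cons a ih)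

theorem trim_subset (w : Word ι) : trim w ⊆ w := by
  rw [trim]
  split_ifs
  · exact fun x hx => List.mem_of_mem_tail (List.mem_of_mem_dropLast hx)
  · exact List.Subset.refl _

theorem iterate_trim_subset (w : Word ι) (n : ℕ) : trim^[n] w ⊆ w := by
  induction n generalizing w with
  | zero => exact List.Subset.refl _
  | succ n ih => exact List.Subset.trans (ih (trim w)) (trim_subset w)

theorem cyclicReduce_subset (w : Word ι) : cyclicReduce w ⊆ w :=
  List.Subset.trans (iterate_trim_subset _ _) (foldr_pushLetter_subset w)

variable {ι' : Type*} [DecidableEq ι'] {name : ι → ι'} {s : Set ι}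

omit [DecidableEq ι] [DecidableEq ι'] in
theorem eq_of_name_eq (hs : Set.InjOn name s) {a b : ι × Bool} (ha : a.1 ∈ s) (hb : b.1 ∈ s)
    (h : (name a.1, a.2) = (name b.1, b.2)) : a = b := by
  rw [Prod.mk.injEq] at h
  exact Prod.ext (hs ha hb h.1) h.2

theorem map_pushLetter (hs : Set.InjOn name s) (a : ι × Bool) (w : Word ι) (ha : a.1 ∈ s)
    (hw : ∀ x ∈ w, x.1 ∈ s) :
    (pushLetter a w).map (fun a => (name a.1, a.2)) =
      pushLetter (name a.1, a.2) (w.map fun a => (name a.1, a.2)) := by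
  cases w with
  | nil => simp [pushLetter]
  | cons c w =>
    have : (name c.1, c.2) = flipLetter (name a.1, a.2) ↔ c = flipLetter a :=
      ⟨fun h => eq_of_name_eq hs (hw c (by simp)) ha h, by rintro rfl; rfl⟩
    simp only [pushLetter, List.head?_cons, Option.some.injEq, List.map_cons, this]
    split_ifs <;> simp

theorem map_foldr_pushLetter (hs : Set.InjOn name s) (w : Word ι) (hw : ∀ x ∈ w, x.1 ∈ s) :
    (w.foldr pushLetter []).map (fun a => (name a.1, a.2)) =
      (w.map fun a => (name a.1, a.2)).foldr pushLetter [] := by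
  induction w with
  | nil => rfl
  | cons a w ih =>
    rw [List.map_cons, List.foldr_cons, List.foldr_cons,
      map_pushLetter hs _ _ (hw a (by simp)), ih fun x hx => hw x (by simp [hx])]
    exact fun x hx => hw x (List.mem_cons_of_mem _ (foldr_pushLetter_subset w hx))

theorem map_trim (hs : Set.InjOn name s) (w : Word ι) (hw : ∀ x ∈ w, x.1 ∈ s) :
    (trim w).map (fun a => (name a.1, a.2)) = trim (w.map fun a => (name a.1, a.2)) := by
  cases w with
  | nil => rfl
  | cons c w =>
    obtain ⟨d, hd⟩ : ∃ d, (c :: w).getLast? = some d := ⟨_, List.getLast?_eq_some_getLast (by simp)⟩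
    have hd2 : ((c :: w).map fun a => (name a.1, a.2)).getLast? = some (name d.1, d.2) := by
      rw [List.getLast?_map, hd]; rfl
    have : (name d.1, d.2) = flipLetter (name c.1, c.2) ↔ d = flipLetter c :=
      ⟨fun h => eq_of_name_eq hs (hw d (List.mem_of_getLast? hd)) (hw c (by simp)) h,
        by rintro rfl; rfl⟩
    rw [trim, trim, hd, hd2]
    simp only [List.map_cons, List.head?_cons, Option.map_some, Option.some.injEq, this]
    split_ifs <;> simp

/-- The reduction only tests whether letters are inverse to each other, so it commutes with every
renaming that is injective on the letters of the word. This allows the algorithm to reduce the words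
after their letters have been numbered. -/
theorem map_cyclicReduce (hs : Set.InjOn name s) (w : Word ι) (hw : ∀ x ∈ w, x.1 ∈ s) :
    (cyclicReduce w).map (fun a => (name a.1, a.2)) =
      cyclicReduce (w.map fun a => (name a.1, a.2)) := by
  rw [cyclicReduce, cyclicReduce, ← map_foldr_pushLetter hs w hw, List.length_map]
  have h : ∀ n, ((trim^[n] (w.foldr pushLetter [])).map fun a => (name a.1, a.2)) =
      trim^[n] ((w.foldr pushLetter []).map fun a => (name a.1, a.2)) := by
    intro n
    induction n with
    | zero => rfl
    | succ n ih =>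
      rw [Function.iterate_succ_apply', Function.iterate_succ_apply', ← ih]
      exact map_trim hs _ fun x hx => hw x (foldr_pushLetter_subset w (iterate_trim_subset _ _ hx))
  exact h _

variable {F : Type u} [Group F] (b : FreeGroupBasis ι F)

theorem evalWord_pushLetter (a : ι × Bool) (w : Word ι) :
    evalWord b (pushLetter a w) = evalWord b (a :: w) := by
  rw [pushLetter]
  split_ifs with h
  · cases w with
    | nil => simp at h
    | cons c w =>
      have : c = flipLetter a := by simpa using h
      subst this
      rw [show a :: flipLetter a :: w = [a] ++ ([flipLetter a] ++ w) from rfl, evalWord_append,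
        evalWord_append, evalWord_flipLetter]
      simp
  · rfl

theorem evalWord_foldr_pushLetter (w : Word ι) :
    evalWord b (w.foldr pushLetter []) = evalWord b w := by
  induction w with
  | nil => rfl
  | cons a w ih =>
    rw [List.foldr_cons, evalWord_pushLetter, ← List.singleton_append, evalWord_append, ih,
      ← evalWord_append, List.singleton_append]

theorem isConj_evalWord_trim (w : Word ι) : IsConj (evalWord b w) (evalWord b (trim w)) := by
  rw [trim]
  split_ifs with h
  · cases w with
    | nil => rfl
    | cons c w =>
      rcases List.eq_nil_or_concat w with rfl | ⟨v, d, rfl⟩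
      · simp [(flipLetter_ne c).symm] at h
      · have : d = flipLetter c := by simpa [List.getLast?_cons] using h
        subst this
        refine isConj_iff.2 ⟨(evalWord b [c])⁻¹, ?_⟩
        rw [show c :: v.concat (flipLetter c) = [c] ++ (v ++ [flipLetter c]) by simp,
          evalWord_append, evalWord_append, evalWord_flipLetter]
        simp [mul_assoc]
  · rfl

theorem isConj_evalWord_cyclicReduce (w : Word ι) :
    IsConj (evalWord b w) (evalWord b (cyclicReduce w)) := by
  rw [cyclicReduce, ← evalWord_foldr_pushLetter b w]
  generalize w.foldr pushLetter [] = v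
  generalize w.length = n
  induction n generalizing v with
  | zero => rfl
  | succ n ih => exact (isConj_evalWord_trim b v).trans (ih (trim v))

omit [DecidableEq ι] in
theorem isCyclicallyReduced_invRev {w : Word ι} (hw : FreeGroup.IsCyclicallyReduced w) :
    FreeGroup.IsCyclicallyReduced (FreeGroup.invRev w) := by
  refine ⟨?_, ?_⟩
  · rw [FreeGroup.invRev, FreeGroup.IsReduced, List.isChain_reverse, List.isChain_map]
    refine hw.1.imp fun a c h h2 => ?_
    simpa using (h h2.symm).symm
  · intro a ha c hc h
    simp only [FreeGroup.invRev, List.getLast?_reverse, List.head?_reverse, List.head?_map,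
      List.getLast?_map, Option.mem_def, Option.map_eq_some_iff] at ha hc
    obtain ⟨a, ha, rfl⟩ := ha
    obtain ⟨c, hc, rfl⟩ := hc
    simpa using (hw.2 c hc a ha h.symm).symm

end Reduction

/-! ### scl as the optimal value of the program -/

section Program

variable {ι : Type v} {F : Type u} [Group F] (b : FreeGroupBasis ι F) {n k : ℕ}

/-- The linear program computes `scl` of all sums of elements of a finite family. -/
theorem exists_hasScl_of_isCoding (E : List Entry) (hE : E.length = n) (ws : Fin n × Bool → Word ι)
    (name : ι → ℕ) (hc : ∀ i, (ws i).map (fun a => (name a.1, a.2)) = codeWord E (i.1, i.2))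
    (hn : Set.InjOn name (wordLetters ws))
    (hcyc : ∀ i, FreeGroup.IsCyclicallyReduced (ws i))
    (hinv : ∀ i, ws (i, false) = FreeGroup.invRev (ws (i, true)))
    (hk : ∀ e ∈ E, e.1.1 < k) (γ : Fin n → F) (hγ : ∀ i, IsConj (γ i) (evalWord b (ws (i, true))))
    (j : Fin n → Fin k) (f : Fin n → Frac) (hj : ∀ i : Fin n, E[i].1 = ((j i : ℕ), f i)) :
    (∀ y ∈ tilingBounds k E, y.length = k) ∧
    ∀ (a : Fin k → ℚ) (m : Multiset (Fin n × Bool)), (∃ K, Bounds K (m.map (signed γ))) →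
      (∀ i, net m i = (f i).val * a (j i)) →
      ∃ y ∈ tilingBounds k E, (∀ y' ∈ tilingBounds k E, evalVec k y' a ≤ evalVec k y a) ∧
        HasScl (m.map (signed γ)) (evalVec k y a) ∧
        ∃ R T, IsSolution ws (net m) (evalVec k y a) R T := by
  subst hE
  have hj' : ∀ i : Fin E.length, E[i].1.2 = f i ∧
      (⟨E[i].1.1, hk _ (List.getElem_mem _)⟩ : Fin k) = j i := fun i => by
    have := hj i
    exact ⟨by rw [this], Fin.ext (by simp only [this])⟩
  obtain ⟨h1, h2⟩ := tilingBounds_spec (ws := ws) (name := name) (E := E) hc hn k hk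
    (fun a c => ∃ R T, IsSolution ws (fun i => (f i).val * a (j i)) c R T) (fun a c => by
      simp only [hj'])
  refine ⟨h1, fun a m hK hm => ?_⟩
  have hconj : ∀ i ∈ m, IsConj (signed γ i) (evalWord b (ws i)) := fun i _ => by
    have := isConj_signed hγ i
    rw [← evalWord_signed b hinv] at this
    exact this
  have hlow : ∀ N K : ℕ, Bounds K ((m.map (signed γ)).map (· ^ N)) →
      ∃ R T, IsSolution ws (fun i => (f i).val * ((N : ℚ) * a (j i)))
        (K + (6 * m.toList.length + 4) / 4) R T := by
    intro N K hb
    obtain ⟨R, T, h⟩ := exists_isSolution_of_bounds b hcyc hinv m.toList N K (by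
      rw [Multiset.coe_toList]
      exact hb.map_conj_pow hconj)
    refine ⟨R, T, ?_⟩
    rw [Multiset.coe_toList] at h
    convert h using 2 with i
    rw [hm]
    ring
  -- Some finite bound exists, so the program is feasible and its minimum is attained by one of the
  -- functionals.
  obtain ⟨K, hK⟩ := hK
  obtain ⟨R, T, h⟩ := hlow 1 K (by simpa using hK)
  simp only [Nat.cast_one, one_mul] at h
  obtain ⟨y, hy, R', T', hs⟩ := (h2 a _ ⟨R, T, h⟩).2
  have hs' : IsSolution ws (net m) (evalVec k y a) R' T' := by
    convert hs using 2 with i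
    exact hm i
  refine ⟨y, hy, fun y' hy' => (h2 a _ ⟨R', T', hs⟩).1 y' hy', ⟨?_, ?_, ?_⟩, R', T', hs'⟩
  · exact_mod_cast hs.cost_nonneg
  · have hup := hs'.sclLE b hinv m (fun i _ => rfl)
      ⟨K, by simpa using Bounds.map_conj (m' := 0) hconj (by simpa using hK)⟩
    exact hup.map_conj fun i hi => (hconj i hi).symm
  -- A bound for the `N`-th powers is a solution at the parameters `N * a`. The functional `y`
  -- bounds the cost from below there as well and is homogeneous, so the error does not grow with
  -- `N`.
  · refine ⟨((6 * m.toList.length + 4) / 4 : ℝ), fun N K' hb => ?_⟩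
    obtain ⟨R, T, h⟩ := hlow N K' hb
    have := (h2 (fun i => N * a i) _ ⟨R, T, h⟩).1 y hy
    have h3 : evalVec k y (fun i => N * a i) = N * evalVec k y a := by
      rw [evalVec, evalVec, Finset.mul_sum]
      exact Finset.sum_congr rfl fun _ _ => by ring
    rw [h3, mul_comm] at this
    have h4 := (Rat.cast_le (K := ℝ)).2 this
    push_cast at h4
    exact h4

theorem codeWord_ofFn (e : Fin n → Entry) (i : Fin n) (ε : Bool) :
    codeWord (List.ofFn e) (i, ε) = if ε then (e i).2 else FreeGroup.invRev (e i).2 := by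
  have : ((List.ofFn e).map Prod.snd).getD i [] = (e i).2 := by
    rw [List.getD_eq_getElem _ _ (by simp)]
    simp
  simp only [codeWord, this]

/-- The words of a finite family and their inverses, cyclically reduced. -/
def signedWords [DecidableEq ι] (w : Fin n → Word ι) (i : Fin n × Bool) : Word ι :=
  if i.2 then cyclicReduce (w i.1) else FreeGroup.invRev (cyclicReduce (w i.1))

/-- The program receives the cyclic reductions of the numbered words, while the conclusion concerns
the elements spelled by the original words; the two differ by conjugation, which scl ignores. -/
theorem exists_hasScl_of_words [DecidableEq ι] (w : Fin n → Word ι) (name : ι → ℕ)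
    (hn : Set.InjOn name (wordLetters w)) (j : Fin n → Fin k) (f : Fin n → Frac)
    (E : List Entry) (hE : E = List.ofFn fun i =>
      (((j i : ℕ), f i), cyclicReduce ((w i).map fun a => (name a.1, a.2)))) :
    (∀ y ∈ tilingBounds k E, y.length = k) ∧
    ∀ (a : Fin k → ℚ) (m : Multiset (Fin n × Bool)),
      (∃ K, Bounds K (m.map (signed fun i => evalWord b (w i)))) →
      (∀ i, net m i = (f i).val * a (j i)) →
      ∃ y ∈ tilingBounds k E, (∀ y' ∈ tilingBounds k E, evalVec k y' a ≤ evalVec k y a) ∧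
        HasScl (m.map (signed fun i => evalWord b (w i))) (evalVec k y a) ∧
        ∃ R T, IsSolution (signedWords w) (net m) (evalVec k y a) R T := by
  have hw : ∀ i, ∀ x ∈ w i, x.1 ∈ wordLetters w := fun i x hx => ⟨i, x, hx, rfl⟩
  refine exists_hasScl_of_isCoding b E (by simp [hE]) (signedWords w) name ?_ ?_ ?_ ?_ ?_ _
    (fun i => isConj_evalWord_cyclicReduce b (w i)) j f (fun i => by simp [hE])
  · rintro ⟨i, ε⟩
    rw [hE, codeWord_ofFn, ← map_cyclicReduce hn (w i) (hw i)]
    cases ε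
    · simp [signedWords, FreeGroup.invRev, Function.comp_def]
    · simp [signedWords]
  · refine hn.mono ?_
    rintro _ ⟨⟨i, ε⟩, x, hx, rfl⟩
    cases ε
    · simp only [signedWords, FreeGroup.invRev, Bool.false_eq_true, if_false, List.mem_reverse,
        List.mem_map] at hx
      obtain ⟨z, hz, rfl⟩ := hx
      exact hw i z (cyclicReduce_subset _ hz)
    · exact hw i x (cyclicReduce_subset _ (by simpa [signedWords] using hx))
  · rintro ⟨i, ε⟩
    cases ε
    · simpa [signedWords] using isCyclicallyReduced_invRev (isCyclicallyReduced_cyclicReduce (w i))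
    · simpa [signedWords] using isCyclicallyReduced_cyclicReduce (w i)
  · intro i
    simp [signedWords]
  · simp only [hE, List.mem_ofFn, forall_exists_index, forall_apply_eq_imp_iff]
    exact fun i => (j i).2

theorem exists_name {I : Type} [Finite I] (w : I → Word ι) :
    ∃ name : ι → ℕ, Set.InjOn name (wordLetters w) := by
  have : (wordLetters w).Finite := by
    have : wordLetters w = ⋃ i, {x | ∃ a ∈ w i, a.1 = x} := by
      ext x
      simp [wordLetters]
    rw [this]
    refine Set.finite_iUnion fun i => ?_
    have := ((w i).map Prod.fst).finite_toSet
    refine this.subset ?_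
    rintro _ ⟨a, ha, rfl⟩
    simp only [List.mem_map, Set.mem_ofPred_eq]
    exact ⟨a, ha, rfl⟩
  obtain ⟨name, h⟩ := Set.countable_iff_exists_injOn.1 this.countable
  exact ⟨name, h⟩

/-- Finitely many rational functionals compute `scl` of all sums of elements of a finite family,
and each value is attained by a solution of the linear program. -/
theorem exists_hasScl_family [DecidableEq ι] (w : Fin n → Word ι) :
    ∃ Y : Finset (Fin n → ℚ), ∀ m : Multiset (Fin n × Bool),
      (∃ K, Bounds K (m.map (signed fun i => evalWord b (w i)))) →
      ∃ y ∈ Y, (∀ y' ∈ Y, ∑ i, y' i * net m i ≤ ∑ i, y i * net m i) ∧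
        HasScl (m.map (signed fun i => evalWord b (w i))) ((∑ i, y i * net m i : ℚ) : ℝ) ∧
        ∃ R T, IsSolution (signedWords w) (net m) (∑ i, y i * net m i) R T := by
  obtain ⟨name, hn⟩ := exists_name w
  -- Every word gets a parameter of its own, with the coefficient `(1, 0)`, which is the code of 1.
  obtain ⟨-, h⟩ := exists_hasScl_of_words b w name hn id (fun _ => (1, 0)) _ rfl
  classical
  revert h
  generalize tilingBounds n _ = Z
  intro h
  refine ⟨Z.toFinset.image fun y i => (y.getD i (0, 0)).val, fun m hm => ?_⟩
  obtain ⟨y, hy, h1, h2, h3⟩ := h (net m) m hm fun i => by simp [Frac.val]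
  refine ⟨_, Finset.mem_image_of_mem _ (List.mem_toFinset.2 hy), ?_, h2, h3⟩
  simp only [Finset.mem_image, List.mem_toFinset]
  rintro _ ⟨y', hy', rfl⟩
  exact h1 y' hy'

end Program

/-! ### Boundaries, the relations in H, and generators of the quotient -/

section Boundaries

variable {G : Type u} [Group G]

theorem boundaryMap_single (p : G × G) (a : ℝ) : boundaryMap G (Finsupp.single p a) =
    Finsupp.single p.1 a - Finsupp.single (p.1 * p.2) a + Finsupp.single p.2 a := by
  simp [boundaryMap]

/-- The class of a group element modulo boundaries. -/
noncomputable def chainClass : G →* Multiplicative ((G →₀ ℝ) ⧸ B1 G) :=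
  MonoidHom.mk' (fun g => Multiplicative.ofAdd ((B1 G).mkQ (Finsupp.single g 1))) fun g h => by
    rw [← ofAdd_add, ← map_add]
    refine congrArg _ ((Submodule.Quotient.eq _).2 ?_)
    refine ⟨- Finsupp.single (g, h) 1, ?_⟩
    rw [map_neg, boundaryMap_single]
    abel

theorem toAdd_chainClass (g : G) :
    (chainClass g).toAdd = (B1 G).mkQ (Finsupp.single g 1) := rfl

theorem mkQ_sumChain (l : List G) : (B1 G).mkQ (sumChain l) = (chainClass l.prod).toAdd := by
  induction l with
  | nil => simp [sumChain]
  | cons a l ih =>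
    rw [List.prod_cons, map_mul, toAdd_mul, ← ih, toAdd_chainClass, ← map_add]
    simp [sumChain]

theorem sumChain_mem_B1 {l : List G} (h : l.prod ∈ commutator G) : sumChain l ∈ B1 G := by
  rw [← Submodule.ker_mkQ (B1 G), LinearMap.mem_ker, mkQ_sumChain]
  have : chainClass l.prod = 1 := Abelianization.commutator_subset_ker chainClass h
  rw [this, toAdd_one]

/-- Modulo boundaries, taking the class of a group element is a homomorphism to a commutative group,
so powers become multiples and conjugation disappears. -/
theorem homogeneousRelations_le : homogeneousRelations G ≤ B1 G := by
  refine Submodule.span_le.2 ?_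
  rintro _ (⟨g, n, rfl⟩ | ⟨g, h, rfl⟩)
  · rw [SetLike.mem_coe, ← Submodule.ker_mkQ (B1 G), LinearMap.mem_ker, map_sub, map_smul,
      ← toAdd_chainClass, ← toAdd_chainClass, map_zpow, toAdd_zpow, sub_eq_zero,
      Int.cast_smul_eq_zsmul]
  · rw [SetLike.mem_coe, ← Submodule.ker_mkQ (B1 G), LinearMap.mem_ker, map_sub,
      ← toAdd_chainClass, ← toAdd_chainClass, map_mul chainClass, map_mul chainClass, map_inv,
      mul_comm (chainClass h), mul_inv_cancel_right, sub_self]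

theorem boundaryMap_mem (f : G × G →₀ ℝ) : boundaryMap G f ∈ B1 G := ⟨f, rfl⟩

theorem toB1H_eq_iff {c c' : G →₀ ℝ} {hc : c ∈ B1 G} {hc' : c' ∈ B1 G} :
    toB1H c hc = toB1H c' hc' ↔ c - c' ∈ homogeneousRelations G := by
  rw [Subtype.ext_iff]
  exact Submodule.Quotient.eq _

theorem toB1H_smul {c : G →₀ ℝ} (hc : c ∈ B1 G) (r : ℝ) :
    toB1H (r • c) (Submodule.smul_mem _ r hc) = r • toB1H c hc := rfl

theorem toB1H_surjective (x : B1H G) : ∃ c hc, toB1H c hc = x := by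
  obtain ⟨x, c, hc, rfl⟩ := x
  exact ⟨c, hc, rfl⟩

omit [Group G] in
theorem sumChain_append (l l' : List G) : sumChain (l ++ l') = sumChain l + sumChain l' := by
  simp [sumChain]

theorem sumChain_inv_mem (l : List G) :
    sumChain (l.map (·⁻¹)) + sumChain l ∈ homogeneousRelations G := by
  induction l with
  | nil => simp [sumChain]
  | cons a l ih =>
    have h : Finsupp.single a⁻¹ (1 : ℝ) + Finsupp.single a 1 ∈ homogeneousRelations G := by
      refine Submodule.subset_span (.inl ⟨a, -1, ?_⟩)
      simp
    have h2 := add_mem h ih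
    convert h2 using 1
    simp only [sumChain, List.map_cons, List.sum_cons]
    abel

/-- Modulo `H`, the boundary `g - g h + h` is the sum of the three elements `g`, `h` and `(g h)⁻¹`,
whose product is trivial. -/
theorem span_sumChain :
    Submodule.span ℝ {x : B1H G | ∃ l hl, toB1H (sumChain l) hl = x} = ⊤ := by
  refine top_unique fun x _ => ?_
  obtain ⟨c, ⟨f, rfl⟩, rfl⟩ := toB1H_surjective x
  induction f using Finsupp.induction_linear with
  | zero =>
    have : toB1H (boundaryMap G 0) (boundaryMap_mem 0) = 0 := by
      refine Subtype.ext ?_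
      simp [toB1H]
    rw [this]
    exact zero_mem _
  | add f g hf hg =>
    have : toB1H (boundaryMap G (f + g)) (boundaryMap_mem _) =
        toB1H (boundaryMap G f) (boundaryMap_mem f) + toB1H (boundaryMap G g) (boundaryMap_mem g) := by
      refine Subtype.ext ?_
      simp [toB1H]
    rw [this]
    exact add_mem (hf trivial) (hg trivial)
  | single p a =>
    have hl : sumChain [p.1, p.2, (p.1 * p.2)⁻¹] ∈ B1 G := sumChain_mem_B1 (by simp [one_mem])
    have : toB1H (boundaryMap G (Finsupp.single p a)) (boundaryMap_mem _) = a • toB1H _ hl := by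
      rw [← toB1H_smul, toB1H_eq_iff]
      have h := Submodule.smul_mem _ (-a) (sumChain_inv_mem [p.1 * p.2])
      convert h using 1
      rw [boundaryMap_single]
      simp only [sumChain, List.map_cons, List.map_nil, List.sum_cons, List.sum_nil, smul_add,
        Finsupp.smul_single, add_zero, smul_eq_mul, mul_one, neg_smul, mul_inv_rev]
      abel
    rw [this]
    exact Submodule.smul_mem _ _ (Submodule.subset_span ⟨_, hl, rfl⟩)

end Boundaries

/-! ### scl as a pseudo-norm -/

section Seminorm

variable {G : Type u} [Group G]

theorem scl_nonneg (x : B1H G) : 0 ≤ scl x := by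
  refine Real.sInf_nonneg ?_
  rintro _ ⟨k, r, l, hl, -, rfl⟩
  positivity

theorem scl_le {J : Type*} [Fintype J] (r : J → ℝ) (l : J → List G)
    (hl : ∀ j, sumChain (l j) ∈ B1 G) :
    scl (∑ j, r j • toB1H (sumChain (l j)) (hl j)) ≤ ∑ j, |r j| * (sclSum (l j)).toReal := by
  refine csInf_le ⟨0, ?_⟩ ⟨Fintype.card J, r ∘ (Fintype.equivFin J).symm,
    l ∘ (Fintype.equivFin J).symm, fun j => hl _, ?_, ?_⟩
  · rintro _ ⟨k, r, l, hl, -, rfl⟩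
    positivity
  · exact (Fintype.equivFin J).symm.sum_comp fun j => r j • toB1H (sumChain (l j)) (hl j)
  · exact ((Fintype.equivFin J).symm.sum_comp fun j => |r j| * (sclSum (l j)).toReal).symm

/-- By `span_sumChain` the set of costs is nonempty, so its infimum is a true one and not the
default value of `sInf`. -/
theorem exists_combination_lt {x : B1H G} {s : ℝ} (h : scl x < s) :
    ∃ (k : ℕ) (r : Fin k → ℝ) (l : Fin k → List G) (hl : ∀ j, sumChain (l j) ∈ B1 G),
      ∑ j, r j • toB1H (sumChain (l j)) (hl j) = x ∧
      ∑ j, |r j| * (sclSum (l j)).toReal < s := by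
  have hne : {s : ℝ | ∃ (k : ℕ) (r : Fin k → ℝ) (l : Fin k → List G)
    (hl : ∀ j, sumChain (l j) ∈ B1 G),
    ∑ j, r j • toB1H (sumChain (l j)) (hl j) = x ∧
    s = ∑ j, |r j| * (sclSum (l j)).toReal}.Nonempty := by
    have hx : x ∈ Submodule.span ℝ {x : B1H G | ∃ l hl, toB1H (sumChain l) hl = x} := by
      rw [span_sumChain]
      trivial
    obtain ⟨k, r, g, rfl⟩ := (Submodule.mem_span_set' (R := ℝ)).1 hx
    choose l hl hlg using fun j => (g j).2
    exact ⟨_, k, r, l, hl, by simp only [hlg], rfl⟩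
  obtain ⟨_, ⟨k, r, l, hl, hx, rfl⟩, hs⟩ := exists_lt_of_csInf_lt hne h
  exact ⟨k, r, l, hl, hx, hs⟩

variable (G) in
/-- Stable commutator length as a pseudo-norm. -/
noncomputable def sclSeminorm : Seminorm ℝ (B1H G) := by
  refine Seminorm.ofSMulLE scl ?_ ?_ ?_
  · refine le_antisymm ?_ (scl_nonneg 0)
    have := scl_le (G := G) (J := Fin 0) (fun _ => 0) (fun _ => []) (fun j => j.elim0)
    simpa using this
  · intro x y
    refine le_of_forall_pos_le_add fun ε hε => ?_
    obtain ⟨k, r, l, hl, hx, hs⟩ := exists_combination_lt (lt_add_of_pos_right (scl x) (half_pos hε))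
    obtain ⟨k', r', l', hl', hy, hs'⟩ :=
      exists_combination_lt (lt_add_of_pos_right (scl y) (half_pos hε))
    have := scl_le (Sum.elim r r') (Sum.elim l l') (by rintro (j | j) <;> simp [hl, hl'])
    simp only [Fintype.sum_sum_type, Sum.elim_inl, Sum.elim_inr, hx, hy] at this
    linarith
  · intro a x
    refine le_of_forall_pos_le_add fun ε hε => ?_
    -- The summand 1 covers the case `a = 0`.
    have hpos : 0 < ε / (|a| + 1) := by positivity
    obtain ⟨k, r, l, hl, hx, hs⟩ := exists_combination_lt (lt_add_of_pos_right (scl x) hpos)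
    have := scl_le (fun j => a * r j) l hl
    simp only [mul_smul, ← Finset.smul_sum, hx, abs_mul, mul_assoc, ← Finset.mul_sum] at this
    have h2 : |a| * (ε / (|a| + 1)) ≤ ε := by
      rw [← mul_div_assoc, div_le_iff₀ (by positivity)]
      nlinarith [abs_nonneg a]
    rw [Real.norm_eq_abs]
    nlinarith [abs_nonneg a]

theorem sclSeminorm_apply (x : B1H G) : sclSeminorm G x = scl x := rfl

theorem scl_smul (a : ℝ) (x : B1H G) : scl (a • x) = |a| * scl x :=
  map_smul_eq_mul (sclSeminorm G) a x

end Seminorm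

/-! ### Inverse elements, and the vanishing of scl on relations -/

section Inverses

variable {G : Type u} [Group G]

theorem CommProd.inv {k : ℕ} {g : G} (h : CommProd k g) : CommProd k g⁻¹ := by
  obtain ⟨l, h1, h2⟩ := h
  refine ⟨(l.map Prod.swap).reverse, by simpa using h1, ?_⟩
  rw [← h2, List.prod_inv_reverse, List.map_reverse, List.map_map, List.map_map]
  congr 3
  funext p
  simp

theorem ConjProd.inv {l : List G} {g : G} (h : ConjProd l g) :
    ConjProd (l.map (·⁻¹)).reverse g⁻¹ := by
  obtain ⟨l', h1, rfl⟩ := h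
  refine ⟨(l'.map (·⁻¹)).reverse, ?_, (List.prod_inv_reverse _).symm⟩
  rw [List.forall₂_reverse_iff, List.forall₂_map_left_iff, List.forall₂_map_right_iff]
  refine h1.imp fun a b hab => ?_
  obtain ⟨c, hc⟩ := isConj_iff.1 hab
  exact isConj_iff.2 ⟨c, by simp [← hc, mul_assoc]⟩

theorem Bounds.map_inv {k : ℕ} {m : Multiset G} (h : Bounds k m) : Bounds k (m.map (·⁻¹)) := by
  obtain ⟨l, rfl, g, h1, h2⟩ := h
  exact ⟨(l.map (·⁻¹)).reverse, by simp, g⁻¹, h1.inv, h2.inv⟩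

theorem SclLE.map_inv {m : Multiset G} {r : ℝ} (h : SclLE m r) : SclLE (m.map (·⁻¹)) r :=
  h.imp 0 fun n k hk => by
    have := hk.map_inv
    rw [Multiset.map_map] at this ⊢
    simpa [Function.comp_def] using this

theorem HasScl.le {m : Multiset G} {r r' : ℝ} (h : HasScl m r) (h' : SclLE m r') : r ≤ r' := by
  obtain ⟨c, hc⟩ := h.lower
  obtain ⟨d, hd⟩ := h'
  by_contra! hlt
  obtain ⟨n, hn⟩ := exists_nat_gt ((d + c) / (r - r'))
  rw [div_lt_iff₀ (by linarith)] at hn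
  obtain ⟨k, hk, hb⟩ := hd n
  have := hc n k hb
  linarith

theorem HasScl.unique {m : Multiset G} {r r' : ℝ} (h : HasScl m r) (h' : HasScl m r') : r = r' :=
  le_antisymm (h.le h'.upper) (h'.le h.upper)

theorem HasScl.of_map_inv {m : Multiset G} {r r' : ℝ} (h : HasScl m r)
    (h' : HasScl (m.map (·⁻¹)) r') : r' = r := by
  refine le_antisymm (h'.le h.upper.map_inv) (h.le ?_)
  simpa using h'.upper.map_inv

/-- Both signs of every homogeneity relation have vanishing `scl`. -/
theorem exists_lists_of_relation {c : G →₀ ℝ}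
    (hc : c ∈ ({c | ∃ (g : G) (n : ℤ), c = Finsupp.single (g ^ n) 1 - (n : ℝ) • Finsupp.single g 1} ∪
     {c | ∃ g h : G, c = Finsupp.single g 1 - Finsupp.single (h * g * h⁻¹) 1} : Set (G →₀ ℝ))) :
    ∃ p p' : List G, c = sumChain p - sumChain p' ∧
      SclLE ((p : Multiset G) + ((p'.map (·⁻¹) : List G) : Multiset G)) 0 := by
  have hrep : ∀ (n : ℕ) (a : G), sumChain (List.replicate n a) = (n : ℝ) • Finsupp.single a 1 := by
    intro n a
    simp [sumChain]
  have hms : ∀ (n : ℕ) (a : G), ((List.replicate n a : List G) : Multiset G) = n • {a} := by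
    intro n a
    rw [Multiset.nsmul_singleton, Multiset.coe_replicate]
  rcases hc with ⟨g, n, rfl⟩ | ⟨g, h, rfl⟩
  · obtain ⟨n, rfl | rfl⟩ := n.eq_nat_or_neg
    · refine ⟨[g ^ n], List.replicate n g, ?_, ?_⟩
      · rw [hrep]
        simp [sumChain]
      · have h := (SclLE.zero (G := G)).cons_inv (g ^ n)
        rw [← inv_pow, Multiset.cons_swap] at h
        have h2 := h.of_pow
        rw [List.map_replicate, hms]
        simpa [add_comm] using h2
    -- For an exponent `-n` with `n` natural, all coefficients of the relation are nonnegative, so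
    -- nothing has to be subtracted.
    · refine ⟨(g ^ n)⁻¹ :: List.replicate n g, [], ?_, ?_⟩
      · have : sumChain ((g ^ n)⁻¹ :: List.replicate n g) =
            Finsupp.single (g ^ n)⁻¹ 1 + sumChain (List.replicate n g) := by simp [sumChain]
        rw [this, hrep]
        simp [sumChain]
      · have h := ((SclLE.zero (G := G)).cons_inv (g ^ n)).of_pow
        rw [← Multiset.cons_coe, hms, ← Multiset.singleton_add]
        simpa [add_comm] using h
  · refine ⟨[g], [h * g * h⁻¹], by simp [sumChain], ?_⟩
    have h1 := (SclLE.zero (G := G)).cons_inv g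
    rw [Multiset.cons_swap] at h1
    have h2 := h1.conj (b := (h * g * h⁻¹)⁻¹) (isConj_iff.2 ⟨h, by simp [mul_assoc]⟩)
    rw [Multiset.cons_swap] at h2
    exact h2

end Inverses

/-! ### Real boundaries in a free group -/

section FreeGroups

variable {ι : Type v} {F : Type u} [Group F] (b : FreeGroupBasis ι F)

/-- The exponent sums of an element of a free group. -/
noncomputable def exponents : F →* Multiplicative (ι →₀ ℤ) :=
  b.lift fun i => Multiplicative.ofAdd (Finsupp.single i 1)

/-- The abelianization map factors through the exponent sums, as can be checked on the basis. -/
theorem mem_commutator_of_exponents {g : F} (h : exponents b g = 1) : g ∈ commutator F := by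
  let s : (ι →₀ ℤ) →+ Additive (Abelianization F) :=
    Finsupp.liftAddHom fun i => zmultiplesHom _ (Additive.ofMul (Abelianization.of (b i)))
  have hs : (AddMonoidHom.toMultiplicativeLeft s).comp (exponents b) = Abelianization.of := by
    refine b.ext_hom _ _ fun i => ?_
    simp [exponents, s, FreeGroupBasis.lift]
  rw [← Abelianization.ker_of, MonoidHom.mem_ker, ← hs]
  simp [h]

/-- Exponent sums extend linearly to real chains and vanish on boundaries. Since integral exponent
sums already detect the commutator subgroup, passing to real coefficients loses no information. -/
theorem prod_mem_commutator (b : FreeGroupBasis ι F) {l : List F} (hl : sumChain l ∈ B1 F) : l.prod ∈ commutator F := by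
  refine mem_commutator_of_exponents b ?_
  suffices ∀ i, (exponents b l.prod).toAdd i = 0 from
    Multiplicative.toAdd.injective (Finsupp.ext this)
  intro i
  let e : (F →₀ ℝ) →ₗ[ℝ] ℝ :=
    Finsupp.linearCombination ℝ fun g => (((exponents b g).toAdd i : ℤ) : ℝ)
  have he : ∀ c ∈ B1 F, e c = 0 := by
    rintro _ ⟨f, rfl⟩
    induction f using Finsupp.induction_linear with
    | zero => simp
    | add f g hf hg => rw [map_add, map_add, hf, hg, add_zero]
    | single p a =>
      rw [boundaryMap_single]
      simp only [e, map_add, map_sub, Finsupp.linearCombination_single, map_mul, toAdd_mul,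
        Finsupp.add_apply, smul_eq_mul, Int.cast_add]
      ring
  have hsum : ∀ l : List F, e (sumChain l) = (exponents b l.prod).toAdd i := by
    intro l
    induction l with
    | nil => simp [sumChain]
    | cons a l ih =>
      have : sumChain (a :: l) = Finsupp.single a 1 + sumChain l := by simp [sumChain]
      rw [this, map_add, ih, List.prod_cons, map_mul, toAdd_mul, Finsupp.add_apply]
      simp [e]
  have := hsum l
  rw [he _ hl] at this
  exact_mod_cast this.symm

theorem exists_bounds (b : FreeGroupBasis ι F) {l : List F} (hl : sumChain l ∈ B1 F) : ∃ k, Bounds k (l : Multiset F) := by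
  obtain ⟨k, hk⟩ := exists_commProd (prod_mem_commutator b hl)
  exact ⟨k, l, rfl, l.prod, ⟨l, List.forall₂_same.2 fun _ _ => IsConj.refl _, rfl⟩, hk⟩

end FreeGroups

/-! ### Dual functionals and the value of the pseudo-norm on sums -/

section Functionals

variable {ι : Type v} {F : Type u} [Group F]

theorem sumChain_apply {G : Type u} [DecidableEq G] (l : List G) (g : G) :
    sumChain l g = l.count g := by
  induction l with
  | nil => simp [sumChain]
  | cons a l ih =>
    have : sumChain (a :: l) = Finsupp.single a 1 + sumChain l := by simp [sumChain]
    rw [this, Finsupp.add_apply, ih, List.count_cons, Finsupp.single_apply]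
    by_cases h : a = g <;> simp [h, add_comm]

/-- Finitely many rational functionals compute `scl` of all integral chains with support in a finite
set. -/
theorem exists_functionals (b : FreeGroupBasis ι F) (S : Finset F) : ∃ Y : Finset ((F →₀ ℝ) →ₗ[ℝ] ℝ),
    (∀ y ∈ Y, ∀ c : F →₀ ℝ, (∀ g, ∃ q : ℚ, c g = q) → ∃ q : ℚ, y c = q) ∧
    ∀ l l' : List F, (∀ x ∈ l, x ∈ S) → (∀ x ∈ l', x ∈ S) → sumChain l - sumChain l' ∈ B1 F →
      ∃ y ∈ Y, (∀ y' ∈ Y, y' (sumChain l - sumChain l') ≤ y (sumChain l - sumChain l')) ∧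
        HasScl ((l : Multiset F) + ((l'.map (·⁻¹) : List F) : Multiset F))
          (y (sumChain l - sumChain l')) := by
  classical
  let γ : Fin S.card → F := fun i => (S.equivFin.symm i : F)
  choose w hw using fun i => evalWord_surjective b (γ i)
  obtain ⟨Y, hY⟩ := exists_hasScl_family b w
  simp only [hw] at hY
  let Φ : (Fin S.card → ℚ) → (F →₀ ℝ) →ₗ[ℝ] ℝ := fun y => ∑ i, (y i : ℝ) • Finsupp.lapply (γ i)
  have hΦ : ∀ y c, Φ y c = ∑ i, (y i : ℝ) * c (γ i) := fun y c => by simp [Φ]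
  refine ⟨Y.image Φ, ?_, ?_⟩
  · simp only [Finset.mem_image]
    rintro _ ⟨y, -, rfl⟩ c hc
    choose q hq using hc
    refine ⟨∑ i, y i * q (γ i), ?_⟩
    simp [hΦ, hq]
  intro l l' hl hl' hc
  lift l to List S using hl
  lift l' to List S using hl'
  set c := sumChain (l.map Subtype.val) - sumChain (l'.map Subtype.val) with hcdef
  let e := S.equivFin
  -- The elements of `l` enter with positive sign and those of `l'` with negative sign, so that the
  -- net coefficients are those of `c`.
  let m : Multiset (Fin S.card × Bool) := ((l.map fun s => (e s, true) : List _) : Multiset _) +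
    ((l'.map fun s => (e s, false) : List _) : Multiset _)
  have hm : m.map (signed γ) = ((l.map Subtype.val : List F) : Multiset F) +
      (((l'.map Subtype.val).map (·⁻¹) : List F) : Multiset F) := by
    simp only [m, Multiset.map_add, Multiset.map_coe, List.map_map]
    congr 3 <;> funext s <;> simp [signed, γ, e]
  have hnet : ∀ i, ((net m i : ℚ) : ℝ) = c (γ i) := by
    intro i
    have hinj : ∀ ε : Bool, Function.Injective fun s : S => (e s, ε) := fun ε s t h =>
      e.injective (Prod.ext_iff.1 h).1
    have h1 : ∀ (ε : Bool) (l : List S), Multiset.count (i, ε)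
        ((l.map fun s => (e s, ε) : List _) : Multiset (Fin S.card × Bool)) =
          Multiset.count (e.symm i) (l : Multiset S) := by
      intro ε l
      rw [← Multiset.count_map_eq_count' _ _ (hinj ε), Multiset.map_coe]
      simp
    have h2 : ∀ (ε δ : Bool) (l : List S), δ ≠ ε → Multiset.count (i, ε)
        ((l.map fun s => (e s, δ) : List _) : Multiset (Fin S.card × Bool)) = 0 := by
      intro ε δ l h
      rw [Multiset.count_eq_zero]
      simp [h]
    have h3 : ∀ l : List S, (l.map Subtype.val).count (γ i) =
        Multiset.count (e.symm i) (l : Multiset S) := fun l => by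
      rw [← Multiset.count_map_eq_count' _ _ Subtype.val_injective, Multiset.map_coe,
        Multiset.coe_count]
    simp only [net, m, Multiset.count_add, h1, h2 true false _ (by simp), h2 false true _ (by simp),
      hcdef, Finsupp.sub_apply, sumChain_apply, h3]
    push_cast
    ring
  have hB : ∃ K, Bounds K (m.map (signed γ)) := by
    rw [hm, Multiset.coe_add]
    refine exists_bounds b ?_
    rw [sumChain_append]
    have := add_mem hc (homogeneousRelations_le (sumChain_inv_mem (l'.map Subtype.val)))
    convert this using 1
    rw [hcdef]
    abel
  obtain ⟨y, hy, h1, h2, -⟩ := hY m hB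
  have heval : ∀ y : Fin S.card → ℚ, Φ y c = ((∑ i, y i * net m i : ℚ) : ℝ) := by
    intro y
    push_cast
    simp only [hnet, hΦ]
  refine ⟨_, Finset.mem_image_of_mem _ hy, ?_, ?_⟩
  · simp only [Finset.mem_image]
    rintro _ ⟨y', hy', rfl⟩
    rw [heval, heval]
    exact_mod_cast h1 y' hy'
  · rw [heval, ← hm]
    exact h2

theorem exists_hasScl (b : FreeGroupBasis ι F) {l : List F} (hl : sumChain l ∈ B1 F) :
    ∃ q : ℚ, HasScl (l : Multiset F) q := by
  classical
  obtain ⟨Y, h1, h2⟩ := exists_functionals b l.toFinset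
  obtain ⟨y, hy, -, h⟩ := h2 l [] (by simp) (by simp) (by simpa [sumChain] using hl)
  obtain ⟨q, hq⟩ := h1 y hy (sumChain l - sumChain []) fun g => by
    refine ⟨l.count g, ?_⟩
    rw [Finsupp.sub_apply, sumChain_apply, sumChain_apply]
    simp
  rw [hq] at h
  exact ⟨q, by simpa using h⟩

/-- The pseudo-norm `scl` has its defining values on sums of group elements. -/
theorem scl_sumChain (b : FreeGroupBasis ι F) {l : List F} (hl : sumChain l ∈ B1 F) {r : ℝ}
    (h : HasScl (l : Multiset F) r) : scl (toB1H (sumChain l) hl) = r := by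
  classical
  refine le_antisymm ?_ (le_of_forall_gt fun s hs => ?_)
  · have := scl_le (G := F) (J := Fin 1) (fun _ => 1) (fun _ => l) (fun _ => hl)
    simpa [h.sclSum_eq] using this
  -- The remaining inequality is linear programming duality. The functional `y` that attains the
  -- value at `l` is at most scl on all sums over the finite set `S`, and it vanishes on the
  -- finitely many relations in use; so `y (sumChain l)` cannot exceed the cost of any competing
  -- combination.
  obtain ⟨k, a, L, hL, hx, hlt⟩ := exists_combination_lt hs
  refine lt_of_le_of_lt ?_ hlt
  have hrel : ∑ j, a j • sumChain (L j) - sumChain l ∈ homogeneousRelations F := by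
    have h1 := congrArg Subtype.val hx
    rw [AddSubmonoidClass.coe_finsetSum] at h1
    rw [← Submodule.Quotient.eq, ← Submodule.mkQ_apply, ← Submodule.mkQ_apply, map_sum]
    simp only [map_smul]
    exact h1
  obtain ⟨n, f, g, hfg⟩ := (Submodule.mem_span_set' (R := ℝ)).1 hrel
  choose p p' hp hpp using fun i => exists_lists_of_relation (g i).2
  let S : Finset F := l.toFinset ∪ (Finset.univ.biUnion fun j => (L j).toFinset) ∪
    (Finset.univ.biUnion fun i => (p i).toFinset ∪ (p' i).toFinset)
  have hS1 : ∀ x ∈ l, x ∈ S := fun x hx => by simp [S, hx]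
  have hS2 : ∀ j, ∀ x ∈ L j, x ∈ S := fun j x hx => by
    simp only [S, Finset.mem_union, Finset.mem_biUnion]
    exact .inl (.inr ⟨j, by simp, by simpa using hx⟩)
  have hS3 : ∀ i, ∀ x ∈ p i, x ∈ S := fun i x hx => by
    simp only [S, Finset.mem_union, Finset.mem_biUnion]
    exact .inr ⟨i, by simp, by simp [hx]⟩
  have hS4 : ∀ i, ∀ x ∈ p' i, x ∈ S := fun i x hx => by
    simp only [S, Finset.mem_union, Finset.mem_biUnion]
    exact .inr ⟨i, by simp, by simp [hx]⟩
  obtain ⟨Y, -, hY⟩ := exists_functionals b S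
  have hnil : sumChain ([] : List F) = 0 := rfl
  obtain ⟨y, hy, -, hyl⟩ := hY l [] hS1 (by simp) (by simpa [hnil] using hl)
  have hyl' : HasScl (l : Multiset F) (y (sumChain l)) := by simpa [hnil] using hyl
  -- The functional is compared with scl of `L j` and of its negative, the sum of the inverses,
  -- which has the same scl.
  have hyL : ∀ j, |y (sumChain (L j))| ≤ (sclSum (L j)).toReal := by
    intro j
    obtain ⟨q, hq⟩ := exists_hasScl b (hL j)
    rw [hq.sclSum_eq, abs_le']
    constructor
    · obtain ⟨z, -, hz1, hz2⟩ := hY (L j) [] (hS2 j) (by simp) (by simpa [hnil] using hL j)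
      have hz3 := hz1 y hy
      rw [hnil, sub_zero] at hz3 hz2
      have hz4 : (q : ℝ) = z (sumChain (L j)) := hq.unique (by simpa using hz2)
      rwa [← hz4] at hz3
    · obtain ⟨z, -, hz1, hz2⟩ := hY [] (L j) (by simp) (hS2 j) (by simpa [hnil] using hL j)
      have hz3 := hz1 y hy
      rw [hnil, zero_sub] at hz3 hz2
      rw [map_neg] at hz3
      have hz4 : z (- sumChain (L j)) = q := hq.of_map_inv (by simpa using hz2)
      rwa [hz4] at hz3
  -- A relation and its negative both have scl 0 (`exists_lists_of_relation`), and `y` is at most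
  -- scl on each of them.
  have hyg : ∀ i, y (g i) = 0 := by
    intro i
    have hB : sumChain (p i) - sumChain (p' i) ∈ B1 F := by
      rw [← hp]
      exact homogeneousRelations_le (Submodule.subset_span (g i).2)
    refine le_antisymm ?_ ?_
    · obtain ⟨z, -, hz1, hz2⟩ := hY (p i) (p' i) (hS3 i) (hS4 i) hB
      rw [hp]
      exact (hz1 y hy).trans (hz2.le (hpp i))
    · obtain ⟨z, -, hz1, hz2⟩ := hY (p' i) (p i) (hS4 i) (hS3 i) (by simpa using neg_mem hB)
      have h1 := (hz1 y hy).trans (hz2.le (r' := 0) (by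
        have := (hpp i).map_inv
        rw [add_comm]
        simpa [Function.comp_def] using this))
      rw [hp, ← neg_sub, map_neg]
      linarith
  have h1 : y (sumChain l) = ∑ j, a j * y (sumChain (L j)) := by
    have := congrArg y hfg
    simp only [map_sum, map_smul, hyg, map_sub, smul_eq_mul, mul_zero,
      Finset.sum_const_zero] at this
    linarith
  rw [h.unique hyl', h1]
  refine Finset.sum_le_sum fun j _ => ?_
  calc a j * y (sumChain (L j)) ≤ |a j * y (sumChain (L j))| := le_abs_self _
    _ = |a j| * |y (sumChain (L j))| := abs_mul _ _
    _ ≤ _ := mul_le_mul_of_nonneg_left (hyL j) (abs_nonneg _)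

theorem tendsto_scl_sumChain (b : FreeGroupBasis ι F) {l : List F} (hl : sumChain l ∈ B1 F) :
    Tendsto (fun n : ℕ => (clSum (l.map (· ^ n)) : ℝ≥0∞) / (n : ℝ≥0∞)) atTop
      (𝓝 (ENNReal.ofReal (scl (toB1H (sumChain l) hl)))) := by
  obtain ⟨q, hq⟩ := exists_hasScl b hl
  rw [scl_sumChain b hl hq]
  exact hq.tendsto

theorem clSum_singleton {G : Type u} [Group G] (g : G) : clSum [g] = cl g := by
  refine le_antisymm (iInf₂_le_of_le [g] (by simpa using IsConj.refl g) (by simp)) (le_iInf₂ fun l hl => ?_)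
  obtain ⟨h, rfl⟩ : ∃ h, l = [h] := by
    cases hl with
    | cons h1 h2 => cases h2; exact ⟨_, rfl⟩
  have hgh : IsConj h g := by simpa using (List.forall₂_cons.1 hl).1.symm
  obtain ⟨c, hc⟩ := isConj_iff.1 hgh
  rcases eq_or_ne (cl [h].prod) ⊤ with ht | ht
  · rw [ht]; exact le_top
  · obtain ⟨k, hk⟩ := ENat.ne_top_iff_exists.1 ht
    rw [← hk, cl_le_iff, ← hc]
    refine CommProd.conj ?_ c
    rw [← cl_le_iff, hk]
    simp

theorem single_eq_sumChain {G : Type u} (g : G) : Finsupp.single g (1 : ℝ) = sumChain [g] := by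
  simp [sumChain]

theorem single_mem_B1 {G : Type u} [Group G] {g : G} (hg : g ∈ commutator G) :
    Finsupp.single g (1 : ℝ) ∈ B1 G := by
  rw [single_eq_sumChain]
  exact sumChain_mem_B1 (by simpa using hg)

theorem exists_rat_tendsto_cl (b : FreeGroupBasis ι F) {g : F} (hg : g ∈ commutator F) :
    ∃ (hg : Finsupp.single g (1 : ℝ) ∈ B1 F) (q : ℚ), scl (toB1H (Finsupp.single g 1) hg) = q ∧
      Tendsto (fun n : ℕ => (cl (g ^ n) : ℝ≥0∞) / (n : ℝ≥0∞)) atTop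
        (𝓝 (ENNReal.ofReal (q : ℝ))) := by
  have h1 := single_mem_B1 hg
  have h2 := h1
  rw [single_eq_sumChain] at h2
  obtain ⟨q, hq⟩ := exists_hasScl b h2
  refine ⟨h1, q, ?_, ?_⟩
  · rw [← scl_sumChain b h2 hq]
    simp only [single_eq_sumChain]
  · simpa [clSum_singleton] using hq.tendsto

end Functionals

/-! ### Rational chains as fractions of sums -/

section RationalChains

variable {ι : Type v} {F : Type u} [Group F]
  {κ : Type} [Fintype κ] [DecidableEq κ]

/-- A negative sign stands for an inverse element, and `g⁻¹ + g` lies in `H`. -/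
theorem sum_net_sub_mem (γ : κ → F) (l : List (κ × Bool)) :
    ∑ i, Finsupp.single (γ i) ((net (l : Multiset (κ × Bool)) i : ℚ) : ℝ) -
      sumChain (l.map (signed γ)) ∈ homogeneousRelations F := by
  induction l with
  | nil => simp [net, sumChain]
  | cons a l ih =>
    have hnet : ∀ i, net ((a :: l : List _) : Multiset (κ × Bool)) i =
        net (l : Multiset (κ × Bool)) i + if i = a.1 then (if a.2 then 1 else -1) else 0 := by
      intro i
      rw [← Multiset.cons_coe]
      simp only [net, Multiset.count_cons]
      rcases a with ⟨j, _ | _⟩ <;> by_cases hij : i = j <;> simp [hij] <;> ring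
    have hs : ∀ i, Finsupp.single (γ i) ((net ((a :: l : List _) : Multiset (κ × Bool)) i : ℚ) : ℝ) =
        Finsupp.single (γ i) ((net (l : Multiset (κ × Bool)) i : ℚ) : ℝ) +
          if i = a.1 then Finsupp.single (γ a.1) (if a.2 then 1 else -1 : ℝ) else 0 := by
      intro i
      rw [hnet]
      by_cases hi : i = a.1
      · subst hi
        rcases a with ⟨j, _ | _⟩ <;> simp
      · simp [hi]
    have hc : sumChain ((a :: l).map (signed γ)) =
        Finsupp.single (signed γ a) 1 + sumChain (l.map (signed γ)) := by simp [sumChain]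
    simp only [hs, Finset.sum_add_distrib, Finset.sum_ite_eq', Finset.mem_univ, if_true, hc]
    have h2 : Finsupp.single (γ a.1) (if a.2 then 1 else -1 : ℝ) - Finsupp.single (signed γ a) 1 ∈
        homogeneousRelations F := by
      rcases a with ⟨j, _ | _⟩
      · have := neg_mem (sumChain_inv_mem [γ j])
        convert this using 1
        simp [sumChain, signed]
        abel
      · simp [signed]
    convert add_mem ih h2 using 1
    abel

/-- Rational chains are, up to scaling, sums of group elements. -/
theorem exists_multiset_of_chain (b : FreeGroupBasis ι F) (γ : κ → F) (q : κ → ℚ)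
    (h : ∑ i, Finsupp.single (γ i) (q i : ℝ) ∈ B1 F) :
    ∃ (N : ℕ) (m : Multiset (κ × Bool)), 0 < N ∧ (∀ i, net m i = N * q i) ∧
      (∃ K, Bounds K (m.map (signed γ))) ∧
      ∀ r, HasScl (m.map (signed γ)) r → N * scl (toB1H _ h) = r := by
  -- Multiplied by a common denominator, the positive parts of the coefficients become
  -- multiplicities of the elements and the negative parts those of their inverses.
  obtain ⟨N, hN, n, hn⟩ := exists_common_denominator
    (fun i : κ × Bool => max (if i.2 then q i.1 else - q i.1) 0) fun _ => le_max_right _ _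
  let m : Multiset (κ × Bool) := ∑ i, n i • {i}
  have hcount : ∀ i, m.count i = n i := by
    intro i
    rw [Multiset.count_sum', Finset.sum_eq_single i]
    · simp
    · intro j _ hj
      simp [hj.symm]
    · simp
  have hnet : ∀ i, net m i = N * q i := by
    intro i
    rw [net, hcount, hcount, hn, hn, ← mul_sub]
    simp only [if_true, Bool.false_eq_true, if_false]
    rcases le_total 0 (q i) with h | h
    · rw [max_eq_left h, max_eq_right (by linarith), sub_zero]
    · rw [max_eq_right h, max_eq_left (by linarith)]
      ring
  have hrel := sum_net_sub_mem γ m.toList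
  simp only [Multiset.coe_toList, hnet] at hrel
  have hsm : ∑ i, Finsupp.single (γ i) (((N * q i : ℚ)) : ℝ) =
      (N : ℝ) • ∑ i, Finsupp.single (γ i) (q i : ℝ) := by
    simp [Finset.smul_sum]
  rw [hsm] at hrel
  have hml : ((m.toList.map (signed γ) : List F) : Multiset F) = m.map (signed γ) := by
    rw [← Multiset.map_coe, Multiset.coe_toList]
  have hl : sumChain (m.toList.map (signed γ)) ∈ B1 F := by
    have := sub_mem (Submodule.smul_mem _ (N : ℝ) h) (homogeneousRelations_le hrel)
    rwa [sub_sub_cancel] at this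
  refine ⟨N, m, hN, hnet, ?_, fun r hr => ?_⟩
  · obtain ⟨K, hK⟩ := exists_bounds b hl
    exact ⟨K, by rwa [hml] at hK⟩
  · rw [← hml] at hr
    rw [← scl_sumChain b hl hr, ← (toB1H_eq_iff (hc := Submodule.smul_mem _ (N : ℝ) h)).2 hrel,
      toB1H_smul h, scl_smul]
    simp

end RationalChains

section Sums

theorem toB1H_sum {G : Type u} [Group G] {J : Type*} [Fintype J] {c : J → G →₀ ℝ}
    (hc : ∀ j, c j ∈ B1 G) (s : J → ℝ) :
    toB1H (∑ j, s j • c j) (Submodule.sum_mem _ fun j _ => Submodule.smul_mem _ _ (hc j)) =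
      ∑ j, s j • toB1H (c j) (hc j) := by
  refine Subtype.ext ?_
  rw [AddSubmonoidClass.coe_finsetSum]
  simp only [toB1H, map_sum, map_smul]
  rfl

end Sums

/-! ### From rational to real parameters -/

section RealParameters

/-- A seminorm on `ℝᵏ` that is a maximum of rational functionals at rational points is so
everywhere. -/
theorem isGreatest_of_rat {k : ℕ} (p : Seminorm ℝ (Fin k → ℝ)) (Y : List (List Frac))
    (h : ∀ a : Fin k → ℚ, ∃ y ∈ Y, (∀ y' ∈ Y, evalVec k y' a ≤ evalVec k y a) ∧
      p (fun j => (a j : ℝ)) = evalVec k y a) (t : Fin k → ℝ) :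
    IsGreatest {s : ℝ | ∃ y ∈ Y, s = ∑ j : Fin k, ((y.getD j (0, 0)).val : ℝ) * t j} (p t) := by
  classical
  let φ : List Frac → (Fin k → ℝ) → ℝ := fun y t => ∑ j : Fin k, ((y.getD j (0, 0)).val : ℝ) * t j
  have hφ : ∀ y (a : Fin k → ℚ), φ y (fun j => (a j : ℝ)) = evalVec k y a := by
    intro y a
    simp [φ, evalVec]
  have hY : Y.toFinset.Nonempty := by
    obtain ⟨y, hy, -⟩ := h 0
    exact ⟨y, by simpa using hy⟩
  -- A seminorm on a finite-dimensional space is convex and therefore continuous. So is a maximum of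
  -- finitely many linear functionals, and the two agree on the dense set of rational points.
  have hp : Continuous p := by
    have := p.convexOn.locallyLipschitz
    exact this.continuous
  have hg : Continuous fun t => Y.toFinset.sup' hY fun y => φ y t :=
    Continuous.finset_sup'_apply hY fun y _ => by
      simp only [φ]
      fun_prop
  have hd : DenseRange (Pi.map fun (_ : Fin k) (q : ℚ) => (q : ℝ)) :=
    DenseRange.piMap fun _ => Rat.denseRange_cast
  have heq : ⇑p = fun t => Y.toFinset.sup' hY fun y => φ y t := by
    refine hd.equalizer hp hg (funext fun a => ?_)
    obtain ⟨y, hy, h1, h2⟩ := h a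
    have h3 : p (Pi.map (fun (_ : Fin k) (q : ℚ) => (q : ℝ)) a) = evalVec k y a := h2
    simp only [Function.comp_apply, h3]
    refine le_antisymm ?_ (Finset.sup'_le _ _ fun y' hy' => ?_)
    · exact (hφ y a).symm.le.trans
        (Finset.le_sup' (fun y => φ y (Pi.map (fun (_ : Fin k) (q : ℚ) => (q : ℝ)) a))
          (List.mem_toFinset.2 hy))
    · refine (hφ y' a).le.trans ?_
      exact_mod_cast h1 y' (List.mem_toFinset.1 hy')
  rw [heq]
  constructor
  · obtain ⟨y, hy, h1⟩ := Finset.exists_mem_eq_sup' hY fun y => φ y t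
    exact ⟨y, List.mem_toFinset.1 hy, h1⟩
  · rintro _ ⟨y, hy, rfl⟩
    exact Finset.le_sup' (fun y => φ y t) (List.mem_toFinset.2 hy)

end RealParameters

/-! ### The algorithm and its correctness -/

section Algorithm

variable {ι : Type v} {F : Type u} [Group F]

/-- The terms of a list of formal chains, with the numbers of the chains. -/
def flatEntries (C : List (FormalChain ι)) : List ((ℕ × Frac) × Word ι) :=
  (List.range C.length).flatMap fun j => (C.getD j []).map fun t => ((j, t.1), t.2)

/-- The algorithm computing `scl` on finite-dimensional rational subspaces. -/
def sclAlgorithm (C : List (FormalChain ℕ)) : List (List Frac) :=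
  tilingBounds C.length ((flatEntries C).map fun x => (x.1, cyclicReduce x.2))

theorem flatEntries_relabel (name : ι → ℕ) (C : List (FormalChain ι)) :
    flatEntries (C.map (FormalChain.relabel name)) =
      (flatEntries C).map fun x => (x.1, x.2.map fun a => (name a.1, a.2)) := by
  simp only [flatEntries, List.map_flatMap, List.length_map, List.map_map]
  refine List.flatMap_congr fun j hj => ?_
  rw [List.mem_range] at hj
  rw [List.getD_eq_getElem _ _ (by simpa using hj), List.getD_eq_getElem _ _ hj, List.getElem_map,
    FormalChain.relabel, List.map_map]
  rfl

theorem mem_flatEntries {C : List (FormalChain ι)} {x : (ℕ × Frac) × Word ι}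
    (hx : x ∈ flatEntries C) : ∃ h : x.1.1 < C.length, (x.1.2, x.2) ∈ C[x.1.1] := by
  simp only [flatEntries, List.mem_flatMap, List.mem_range, List.mem_map] at hx
  obtain ⟨j, hj, t, ht, rfl⟩ := hx
  rw [List.getD_eq_getElem _ _ hj] at ht
  exact ⟨hj, ht⟩

theorem sum_flatEntries {M : Type*} [AddCommMonoid M] (C : List (FormalChain ι))
    (f : ℕ → Frac × Word ι → M) :
    ((flatEntries C).map fun x => f x.1.1 (x.1.2, x.2)).sum =
      ∑ j : Fin C.length, ((C.get j).map (f j)).sum := by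
  have h1 : ∀ l : List ℕ, ((l.flatMap fun j => (C.getD j []).map fun t => ((j, t.1), t.2)).map
      fun x => f x.1.1 (x.1.2, x.2)).sum = (l.map fun j => ((C.getD j []).map (f j)).sum).sum := by
    intro l
    induction l with
    | nil => rfl
    | cons a l ih =>
      rw [List.flatMap_cons, List.map_append, List.sum_append, ih, List.map_cons, List.sum_cons,
        List.map_map]
      rfl
  rw [flatEntries, h1, ← List.map_coe_finRange_eq_range, List.map_map, Fin.sum_univ_def]
  refine congrArg _ (List.map_congr_left fun j _ => ?_)
  simp only [Function.comp_apply]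
  rw [List.getD_eq_getElem _ _ j.2]
  rfl

variable (b : FreeGroupBasis ι F)

theorem smul_evalChain (a : ℝ) (c : FormalChain ι) :
    a • evalChain b c = (c.map fun p => Finsupp.single (evalWord b p.2) ((p.1.val : ℝ) * a)).sum := by
  induction c with
  | nil => simp [evalChain]
  | cons p c ih =>
    rw [List.map_cons, List.sum_cons, ← ih]
    simp [evalChain, mul_comm]

/-- All terms of the chain number `j` share the parameter `t j`, each with its own coefficient. Thus
the program is parametrized by the combination of the chains and not by the single words. -/
theorem sclAlgorithm_spec (name : ι → ℕ) (C : List (FormalChain ι))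
    (hC : ∀ j : Fin C.length, evalChain b (C.get j) ∈ B1 F)
    (hn : Set.InjOn name (wordLetters fun i : Fin (flatEntries C).length => (flatEntries C)[i].2)) :
    ComputesScl b C hC (sclAlgorithm (C.map (FormalChain.relabel name))) := by
  classical
  let k := C.length
  let L := flatEntries C
  let j : Fin L.length → Fin k := fun i => ⟨L[i].1.1, (mem_flatEntries (List.getElem_mem i.2)).1⟩
  let f : Fin L.length → Frac := fun i => L[i].1.2
  let w : Fin L.length → Word ι := fun i => L[i].2
  obtain ⟨h1, h2⟩ := exists_hasScl_of_words b w name hn j f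
    ((flatEntries (C.map (FormalChain.relabel name))).map fun x => (x.1, cyclicReduce x.2)) (by
      rw [flatEntries_relabel, List.map_map]
      refine List.ext_getElem (by simp [L]) fun i h h' => ?_
      simp [j, f, w, L])
  have hA : sclAlgorithm (C.map (FormalChain.relabel name)) = tilingBounds k
      ((flatEntries (C.map (FormalChain.relabel name))).map fun x => (x.1, cyclicReduce x.2)) := by
    rw [sclAlgorithm, List.length_map]
  rw [hA]
  refine ⟨h1, ?_⟩
  let Φ : (Fin k → ℝ) →ₗ[ℝ] B1H F :=
    Fintype.linearCombination ℝ fun i => toB1H (evalChain b (C.get i)) (hC i)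
  have hΦ : ∀ t, Φ t = ∑ i, t i • toB1H (evalChain b (C.get i)) (hC i) :=
    fun t => Fintype.linearCombination_apply ℝ _ t
  intro t
  rw [← hΦ]
  refine isGreatest_of_rat ((sclSeminorm F).comp Φ) _ (fun a => ?_) t
  have hsum : ∑ i, Finsupp.single (evalWord b (w i)) (((f i).val * a (j i) : ℚ) : ℝ) =
      ∑ i, (a i : ℝ) • evalChain b (C.get i) := by
    simp only [smul_evalChain]
    let a' : ℕ → ℝ := fun n => if h : n < k then a ⟨n, h⟩ else 0
    have ha' : ∀ i : Fin k, (a i : ℝ) = a' i := fun i => by simp [a']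
    have h3 := sum_flatEntries C fun n p =>
      Finsupp.single (evalWord b p.2) ((p.1.val : ℝ) * a' n)
    simp only [ha']
    rw [← h3, ← Fin.sum_univ_fun_getElem]
    refine Finset.sum_congr rfl fun i _ => ?_
    push_cast
    rw [ha']
    rfl
  have hB : ∑ i, Finsupp.single (evalWord b (w i)) (((f i).val * a (j i) : ℚ) : ℝ) ∈ B1 F := by
    rw [hsum]
    exact Submodule.sum_mem _ fun i _ => Submodule.smul_mem _ _ (hC i)
  -- For rational parameters `N` times the chain is a sum modulo `H`. Both scl and the functionals
  -- are homogeneous, so `N` cancels at the end.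
  obtain ⟨N, m, hN, hm, hK, hscl⟩ := exists_multiset_of_chain b (fun i => evalWord b (w i)) _ hB
  obtain ⟨y, hy, hmax, hy2, -⟩ := h2 (fun i => N * a i) m hK fun i => by rw [hm]; ring
  have hev : ∀ y, evalVec k y (fun i => N * a i) = N * evalVec k y a := by
    intro y
    rw [evalVec, evalVec, Finset.mul_sum]
    exact Finset.sum_congr rfl fun _ _ => by ring
  have hN' : (0 : ℚ) < N := by exact_mod_cast hN
  refine ⟨y, hy, fun y' hy' => ?_, ?_⟩
  · have := hmax y' hy'
    rw [hev, hev] at this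
    exact le_of_mul_le_mul_left this hN'
  · have h4 := hscl _ hy2
    rw [hev, Rat.cast_mul, Rat.cast_natCast] at h4
    have h5 := mul_left_cancel₀ (by exact_mod_cast hN.ne') h4
    rw [← h5, Seminorm.comp_apply, sclSeminorm_apply, hΦ]
    congr 1
    rw [← toB1H_sum]
    simp only [hsum]

theorem injOn_letters {name : ι → ℕ} {C : List (FormalChain ι)} (hn : Set.InjOn name (letters C)) :
    Set.InjOn name (wordLetters fun i : Fin (flatEntries C).length => (flatEntries C)[i].2) := by
  refine hn.mono ?_
  rintro _ ⟨i, a, ha, rfl⟩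
  obtain ⟨h, h2⟩ := mem_flatEntries (List.getElem_mem i.2)
  exact ⟨_, List.getElem_mem h, _, h2, a, ha, rfl⟩

end Algorithm

/-! ### Piecewise rational linearity -/

section PiecewiseLinear

variable {G : Type u} [Group G] {k : ℕ}

omit [Group G] in
-- Rational coefficients pass through `θ`, although it is linear over `ℚ` only.
theorem mapRange_smul_of_rational {c : G →₀ ℝ} (hc : ∀ g, ∃ q : ℚ, c g = q) (θ : ℝ →ₗ[ℚ] ℝ)
    (r : ℝ) : Finsupp.mapRange.linearMap θ (r • c) = θ r • c := by
  ext g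
  obtain ⟨q, hq⟩ := hc g
  have : r * (q : ℝ) = q • r := by rw [Rat.smul_def, mul_comm]
  simp only [Finsupp.mapRange.linearMap_apply, Finsupp.mapRange_apply, Finsupp.smul_apply,
    smul_eq_mul, hq]
  rw [this, map_smul, Rat.smul_def, mul_comm]

theorem rational_of_relation {c : G →₀ ℝ}
    (hc : c ∈ ({c | ∃ (g : G) (n : ℤ), c = Finsupp.single (g ^ n) 1 - (n : ℝ) • Finsupp.single g 1} ∪
     {c | ∃ g h : G, c = Finsupp.single g 1 - Finsupp.single (h * g * h⁻¹) 1} : Set (G →₀ ℝ)))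
    (x : G) : ∃ q : ℚ, c x = q := by
  classical
  rcases hc with ⟨g, n, rfl⟩ | ⟨g, h, rfl⟩
  · refine ⟨(if g ^ n = x then 1 else 0) - n * (if g = x then 1 else 0), ?_⟩
    simp only [Finsupp.sub_apply, Finsupp.smul_apply, Finsupp.single_apply, smul_eq_mul]
    split_ifs <;> simp
  · refine ⟨(if g = x then 1 else 0) - (if h * g * h⁻¹ = x then 1 else 0), ?_⟩
    simp only [Finsupp.sub_apply, Finsupp.single_apply]
    split_ifs <;> simp

/-- The relations spanning `H` have rational coefficients, so `θ` only changes the real factors in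
front of them. -/
theorem mapRange_mem_homogeneousRelations (θ : ℝ →ₗ[ℚ] ℝ) {c : G →₀ ℝ}
    (hc : c ∈ homogeneousRelations G) :
    Finsupp.mapRange.linearMap θ c ∈ homogeneousRelations G := by
  obtain ⟨n, f, g, rfl⟩ := (Submodule.mem_span_set' (R := ℝ)).1 hc
  rw [map_sum]
  refine Submodule.sum_mem _ fun i _ => ?_
  rw [mapRange_smul_of_rational fun x => rational_of_relation (g i).2 x]
  exact Submodule.smul_mem _ _ (Submodule.subset_span (g i).2)

theorem exists_rational_coefficients : ∃ θ : ℝ →ₗ[ℚ] ℚ, θ 1 = 1 := by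
  obtain ⟨θ, hθ⟩ := LinearMap.exists_leftInverse_of_injective (Algebra.linearMap ℚ ℝ)
    (LinearMap.ker_eq_bot.2 (algebraMap ℚ ℝ).injective)
  refine ⟨θ, ?_⟩
  have := LinearMap.congr_fun hθ 1
  simpa using this

/-- Rational points of a rational subspace have rational coordinates. -/
theorem exists_rational_combination {x : Fin k → B1H G} (hx : ∀ j, IsRationalPoint (x j))
    {t : Fin k → ℝ} (ht : IsRationalPoint (∑ j, t j • x j)) :
    ∃ q : Fin k → ℚ, ∑ j, t j • x j = ∑ j, (q j : ℝ) • x j := by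
  -- A `ℚ`-linear retraction of `ℝ` onto `ℚ`, applied to all coefficients, fixes the rational chain
  -- `d` and preserves `H`. Hence it replaces the real coordinates `t j` by rational ones.
  obtain ⟨θ, hθ⟩ := exists_rational_coefficients
  let θ' : ℝ →ₗ[ℚ] ℝ := (Algebra.linearMap ℚ ℝ).comp θ
  have hθ' : ∀ r, θ' r = (θ r : ℝ) := fun r => by simp [θ']
  choose c hc hr hcx using hx
  obtain ⟨d, hd, hdr, hdx⟩ := ht
  refine ⟨fun j => θ (t j), ?_⟩
  have key : ∀ s : Fin k → ℝ, toB1H (∑ j, s j • c j)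
      (Submodule.sum_mem _ fun j _ => Submodule.smul_mem _ _ (hc j)) = ∑ j, s j • x j := by
    intro s
    simp only [← hcx]
    exact toB1H_sum hc s
  rw [← key, toB1H_eq_iff] at hdx
  have h2 := mapRange_mem_homogeneousRelations θ' hdx
  rw [map_sub, map_sum] at h2
  simp only [mapRange_smul_of_rational (hr _), hθ'] at h2
  have h3 := mapRange_smul_of_rational hdr θ' 1
  rw [one_smul, hθ', hθ, Rat.cast_one, one_smul] at h3
  rw [h3, ← toB1H_eq_iff (hc := hd) (hc' := Submodule.sum_mem _ fun j _ =>
    Submodule.smul_mem _ _ (hc j)), key] at h2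
  rw [← h2, ← key, eq_comm, toB1H_eq_iff]
  exact hdx

theorem exists_section {V W : Type*} [AddCommGroup V] [Module ℝ V] [AddCommGroup W] [Module ℝ W]
    (Φ : W →ₗ[ℝ] V) : ∃ σ : LinearMap.range Φ →ₗ[ℝ] W, ∀ z, Φ (σ z) = z := by
  obtain ⟨σ, hσ⟩ := Φ.rangeRestrict.exists_rightInverse_of_surjective Φ.range_rangeRestrict
  exact ⟨σ, fun z => congrArg Subtype.val (LinearMap.congr_fun hσ z)⟩

/-- A maximum of rational functionals of the coordinates is piecewise rational linear. -/
theorem piecewise_of_isGreatest (x : Fin k → B1H G) (hx : ∀ j, IsRationalPoint (x j))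
    (Y : Set (Fin k → ℚ)) (hY : Y.Finite)
    (h : ∀ t : Fin k → ℝ, IsGreatest {s : ℝ | ∃ y ∈ Y, s = ∑ j, (y j : ℝ) * t j}
      (scl (∑ j, t j • x j)))
    (L : Submodule ℝ (B1H G)) (hL : Submodule.span ℝ (Set.range x) = L) :
    IsPiecewiseRationalLinear (fun x : L => scl (x : B1H G)) ∧
      IsRationalPolyhedron {x : L | scl (x : B1H G) ≤ 1} := by
  let Φ : (Fin k → ℝ) →ₗ[ℝ] B1H G := Fintype.linearCombination ℝ x
  have hΦ : ∀ t, Φ t = ∑ j, t j • x j := fun t => Fintype.linearCombination_apply ℝ x t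
  have hr : LinearMap.range Φ = L := by rw [← hL]; exact Fintype.range_linearCombination ℝ x
  subst hr
  obtain ⟨σ, hσΦ⟩ := exists_section Φ
  let ψ : (Fin k → ℚ) → (Fin k → ℝ) →ₗ[ℝ] ℝ := fun y =>
    Fintype.linearCombination ℝ fun j => (y j : ℝ)
  have hψ : ∀ y t, ψ y t = ∑ j, (y j : ℝ) * t j := fun y t => by
    simp [ψ, Fintype.linearCombination_apply, mul_comm]
  -- Since scl is 0 at the origin, a functional in `Y` is at most 0 both at `t` and at `-t` whenever
  -- `t` represents 0. Hence it descends to the span even if the spanning points are dependent.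
  have hker : ∀ y ∈ Y, ∀ t, Φ t = 0 → ψ y t = 0 := by
    intro y hy t ht
    have h1 := (h t).2 ⟨y, hy, rfl⟩
    have h2 := (h (-t)).2 ⟨y, hy, rfl⟩
    have h0 : scl (0 : B1H G) = 0 := map_zero (sclSeminorm G)
    rw [← hψ, ← hΦ, map_neg, map_neg, ht, neg_zero, h0] at h2
    rw [← hψ, ← hΦ, ht, h0] at h1
    linarith
  let φ : (Fin k → ℚ) → LinearMap.range Φ →ₗ[ℝ] ℝ := fun y => (ψ y).comp σ
  have hφ : ∀ y ∈ Y, ∀ t (z : LinearMap.range Φ), Φ t = z → φ y z = ψ y t := by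
    intro y hy t z hz
    have := hker y hy (σ z - t) (by rw [map_sub, hσΦ, hz, sub_self])
    rw [map_sub, sub_eq_zero] at this
    exact this
  have hmax : ∀ z : LinearMap.range Φ, ∃ y ∈ Y, scl (z : B1H G) = φ y z ∧
      ∀ y' ∈ Y, φ y' z ≤ φ y z := by
    intro z
    obtain ⟨⟨y, hy, h1⟩, h2⟩ := h (σ z)
    rw [← hΦ, hσΦ] at h1 h2
    rw [← hψ] at h1
    refine ⟨y, hy, h1, fun y' hy' => ?_⟩
    have := h2 ⟨y', hy', rfl⟩
    rw [← hψ, h1] at this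
    exact this
  have hrat : ∀ y ∈ Y, IsRationalFunctional (φ y) := by
    intro y hy z hz
    have hz' := hz
    rw [← hσΦ z, hΦ] at hz'
    obtain ⟨q, hq⟩ := exists_rational_combination hx hz'
    refine ⟨∑ j, y j * q j, ?_⟩
    rw [hφ y hy (fun j => (q j : ℝ)) z (by rw [hΦ, ← hq, ← hΦ, hσΦ]), hψ]
    push_cast
    rfl
  have hsub : ∀ y ∈ Y, ∀ y' ∈ Y, IsRationalFunctional (φ y' - φ y) := by
    intro y hy y' hy' z hz
    obtain ⟨q, hq⟩ := hrat y hy z hz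
    obtain ⟨q', hq'⟩ := hrat y' hy' z hz
    exact ⟨q' - q, by rw [LinearMap.sub_apply, hq, hq']; push_cast; rfl⟩
  constructor
  -- Each cone is the region where one functional dominates all the others.
  · refine ⟨(fun y => {z | ∀ y' ∈ Y, φ y' z ≤ φ y z}) '' Y, hY.image _, ?_, ?_, ?_⟩
    · rintro _ ⟨y, hy, rfl⟩
      refine ⟨(fun y' => φ y' - φ y) '' Y, hY.image _, ?_, ?_⟩
      · rintro _ ⟨y', hy', rfl⟩
        exact hsub y hy y' hy'
      · ext z
        simp
    · refine Set.eq_univ_of_forall fun z => ?_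
      obtain ⟨y, hy, -, h2⟩ := hmax z
      exact ⟨_, ⟨y, hy, rfl⟩, h2⟩
    · rintro _ ⟨y, hy, rfl⟩
      refine ⟨φ y, hrat y hy, fun z hz => ?_⟩
      obtain ⟨y', hy', h1, h2⟩ := hmax z
      exact h1.trans (le_antisymm (hz y' hy') (h2 y hy))
  · refine ⟨(fun y => (φ y, (1 : ℚ))) '' Y, hY.image _, ?_, ?_⟩
    · rintro _ ⟨y, hy, rfl⟩
      exact hrat y hy
    · ext z
      obtain ⟨y, hy, h1, h2⟩ := hmax z
      simp only [Set.mem_ofPred_eq, Set.forall_mem_image, Rat.cast_one]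
      exact ⟨fun h y' hy' => (h2 y' hy').trans (h1 ▸ h), fun h => h1 ▸ h hy⟩

variable {ι : Type v} {F : Type u} [Group F]

theorem exists_frac (q : ℚ) : ∃ f : Frac, f.val = q := by
  refine ⟨(q.num, q.den - 1), ?_⟩
  have : ((q.den - 1 : ℕ) : ℚ) + 1 = q.den := by
    have := q.pos
    rw [Nat.cast_sub (by omega)]
    simp
  rw [Frac.val, this, Rat.num_div_den]

theorem exists_formalChain (b : FreeGroupBasis ι F) {c : F →₀ ℝ} (hc : ∀ g, ∃ q : ℚ, c g = q) :
    ∃ C : FormalChain ι, evalChain b C = c := by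
  choose q hq using hc
  choose f hf using fun g => exists_frac (q g)
  choose w hw using evalWord_surjective b
  refine ⟨c.support.toList.map fun g => (f g, w g), ?_⟩
  rw [evalChain, List.map_map]
  simp only [Function.comp_def, hf, hw, ← hq]
  rw [Finset.sum_map_toList]
  exact Finsupp.sum_single c

theorem piecewise_of_isFiniteRationalSubspace (b : FreeGroupBasis ι F) {L : Submodule ℝ (B1H F)}
    (hL : IsFiniteRationalSubspace L) :
    IsPiecewiseRationalLinear (fun x : L => scl (x : B1H F)) ∧
      IsRationalPolyhedron {x : L | scl (x : B1H F) ≤ 1} := by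
  obtain ⟨T, hT, hTr, rfl⟩ := hL
  obtain ⟨l, hl⟩ : ∃ l : List (B1H F), {x | x ∈ l} = T :=
    ⟨hT.toFinset.toList, by ext; simp⟩
  subst hl
  have hex : ∀ x : {x : B1H F // IsRationalPoint x}, ∃ C : FormalChain ι, ∃ hC,
      toB1H (evalChain b C) hC = x := by
    rintro ⟨_, c, hc, hr, rfl⟩
    obtain ⟨C, rfl⟩ := exists_formalChain b hr
    exact ⟨C, hc, rfl⟩
  choose fc hfc hfx using hex
  lift l to List {x : B1H F // IsRationalPoint x} using hTr
  let C := l.map fc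
  have hC : ∀ j : Fin C.length, evalChain b (C.get j) ∈ B1 F := fun j => by
    have : C.get j = fc (l[(j : ℕ)]'(by simpa [C] using j.2)) := by simp [C]
    rw [this]
    exact hfc _
  have hx : ∀ j : Fin C.length, toB1H (evalChain b (C.get j)) (hC j) =
      (l[(j : ℕ)]'(by simpa [C] using j.2) : {x : B1H F // IsRationalPoint x}) := fun j => by
    rw [← hfx]
    have : C.get j = fc (l[(j : ℕ)]'(by simpa [C] using j.2)) := by simp [C]
    simp only [this]
  obtain ⟨name, hn⟩ := exists_name fun i : Fin (flatEntries C).length => (flatEntries C)[i].2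
  obtain ⟨-, h⟩ := sclAlgorithm_spec b name C hC hn
  let Z := sclAlgorithm (C.map (FormalChain.relabel name))
  refine piecewise_of_isGreatest (fun j : Fin C.length => toB1H (evalChain b (C.get j)) (hC j))
    (fun j => ?_)
    ((fun (y : List Frac) (j : Fin C.length) => (y.getD j (0, 0)).val) '' {y | y ∈ Z})
    (Z.finite_toSet.image _) (fun t => ?_) _ ?_
  · rw [hx]
    exact Subtype.prop _
  · simpa using h t
  · congr 1
    ext x
    simp only [Set.mem_range, hx]
    constructor
    · rintro ⟨j, rfl⟩
      exact List.mem_map_of_mem (List.getElem_mem _)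
    · intro hx
      obtain ⟨z, hz, rfl⟩ := List.mem_map.1 hx
      obtain ⟨i, hi, rfl⟩ := List.getElem_of_mem hz
      exact ⟨⟨i, by simpa [C] using hi⟩, rfl⟩

end PiecewiseLinear

/-! ### Products and sums along the cycles of a permutation -/

section Orbits

variable {D : Type*} (σ : Equiv.Perm D)

/-- Over a full period the potentials `P` at both ends agree, so the product of the letters is
conjugate to a power of `g`. With `g = 1` this treats the polygons of a surface, and in general its
boundary components. -/
theorem prod_telescope {F : Type u} [Group F] (x P : D → F) (g : F) (δ : D → ℤ) (d : D)
    (h : ∀ i : ℕ, P ((σ ^ i) d) * x ((σ ^ i) d) = g ^ δ ((σ ^ i) d) * P ((σ ^ (i + 1)) d)) (n : ℕ) :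
    P d * ((List.range n).map fun i => x ((σ ^ i) d)).prod =
      g ^ (∑ i ∈ Finset.range n, δ ((σ ^ i) d)) * P ((σ ^ n) d) := by
  induction n with
  | zero => simp
  | succ n ih =>
    rw [List.range_succ, List.map_append, List.prod_append, ← mul_assoc, ih, mul_assoc,
      Finset.sum_range_succ, zpow_add, mul_assoc]
    simp [h]

theorem pow_minimalPeriod (d : D) : (σ ^ Function.minimalPeriod σ d) d = d := by
  rw [← Equiv.Perm.iterate_eq_pow]
  exact Function.iterate_minimalPeriod

theorem sum_range_minimalPeriod [Fintype D] [DecidableEq D] [DecidableRel σ.SameCycle] (δ : D → ℤ) (d : D) :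
    ∑ i ∈ Finset.range (Function.minimalPeriod σ d), δ ((σ ^ i) d) =
      ∑ e with σ.SameCycle d e, δ e := by
  rw [← Finset.sum_image (s := Finset.range (Function.minimalPeriod σ d)) (g := fun i => (σ ^ i) d)]
  · congr 1
    ext e
    simp only [Finset.mem_image, Finset.mem_range, Finset.mem_filter, Finset.mem_univ, true_and]
    constructor
    · rintro ⟨i, -, rfl⟩
      exact ⟨i, by simp⟩
    · intro he
      obtain ⟨i, -, -, hi⟩ := he.exists_pow_eq σ
      have hpos : 0 < Function.minimalPeriod σ d := by
        refine Function.minimalPeriod_pos_of_mem_periodicPts ?_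
        exact Function.Injective.mem_periodicPts σ.injective d
      refine ⟨i % Function.minimalPeriod σ d, Nat.mod_lt _ hpos, ?_⟩
      rw [← hi, ← Equiv.Perm.iterate_eq_pow, ← Equiv.Perm.iterate_eq_pow,
        Function.iterate_mod_minimalPeriod_eq]
  · intro i hi j hj hij
    simp only [Finset.coe_range, Set.mem_Iio] at hi hj
    simp only [← Equiv.Perm.iterate_eq_pow] at hij
    exact Function.iterate_injOn_Iio_minimalPeriod hi hj hij

end Orbits

/-! ### Cells and components of polygonal surfaces -/

section Cells

namespace PolygonalSurface

variable (S : PolygonalSurface)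

/-- The edge of a side. -/
def edgeOf (d : S.Dart) : S.Edge := Quot.mk _ d

/-- The face of a side. -/
def faceOf (d : S.Dart) : S.Face := Quot.mk _ d

/-- The start of a side. -/
def vertexOf (d : S.Dart) : S.Vertex := Quot.mk _ d

theorem component_face (d : S.Dart) : S.component (S.face d) = S.component d :=
  (Quot.sound (r := fun d e : S.Dart => e = S.face d ∨ e = S.glue d) (Or.inl rfl)).symm

theorem component_glue (d : S.Dart) : S.component (S.glue d) = S.component d :=
  (Quot.sound (r := fun d e : S.Dart => e = S.face d ∨ e = S.glue d) (Or.inr rfl)).symm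

theorem edgeOf_glue (d : S.Dart) : S.edgeOf (S.glue d) = S.edgeOf d :=
  (Quot.sound (r := fun d e : S.Dart => e = S.glue d) rfl).symm

theorem faceOf_face (d : S.Dart) : S.faceOf (S.face d) = S.faceOf d :=
  (Quot.sound (r := fun d e : S.Dart => e = S.face d) rfl).symm

theorem vertexOf_face_glue (d : S.Dart) (hd : S.glue d ≠ d) :
    S.vertexOf (S.face (S.glue d)) = S.vertexOf d :=
  (Quot.sound (r := fun d e : S.Dart => S.glue d ≠ d ∧ e = S.face (S.glue d)) ⟨hd, rfl⟩).symm

end PolygonalSurface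

end Cells

/-! ### Polygons with alternately glued and free sides: Euler characteristic -/

section Ribbon

variable {H : Type} (ρ ι : Equiv.Perm H)

/-- The surface assembled from polygons with alternatingly glued and free sides: `ρ` leads to the
next glued side of a polygon, and glued sides are glued by the involution `ι`. A dart is a glued
side or the free side following it. -/
abbrev ribbonSurface [Fintype H] (hι : ∀ h, ι (ι h) = h) : PolygonalSurface where
  Dart := H × Bool
  face :=
    { toFun := fun d => if d.2 then (ρ d.1, false) else (d.1, true)
      invFun := fun d => if d.2 then (d.1, false) else (ρ.symm d.1, true)
      left_inv := by rintro ⟨h, _ | _⟩ <;> simp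
      right_inv := by rintro ⟨h, _ | _⟩ <;> simp }
  glue :=
    { toFun := fun d => if d.2 then d else (ι d.1, false)
      invFun := fun d => if d.2 then d else (ι d.1, false)
      left_inv := by rintro ⟨h, _ | _⟩ <;> simp [hι]
      right_inv := by rintro ⟨h, _ | _⟩ <;> simp [hι] }
  glue_glue := by rintro ⟨h, _ | _⟩ <;> simp [hι]

variable [Fintype H] (hι : ∀ h, ι (ι h) = h)

/-- The component of a half-edge. -/
def ribbonComponent (h : H) : (ribbonSurface ρ ι hι).Component :=
  (ribbonSurface ρ ι hι).component (h, true)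

theorem component_false (h : H) :
    (ribbonSurface ρ ι hι).component (h, false) = ribbonComponent ρ ι hι h :=
  ((ribbonSurface ρ ι hι).component_face (h, false)).symm

theorem component_eq (d : H × Bool) :
    (ribbonSurface ρ ι hι).component d = ribbonComponent ρ ι hι d.1 := by
  rcases d with ⟨h, _ | _⟩
  · exact component_false ρ ι hι h
  · rfl

theorem ribbonComponent_next (h : H) : ribbonComponent ρ ι hι (ρ h) = ribbonComponent ρ ι hι h := by
  rw [← component_false]
  exact (ribbonSurface ρ ι hι).component_face (h, true)

theorem ribbonComponent_flip (h : H) : ribbonComponent ρ ι hι (ι h) = ribbonComponent ρ ι hι h := by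
  rw [← component_false, ← component_false ρ ι hι h]
  exact (ribbonSurface ρ ι hι).component_glue (h, false)

theorem not_isClosedComponent (c : (ribbonSurface ρ ι hι).Component) :
    ¬ (ribbonSurface ρ ι hι).IsClosedComponent c := by
  obtain ⟨⟨h, ε⟩, rfl⟩ := Quot.exists_rep c
  exact fun hc => hc (h, true) (component_eq ρ ι hι (h, ε)).symm rfl

variable {ρ ι hι} {side : H → Bool} (hside : ∀ h, side (ι h) = !side h)

omit [Fintype H] in
include hside in
theorem flip_ne (h : H) : ι h ≠ h := fun h1 => by
  have := hside h
  rw [h1] at this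
  simp at this

-- Free sides start at pairwise different vertices, and the start of the glued side `(h, false)` is
-- that of the free side `(ι h, true)`. So vertices correspond to half-edges.
include hside in
theorem card_vertex (c : (ribbonSurface ρ ι hι).Component) :
    Nat.card {x : (ribbonSurface ρ ι hι).Vertex //
      ∃ d, Quot.mk _ d = x ∧ (ribbonSurface ρ ι hι).component d = c} =
      Nat.card {h // ribbonComponent ρ ι hι h = c} := by
  symm
  let S := ribbonSurface ρ ι hι
  let V : S.Vertex → H := Quot.lift (fun d : H × Bool => if d.2 then d.1 else ι d.1) (by
    rintro ⟨h, _ | _⟩ e ⟨h1, rfl⟩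
    · rfl
    · exact absurd rfl h1)
  refine Nat.card_congr (Equiv.ofBijective (fun h => ⟨Quot.mk _ (h.1, true), (h.1, true), rfl, h.2⟩) ⟨?_, ?_⟩)
  · intro h h' hh
    exact Subtype.ext (congrArg V (congrArg Subtype.val hh))
  · rintro ⟨_, ⟨h, ε⟩, rfl, hc⟩
    rw [component_eq] at hc
    cases ε
    · refine ⟨⟨ι h, (ribbonComponent_flip ρ ι hι h).trans hc⟩, Subtype.ext ?_⟩
      exact (ribbonSurface ρ ι hι).vertexOf_face_glue (h, false) fun h1 =>
        flip_ne hside h (congrArg Prod.fst h1)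
    · exact ⟨⟨h, hc⟩, rfl⟩

-- Every free side is an edge by itself, and an edge made of two glued sides is represented by the
-- one with `side h = true`.
include hside in
theorem card_edge (c : (ribbonSurface ρ ι hι).Component) :
    Nat.card {x : (ribbonSurface ρ ι hι).Edge //
      ∃ d, Quot.mk _ d = x ∧ (ribbonSurface ρ ι hι).component d = c} =
      Nat.card {h // ribbonComponent ρ ι hι h = c} +
        Nat.card {x : {h // side h = true} // ribbonComponent ρ ι hι x = c} := by
  symm
  let S := ribbonSurface ρ ι hι
  let E : S.Edge → H ⊕ H := Quot.lift (fun d : H × Bool =>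
      if d.2 then .inl d.1 else .inr (if side d.1 then d.1 else ι d.1)) (by
    rintro ⟨h, _ | _⟩ e rfl
    · have h1 : S.glue (h, false) = (ι h, false) := rfl
      rw [h1]
      simp only [hside, hι, Bool.false_eq_true, if_false]
      cases side h <;> simp
    · rfl)
  have hE1 : ∀ h, E (S.edgeOf (h, true)) = .inl h := fun _ => rfl
  have hE2 : ∀ h, side h = true → E (S.edgeOf (h, false)) = .inr h := fun h hh => by
    have : E (S.edgeOf (h, false)) = .inr (if side h then h else ι h) := rfl
    rw [this, if_pos hh]
  rw [← Nat.card_sum]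
  refine Nat.card_congr (Equiv.ofBijective (Sum.elim
    (fun h => ⟨Quot.mk _ (h.1, true), (h.1, true), rfl, h.2⟩)
    (fun h => ⟨Quot.mk _ (h.1.1, false), (h.1.1, false), rfl,
      (component_false ρ ι hι _).trans h.2⟩)) ⟨?_, ?_⟩)
  · rintro (h | h) (h' | h') hh
    · have h1 : E (S.edgeOf (h.1, true)) = E (S.edgeOf (h'.1, true)) :=
        congrArg E (congrArg Subtype.val hh)
      rw [hE1, hE1, Sum.inl.injEq] at h1
      rw [Subtype.ext h1]
    · have h1 : E (S.edgeOf (h.1, true)) = E (S.edgeOf (h'.1.1, false)) :=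
        congrArg E (congrArg Subtype.val hh)
      rw [hE1, hE2 _ h'.1.2] at h1
      cases h1
    · have h1 : E (S.edgeOf (h.1.1, false)) = E (S.edgeOf (h'.1, true)) :=
        congrArg E (congrArg Subtype.val hh)
      rw [hE1, hE2 _ h.1.2] at h1
      cases h1
    · have h1 : E (S.edgeOf (h.1.1, false)) = E (S.edgeOf (h'.1.1, false)) :=
        congrArg E (congrArg Subtype.val hh)
      rw [hE2 _ h.1.2, hE2 _ h'.1.2, Sum.inr.injEq] at h1
      rw [Subtype.ext (Subtype.ext h1)]
  · rintro ⟨_, ⟨h, ε⟩, rfl, hc⟩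
    rw [component_eq] at hc
    cases ε
    · by_cases hh : side h = true
      · exact ⟨.inr ⟨⟨h, hh⟩, hc⟩, rfl⟩
      · refine ⟨.inr ⟨⟨ι h, by simpa [hside] using hh⟩,
          (ribbonComponent_flip ρ ι hι h).trans hc⟩, Subtype.ext ?_⟩
        exact S.edgeOf_glue (h, false)
    · exact ⟨.inl ⟨h, hc⟩, rfl⟩

variable {P : Type} {pc : H → P} {s : P → H} (hpc : ∀ h, pc (ρ h) = pc h) (hs : ∀ p, pc (s p) = p)
  (hreach : ∀ h, ∃ n : ℕ, (ρ ^ n) (s (pc h)) = h)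

-- The polygons are the cycles of `ρ`: `pc` is constant along them, and each is swept out from its
-- chosen half-edge `s p`.
include hpc hs hreach in
theorem card_face (c : (ribbonSurface ρ ι hι).Component) :
    Nat.card {x : (ribbonSurface ρ ι hι).Face //
      ∃ d, Quot.mk _ d = x ∧ (ribbonSurface ρ ι hι).component d = c} =
      Nat.card {p // ribbonComponent ρ ι hι (s p) = c} := by
  symm
  let S := ribbonSurface ρ ι hι
  let V : S.Face → P := Quot.lift (fun d : H × Bool => pc d.1) (by
    rintro ⟨h, _ | _⟩ e rfl
    · rfl
    · exact (hpc h).symm)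
  have hpow : ∀ (n : ℕ) (h : H), S.faceOf ((ρ ^ n) h, true) = S.faceOf (h, true) ∧
      ribbonComponent ρ ι hι ((ρ ^ n) h) = ribbonComponent ρ ι hι h := by
    intro n h
    induction n with
    | zero => exact ⟨rfl, rfl⟩
    | succ n ih =>
      rw [pow_succ', Equiv.Perm.mul_apply, ← ih.1, ← ih.2]
      refine ⟨?_, ribbonComponent_next ρ ι hι _⟩
      exact (S.faceOf_face (ρ ((ρ ^ n) h), false)).trans (S.faceOf_face ((ρ ^ n) h, true))
  refine Nat.card_congr (Equiv.ofBijective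
    (fun p => ⟨Quot.mk _ (s p.1, true), (s p.1, true), rfl, p.2⟩) ⟨?_, ?_⟩)
  · intro p p' h
    have h1 : pc (s p) = pc (s p') := congrArg V (congrArg Subtype.val h)
    rw [hs, hs] at h1
    exact Subtype.ext h1
  · rintro ⟨_, ⟨h, ε⟩, rfl, hc⟩
    rw [component_eq] at hc
    obtain ⟨n, hn⟩ := hreach h
    obtain ⟨h1, h2⟩ := hpow n (s (pc h))
    rw [hn] at h1 h2
    refine ⟨⟨pc h, h2.symm.trans hc⟩, Subtype.ext (h1.symm.trans ?_)⟩
    cases ε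
    · exact S.faceOf_face (h, false)
    · rfl

include hside hpc hs hreach in
theorem chi_ribbonSurface (c : (ribbonSurface ρ ι hι).Component) :
    (ribbonSurface ρ ι hι).chi c = (Nat.card {p // ribbonComponent ρ ι hι (s p) = c} : ℤ) -
      Nat.card {x : {h // side h = true} // ribbonComponent ρ ι hι x = c} := by
  rw [PolygonalSurface.chi, card_vertex hside, card_edge hside, card_face hpc hs hreach]
  push_cast
  ring

-- Because `ρ` has no fixed point, every polygon has at least two glued sides, while a glued edge
-- consists of exactly two. So no component has more polygons than glued edges.
include hside hpc hs hreach in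
theorem chi_ribbonSurface_nonpos (hρ : ∀ h, ρ h ≠ h) (c : (ribbonSurface ρ ι hι).Component) :
    (ribbonSurface ρ ι hι).chi c ≤ 0 := by
  have : Finite P := Finite.of_surjective pc fun p => ⟨s p, hs p⟩
  rw [chi_ribbonSurface hside hpc hs hreach]
  have h1 : Nat.card ({p // ribbonComponent ρ ι hι (s p) = c} × Bool) ≤
      Nat.card {h // ribbonComponent ρ ι hι h = c} := by
    refine Nat.card_le_card_of_injective (fun x => if x.2 then ⟨s x.1, x.1.2⟩ else
      ⟨ρ (s x.1), (ribbonComponent_next ρ ι hι _).trans x.1.2⟩) ?_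
    rintro ⟨⟨p, hp⟩, ε⟩ ⟨⟨p', hp'⟩, ε'⟩ h
    have h2 := congrArg Subtype.val h
    have h3 : p = p' := by
      have := congrArg pc h2
      cases ε <;> cases ε' <;> simpa [hpc, hs] using this
    subst h3
    cases ε <;> cases ε' <;> simp at h2 ⊢
    · exact hρ _ h2
    · exact hρ _ h2.symm
  have h2 : Nat.card {h // ribbonComponent ρ ι hι h = c} ≤
      Nat.card ({x : {h // side h = true} // ribbonComponent ρ ι hι x = c} × Bool) := by
    refine Nat.card_le_card_of_injective (fun x => if h : side x = true then (⟨⟨x, h⟩, x.2⟩, true)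
      else (⟨⟨ι x, by simpa [hside] using h⟩, (ribbonComponent_flip ρ ι hι _).trans x.2⟩, false)) ?_
    rintro ⟨h, hh⟩ ⟨h', hh'⟩ heq
    by_cases h3 : side h = true <;> by_cases h4 : side h' = true <;> simp [h3, h4] at heq ⊢ <;>
      exact heq
  rw [Nat.card_prod, Nat.card_eq_fintype_card (α := Bool), Fintype.card_bool] at h1 h2
  omega

theorem sum_card_fiber {A B : Type} [Finite A] [Fintype B] (f : A → B) :
    ∑ b, Nat.card {a // f a = b} = Nat.card A := by
  rw [← Nat.card_sigma]
  exact Nat.card_congr (Equiv.sigmaFiberEquiv f)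

-- No component has positive Euler characteristic, so the truncation in `chiMinus` has no effect and
-- the counts add up over the components.
include hside hpc hs hreach in
theorem chiMinus_ribbonSurface (hρ : ∀ h, ρ h ≠ h) :
    (ribbonSurface ρ ι hι).chiMinus = (Nat.card P : ℤ) - Nat.card {h // side h = true} := by
  have : Finite P := Finite.of_surjective pc fun p => ⟨s p, hs p⟩
  rw [PolygonalSurface.chiMinus, ← sum_card_fiber fun p => ribbonComponent ρ ι hι (s p),
    ← sum_card_fiber fun h : {h // side h = true} => ribbonComponent ρ ι hι h]
  push_cast
  rw [← Finset.sum_sub_distrib]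
  refine Finset.sum_congr rfl fun c _ => ?_
  rw [min_eq_right (chi_ribbonSurface_nonpos hside hpc hs hreach hρ c),
    chi_ribbonSurface hside hpc hs hreach]

end Ribbon

/-! ### Maps from such surfaces, and the classes of their boundary components -/

section RibbonMap

variable {H : Type} [Fintype H] {ρ ι : Equiv.Perm H} {hι : ∀ h, ι (ι h) = h} {F : Type u} [Group F]

/-- The map sending glued sides to the base point. -/
def ribbonMap (hι : ∀ h, ι (ι h) = h) (e Q : H → F) (hQ : ∀ h, Q h * e h = Q (ρ h)) :
    SurfaceMap (ribbonSurface ρ ι hι) F where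
  label := fun d : H × Bool => if d.2 then e d.1 else 1
  label_glue := by
    rintro ⟨h, _ | _⟩ hd
    · simp
    · exact absurd rfl hd
  face_prod := by
    intro d
    have := prod_telescope (ribbonSurface ρ ι hι).face (fun d : H × Bool => if d.2 then e d.1 else 1)
      (fun d : H × Bool => if d.2 then Q d.1 else Q d.1) 1 (fun _ => 0) d (fun i => by
        rw [pow_succ', Equiv.Perm.mul_apply]
        generalize ((ribbonSurface ρ ι hι).face ^ i) d = d'
        obtain ⟨h, _ | _⟩ := d'
        · simp
        · simp [hQ]) (Function.minimalPeriod (ribbonSurface ρ ι hι).face d)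
    rw [pow_minimalPeriod] at this
    simpa using this

theorem boundaryComponent_eq_iff {S : PolygonalSurface} {d e : S.BoundaryDart} :
    S.boundaryComponent d = S.boundaryComponent e ↔ S.walk.SameCycle d.1 e.1 := by
  constructor
  · intro h
    let f : S.BoundaryComponent → Prop := Quot.lift (fun x => S.walk.SameCycle d.1 x.1)
      fun x y hxy => propext ⟨fun h => h.trans hxy, fun h => h.trans hxy.symm⟩
    have h1 : f (S.boundaryComponent d) := Equiv.Perm.SameCycle.refl _ _
    rw [h] at h1
    exact h1
  · exact fun h => Quot.sound h

variable (ρ) in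
/-- The boundary component following a half-edge. -/
def ribbonBoundary (hι : ∀ h, ι (ι h) = h) (h : H) : (ribbonSurface ρ ι hι).BoundaryComponent :=
  (ribbonSurface ρ ι hι).boundaryComponent ⟨(h, true), rfl⟩

/-- After the free side of `h` the boundary crosses one glued edge and continues with the free side
of `ι (ρ h)`. Along this walk the target is constant and the potentials telescope, so a boundary
component is conjugate to the power of its target whose exponent is the sum of `δ`. -/
theorem rationallyBounds_ribbonMap {e Q : H → F} (hQ : ∀ h, Q h * e h = Q (ρ h)) {m : ℕ}
    {g : Fin m → F} {q : Fin m → ℚ} {n : ℕ} (hn : 0 < n)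
    (hne : ∀ h, ι h ≠ h) (tgt : H → Fin m) (pot : H → F) (δ : H → ℤ)
    (htgt : ∀ h, tgt (ι (ρ h)) = tgt h)
    (hpot : ∀ h, pot h * e h = g (tgt h) ^ δ h * pot (ι (ρ h)))
    (hδ : ∀ i, ((∑ h with tgt h = i, δ h : ℤ) : ℚ) = n * q i) :
    RationallyBounds (ribbonMap hι e Q hQ) g q n := by
  classical
  let S := ribbonSurface ρ ι hι
  let tgt' : S.Dart → Fin m := fun d : H × Bool => if d.2 then tgt d.1 else tgt (ι d.1)
  have htgt' : ∀ d, tgt' (S.walk d) = tgt' d := by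
    rintro ⟨h, _ | _⟩
    · rfl
    · exact htgt h
  have hcyc : ∀ d e, S.walk.SameCycle d e → tgt' d = tgt' e := by
    intro d e h
    obtain ⟨i, -, -, rfl⟩ := h.exists_pow_eq S.walk
    clear h
    induction i with
    | zero => rfl
    | succ i ih => rw [pow_succ', Equiv.Perm.mul_apply, htgt', ih]
  let target : S.BoundaryComponent → Fin m := Quot.lift (fun d => tgt' d.1) fun d e h => hcyc _ _ h
  have htarget : ∀ h, target (ribbonBoundary ρ hι h) = tgt h := fun _ => rfl
  refine ⟨hn, target, fun b => ∑ h with ribbonBoundary ρ hι h = b, δ h, ?_, fun i => ?_⟩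
  · rintro ⟨⟨h, ε⟩, hd⟩
    cases ε
    · exact absurd (congrArg Prod.fst hd) (hne h)
    let δ' : S.Dart → ℤ := fun d : H × Bool => if d.2 then δ d.1 else 0
    let pot' : S.Dart → F := fun d : H × Bool => if d.2 then pot d.1 else pot (ι d.1)
    let x : S.Dart → F := fun d =>
      if S.glue d = d then (ribbonMap hι e Q hQ).label d else 1
    have hx1 : ∀ h, x (h, true) = e h := fun h => by
      have : S.glue (h, true) = (h, true) := rfl
      simp only [x, if_pos this]
      rfl
    have hx2 : ∀ h, x (h, false) = 1 := fun h => by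
      have : (ribbonMap hι e Q hQ).label (h, false) = 1 := rfl
      simp only [x, this, ite_self]
    have key := prod_telescope S.walk x pot' (g (tgt h)) δ' (h, true) (fun i => by
      have h1 : tgt' ((S.walk ^ i) (h, true)) = tgt h :=
        (hcyc (h, true) _ ⟨i, by simp⟩).symm
      rw [pow_succ', Equiv.Perm.mul_apply]
      generalize (S.walk ^ i) (h, true) = d' at h1
      obtain ⟨h', _ | _⟩ := d'
      · rw [hx2]
        simp [pot', δ', S]
        rfl
      · have h2 : tgt h' = tgt h := h1
        rw [hx1, ← h2]
        exact hpot h') (Function.minimalPeriod S.walk (h, true))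
    rw [pow_minimalPeriod, sum_range_minimalPeriod] at key
    have hsum : ∑ e with S.walk.SameCycle (h, true) e, δ' e =
        ∑ h' with ribbonBoundary ρ hι h' = ribbonBoundary ρ hι h, δ h' := by
      rw [Finset.sum_filter, Finset.sum_filter]
      have : ∀ f : S.Dart → ℤ, ∑ d, f d = ∑ h : H, (f (h, true) + f (h, false)) := fun f => by
        rw [Fintype.sum_prod_type]
        exact Finset.sum_congr rfl fun h _ => Fintype.sum_bool _
      rw [this]
      refine Finset.sum_congr rfl fun h' _ => ?_
      have h1 : ribbonBoundary ρ hι h' = ribbonBoundary ρ hι h ↔ S.walk.SameCycle (h, true) (h', true) :=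
        boundaryComponent_eq_iff.trans Equiv.Perm.sameCycle_comm
      simp [δ', h1]
    rw [hsum] at key
    refine isConj_iff.2 ⟨pot h, ?_⟩
    rw [mul_inv_eq_iff_eq_mul]
    refine Eq.trans (congrArg (pot h * ·) ?_) key
    refine congrArg List.prod (List.map_congr_left fun i _ => ?_)
    simp only [x]
    split_ifs <;> rfl
  · rw [← hδ]
    congr 1
    rw [← Finset.sum_fiberwise_of_maps_to (s := Finset.univ.filter fun h => tgt h = i)
      (t := Finset.univ.filter fun b => target b = i) (g := ribbonBoundary ρ hι)
      (fun h hh => by simpa [htarget] using hh)]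
    refine Finset.sum_congr rfl fun b hb => ?_
    rw [Finset.filter_filter]
    refine Finset.sum_congr (Finset.filter_congr fun h _ => ?_) fun _ _ => rfl
    rw [Finset.mem_filter] at hb
    exact ⟨fun hh => ⟨by rw [← htarget, hh]; exact hb.2, hh⟩, fun hh => hh.2⟩

end RibbonMap

/-! ### Tiles of an integral tiling and the gluing of their sides -/

section Pieces

variable {ι : Type v} {I : Type} {ws : I → Word ι} (R : Pos ws → Pos ws → ℕ)
  (T : Pos ws → Pos ws → Pos ws → ℕ)

/-- The triangles of a tiling. -/
abbrev Triangles : Type := Σ x : Pos ws × Pos ws × Pos ws, Fin (T x.1 x.2.1 x.2.2)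

/-- The rectangles of a tiling. -/
abbrev Rectangles : Type := Σ x : Pos ws × Pos ws, Fin (R x.1 x.2)

/-- The glued sides of the tiles of a tiling. -/
abbrev TileSides : Type := Triangles T × Fin 3 ⊕ Rectangles R × Bool

variable {R T}

/-- The end points of a glued side. -/
def sideType : TileSides R T → Pos ws × Pos ws
  | .inl (t, k) => ![(t.1.1, t.1.2.1), (t.1.2.1, t.1.2.2), (t.1.2.2, t.1.1)] k
  | .inr (r, false) => (r.1.2.next, r.1.1)
  | .inr (r, true) => (r.1.1.next, r.1.2)

/-- The next glued side of a tile. -/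
def sideNext : Equiv.Perm (TileSides R T) :=
  Equiv.sumCongr (Equiv.prodCongr (Equiv.refl _) (Equiv.addRight 1))
    (Equiv.prodCongr (Equiv.refl _) Equiv.boolNot)

theorem sideType_next_inl (x : Triangles T × Fin 3) :
    (sideType (sideNext (.inl x : TileSides R T))).1 = (sideType (.inl x : TileSides R T)).2 := by
  obtain ⟨t, k⟩ := x
  fin_cases k <;> rfl

theorem sideType_next_inr (x : Rectangles R × Bool) :
    (sideType (sideNext (.inr x : TileSides R T))).1 =
      (sideType (.inr x : TileSides R T)).2.next := by
  obtain ⟨r, _ | _⟩ := x <;> rfl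

variable [Fintype I]

theorem sum_tileSides {M : Type*} [CommRing M] (f : Pos ws × Pos ws → M) :
    ∑ s : TileSides R T, f (sideType s) =
      (∑ a, ∑ b, ∑ c, (T a b c : M) * (f (a, b) + f (b, c) + f (c, a))) +
        ∑ a, ∑ b, (R a b : M) * (f (b.next, a) + f (a.next, b)) := by
  rw [Fintype.sum_sum_type, Fintype.sum_prod_type, Fintype.sum_prod_type, Fintype.sum_sigma,
    Fintype.sum_sigma]
  simp only [Fin.sum_univ_three, Fintype.sum_bool, sideType, Matrix.cons_val_zero,
    Matrix.cons_val_one, Matrix.cons_val, Finset.sum_const, Finset.card_univ, Fintype.card_fin,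
    nsmul_eq_mul, Fintype.sum_prod_type]
  congr 1
  exact Finset.sum_congr rfl fun a _ => Finset.sum_congr rfl fun b _ => by ring

theorem sum_rectangles {M : Type*} [CommRing M] (f : Pos ws × Pos ws → M) :
    ∑ r : Rectangles R, f r.1 = ∑ a, ∑ b, (R a b : M) * f (a, b) := by
  rw [Fintype.sum_sigma]
  simp only [Finset.sum_const, Finset.card_univ, Fintype.card_fin, nsmul_eq_mul,
    Fintype.sum_prod_type]

variable [DecidableEq I]

/-- The sides of a tiling can be glued. -/
theorem exists_gluing (h : IsTiling (fun a b => (R a b : ℤ)) (fun a b c => (T a b c : ℤ))) :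
    ∃ π : Equiv.Perm (TileSides R T), ∀ s, sideType (π s) = (sideType s).swap := by
  -- By the balance condition every type of side is as frequent as its reverse.
  have hcard : ∀ c : Pos ws × Pos ws, Fintype.card {s : TileSides R T // sideType s = c} =
      Fintype.card {s : TileSides R T // (sideType s).swap = c} := by
    rintro ⟨u, v⟩
    have h1 := h.balance u v
    rw [← sum_tileSides (R := R) (T := T) fun x => sideSign ℤ u v x.1 x.2] at h1
    simp only [sideSign, Finset.sum_sub_distrib] at h1
    rw [Fintype.card_subtype, Fintype.card_subtype]
    rw [sub_eq_zero, Finset.sum_boole, Finset.sum_boole] at h1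
    have h2 : ∀ s : TileSides R T, (sideType s = (u, v) ↔ (sideType s).1 = u ∧ (sideType s).2 = v) ∧
        ((sideType s).swap = (u, v) ↔ (sideType s).1 = v ∧ (sideType s).2 = u) := fun s => by
      constructor
      · exact Prod.ext_iff
      · rw [Prod.ext_iff]
        exact and_comm
    simp only [h2]
    exact_mod_cast h1
  -- Any choice of bijections between the fibres is good enough. The result need not be an
  -- involution; a second copy of the tiles will repair this.
  refine ⟨Equiv.ofFiberEquiv fun c => Fintype.equivOfCardEq (hcard c), fun s => ?_⟩
  rw [← Prod.swap_inj, Prod.swap_swap]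
  exact Equiv.ofFiberEquiv_map (g := fun s : TileSides R T => (sideType s).swap) _ s

end Pieces

/-! ### The closed-up surface of an integral tiling -/

section Assembly

variable {ι : Type v} {F : Type u} [Group F] (b : FreeGroupBasis ι F) {m : ℕ}
  {ws : Fin m × Bool → Word ι} {R : Pos ws → Pos ws → ℕ} {T : Pos ws → Pos ws → Pos ws → ℕ}

/-- The contribution of a letter to the degree of a boundary component. -/
def lastSign (p : Pos ws) : ℤ := if p.IsLast then (if p.1.2 then 1 else -1) else 0

theorem sum_lastSign (R : Pos ws → Pos ws → ℕ) (i : Fin m) :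
    ∑ a, ∑ b, (R a b : ℤ) * ((if a.1.1 = i then lastSign a else 0) +
      (if b.1.1 = i then lastSign b else 0)) =
      ((lastCount R (i, true) : ℕ) : ℤ) - ((lastCount R (i, false) : ℕ) : ℤ) := by
  have h1 : ∀ p : Pos ws, (if p.1.1 = i then lastSign p else 0) =
      (if p.IsLast ∧ p.1 = (i, true) then 1 else 0) - (if p.IsLast ∧ p.1 = (i, false) then 1 else 0) := by
    rintro ⟨⟨j, ε⟩, k⟩
    simp only [lastSign, Prod.mk.injEq]
    by_cases hj : j = i <;> by_cases hl : Pos.IsLast (ws := ws) ⟨(j, ε), k⟩ <;> cases ε <;>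
      simp [hj, hl]
  have h2 : ∀ ε, ((lastCount R (i, ε) : ℕ) : ℤ) = ∑ a, ∑ b, (R a b : ℤ) *
      ((if a.IsLast ∧ a.1 = (i, ε) then 1 else 0) + (if b.IsLast ∧ b.1 = (i, ε) then 1 else 0)) := by
    intro ε
    simp only [mul_add, Finset.sum_add_distrib]
    rw [Finset.sum_comm (f := fun a b : Pos ws => (R a b : ℤ) * if b.IsLast ∧ b.1 = (i, ε) then 1 else 0),
      ← Finset.sum_add_distrib, lastCount, Finset.sum_filter]
    push_cast
    refine Finset.sum_congr rfl fun p _ => ?_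
    rw [sideCount, ← Finset.sum_add_distrib]
    split_ifs <;> simp
  rw [h2, h2, ← Finset.sum_sub_distrib]
  refine Finset.sum_congr rfl fun p _ => ?_
  rw [← Finset.sum_sub_distrib]
  refine Finset.sum_congr rfl fun p' _ => ?_
  rw [h1, h1]
  ring

theorem lastCount_eq_zero (R : Pos ws → Pos ws → ℕ) {i : Fin m × Bool} (h : ws i = []) :
    lastCount R i = 0 := by
  refine Finset.sum_eq_zero ?_
  rintro ⟨j, k⟩ hp
  simp only [Finset.mem_filter] at hp
  obtain rfl : j = i := hp.2.2
  exact absurd k.2 (by simp [h])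

/-- A tiling, doubled, closes up to a surface; annuli take care of trivial words. -/
theorem exists_surface_of_isTiling
    (hRT : IsTiling (fun a b => (R a b : ℤ)) (fun a b c => (T a b c : ℤ)))
    (hinv : ∀ i, ws (i, false) = FreeGroup.invRev (ws (i, true))) {g : Fin m → F}
    (hg : ∀ i, IsConj (evalWord b (ws (i, true))) (g i)) {q : Fin m → ℚ} {n : ℕ} (hn : 0 < n)
    (d : Fin m → ℤ) (hd : ∀ i, ws (i, true) = [] → (d i : ℚ) = n * q i)
    (hdeg : ∀ i, ws (i, true) ≠ [] →
      2 * (((lastCount R (i, true) : ℕ) : ℚ) - ((lastCount R (i, false) : ℕ) : ℚ)) = n * q i) :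
    ∃ (S : PolygonalSurface) (f : SurfaceMap S F), RationallyBounds f g q n ∧
      (∀ c : S.Component, S.chi c ≤ 0 ∧ ¬ S.IsClosedComponent c) ∧
      S.chiMinus = - ∑ a, ∑ b, ∑ c, (T a b c : ℤ) := by
  classical
  obtain ⟨π, hπ⟩ := exists_gluing hRT
  have hπ' : ∀ s, sideType (π.symm s) = (sideType s).swap := fun s => by
    have := hπ (π.symm s)
    rw [Equiv.apply_symm_apply] at this
    rw [this, Prod.swap_swap]
  choose c hc using fun i => isConj_iff.1 (hg i)
  -- A trivial word has no positions, hence it is invisible to the tiling. Each such index receives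
  -- one annulus, made of a polygon with two sides glued to each other; its degree is arbitrary
  -- because the corresponding `g i` is trivial.
  let A : Type := {i : Fin m // ws (i, true) = []}
  let H : Type := TileSides R T × Bool ⊕ A × Bool
  let P : Type := (Triangles T ⊕ Rectangles R) × Bool ⊕ A
  let ρ : Equiv.Perm H := Equiv.sumCongr (Equiv.prodCongr sideNext (Equiv.refl _))
    (Equiv.prodCongr (Equiv.refl _) Equiv.boolNot)
  -- A side `s` of the copy `false` is glued to the side `π s` of the copy `true`, which is an
  -- involution whatever `π` is.
  let gl : TileSides R T × Bool → TileSides R T × Bool := fun x =>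
    if x.2 then (π.symm x.1, false) else (π x.1, true)
  have hgl : Function.Involutive gl := by
    rintro ⟨s, _ | _⟩ <;> simp [gl]
  let τ : Equiv.Perm H := Equiv.sumCongr hgl.toPerm (Equiv.prodCongr (Equiv.refl _) Equiv.boolNot)
  have hτ : ∀ h, τ (τ h) = h := by
    rintro (x | ⟨a, ε⟩)
    · exact congrArg Sum.inl (hgl x)
    · exact congrArg Sum.inr (Prod.ext rfl (Bool.not_not ε))
  let side : H → Bool := Sum.elim Prod.snd Prod.snd
  have hside : ∀ h, side (τ h) = !side h := by
    rintro (⟨s, _ | _⟩ | ⟨a, ε⟩) <;> rfl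
  let pc : H → P := Sum.elim (fun x => .inl (Sum.map Prod.fst Prod.fst x.1, x.2)) (fun x => .inr x.1)
  let sec : P → H := Sum.elim
    (fun x => .inl (Sum.map (fun t => (t, 0)) (fun r => (r, false)) x.1, x.2)) (fun a => .inr (a, false))
  have hpc : ∀ h, pc (ρ h) = pc h := by
    rintro (⟨x | x, ε⟩ | x) <;> rfl
  have hsec : ∀ p, pc (sec p) = p := by
    rintro (⟨x | x, ε⟩ | x) <;> rfl
  have hreach : ∀ h, ∃ k : ℕ, (ρ ^ k) (sec (pc h)) = h := by
    rintro (⟨⟨t, k⟩ | ⟨r, _ | _⟩, ε⟩ | ⟨a, _ | _⟩)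
    · fin_cases k
      · exact ⟨0, rfl⟩
      · exact ⟨1, rfl⟩
      · exact ⟨2, rfl⟩
    · exact ⟨0, rfl⟩
    · exact ⟨1, rfl⟩
    · exact ⟨0, rfl⟩
    · exact ⟨1, rfl⟩
  have hρ : ∀ h, ρ h ≠ h := by
    rintro (⟨⟨t, k⟩ | ⟨r, k⟩, ε⟩ | ⟨a, k⟩) h
    · have h1 : k + 1 = k := congrArg Prod.snd (Sum.inl.inj (congrArg Prod.fst (Sum.inl.inj h)))
      simp at h1
    · have h1 : (!k) = k := congrArg Prod.snd (Sum.inr.inj (congrArg Prod.fst (Sum.inl.inj h)))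
      simp at h1
    · have h1 : (!k) = k := congrArg Prod.snd (Sum.inr.inj h)
      simp at h1
  -- The free sides of a rectangle carry its two letters; those of triangles and annuli are
  -- constant.
  let e : H → F := Sum.elim (fun x => match x.1 with
    | .inl _ => 1
    | .inr y => evalWord b [(sideType (.inr y : TileSides R T)).2.letter]) fun _ => 1
  let Q : H → F := Sum.elim (fun x => match x.1 with
    | .inl _ => 1
    | .inr y => if y.2 then evalWord b [y.1.1.1.letter] else 1) fun _ => 1
  have hQ : ∀ h, Q h * e h = Q (ρ h) := by
    rintro (⟨x | ⟨r, _ | _⟩, ε⟩ | x)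
    · exact one_mul 1
    · exact one_mul _
    · have hr : r.1.2.letter = flipLetter r.1.1.letter := by
        by_contra h1
        have h2 := hRT.adj _ _ h1
        have h3 : R r.1.1 r.1.2 = 0 := by exact_mod_cast h2
        exact absurd r.2.2 (by omega)
      have : evalWord b [r.1.1.letter] * evalWord b [r.1.2.letter] = 1 := by
        rw [hr, evalWord_flipLetter, mul_inv_cancel]
      exact this
    · exact one_mul 1
  let tgt : H → Fin m := Sum.elim (fun x => (sideType x.1).2.1.1) fun x => x.1.1
  -- The factor `c i` conjugates the word `ws (i, true)` to `g i`, so that a full turn in the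
  -- potentials becomes a power of `g i` itself.
  let pot : H → F := Sum.elim (fun x => c (sideType x.1).2.1.1 * (sideType x.1).2.pot b) fun _ => 1
  let δ : H → ℤ := Sum.elim (fun x => match x.1 with
    | .inl _ => 0
    | .inr y => lastSign (sideType (.inr y : TileSides R T)).2) fun x => if x.2 then d x.1.1 else 0
  have hgltype : ∀ x, sideType (gl x).1 = (sideType x.1).swap := by
    rintro ⟨s, _ | _⟩
    · exact hπ s
    · exact hπ' s
  have hnext : ∀ (s : TileSides R T) ε,
      sideType (gl (sideNext s, ε)).1 = (sideType (sideNext s)).swap := fun s ε => hgltype _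
  have htgt : ∀ h, tgt (τ (ρ h)) = tgt h := by
    rintro (⟨x | x, ε⟩ | x)
    · change (sideType (gl (sideNext (.inl x), ε)).1).2.1.1 = _
      rw [hnext, Prod.snd_swap, sideType_next_inl]
      rfl
    · change (sideType (gl (sideNext (.inr x), ε)).1).2.1.1 = _
      rw [hnext, Prod.snd_swap, sideType_next_inr]
      rfl
    · rfl
  have hpot : ∀ h, pot h * e h = g (tgt h) ^ δ h * pot (τ (ρ h)) := by
    rintro (⟨x | x, ε⟩ | x)
    · change _ * 1 = g _ ^ (0 : ℤ) * (c (sideType (gl (sideNext (.inl x), ε)).1).2.1.1 *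
        (sideType (gl (sideNext (.inl x), ε)).1).2.pot b)
      rw [hnext, Prod.snd_swap, sideType_next_inl, zpow_zero, one_mul, mul_one]
      rfl
    · change (c (sideType (.inr x : TileSides R T)).2.1.1 *
          (sideType (.inr x : TileSides R T)).2.pot b) *
          evalWord b [(sideType (.inr x : TileSides R T)).2.letter] =
        g (sideType (.inr x : TileSides R T)).2.1.1 ^ lastSign (sideType (.inr x : TileSides R T)).2 *
          (c (sideType (gl (sideNext (.inr x), ε)).1).2.1.1 *
            (sideType (gl (sideNext (.inr x), ε)).1).2.pot b)
      rw [hnext, Prod.snd_swap, sideType_next_inr]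
      generalize (sideType (.inr x : TileSides R T)).2 = p
      have hnx : p.next.1 = p.1 := rfl
      rw [mul_assoc, Pos.pot_mul_letter, hnx, lastSign, ← hc]
      by_cases hp : p.IsLast
      · rw [if_pos hp, if_pos hp]
        obtain ⟨⟨i, ε⟩, k⟩ := p
        cases ε
        · simp [hinv, evalWord_invRev, mul_assoc]
        · simp [mul_assoc]
      · rw [if_neg hp, if_neg hp, zpow_zero, one_mul, one_mul]
    · have h1 : g x.1.1 = 1 := by
        rw [← hc, x.1.2]
        simp [evalWord]
      change (1 : F) * 1 = g x.1.1 ^ _ * 1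
      rw [h1, one_zpow]
  have hδ : ∀ i, ((∑ h with tgt h = i, δ h : ℤ) : ℚ) = n * q i := by
    intro i
    have h1 : ∑ h with tgt h = i, δ h = 2 * (((lastCount R (i, true) : ℕ) : ℤ) - ((lastCount R (i, false) : ℕ) : ℤ)) +
        ∑ a : A, if a.1 = i then d a.1 else 0 := by
      have h2 : ∀ (x : TileSides R T) (ε : Bool),
          (if tgt (.inl (x, ε)) = i then δ (.inl (x, ε)) else 0) = Sum.elim (fun _ => 0)
            (fun y => if (sideType (.inr y : TileSides R T)).2.1.1 = i then
              lastSign (sideType (.inr y : TileSides R T)).2 else 0) x := by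
        rintro (x | x) ε
        · exact ite_self _
        · rfl
      have h3 : ∀ (a : A) (ε : Bool), (if tgt (.inr (a, ε)) = i then δ (.inr (a, ε)) else 0) =
          if ε then (if a.1 = i then d a.1 else 0) else 0 := by
        rintro a (_ | _)
        · exact ite_self _
        · rfl
      rw [Finset.sum_filter, Fintype.sum_sum_type, Fintype.sum_prod_type, Fintype.sum_prod_type,
        Finset.sum_congr rfl fun x _ => Finset.sum_congr rfl fun ε _ => h2 x ε,
        Finset.sum_congr rfl fun x _ => Finset.sum_congr rfl fun ε _ => h3 x ε]
      congr 1
      · rw [← sum_lastSign R i, Finset.sum_comm, Fintype.sum_bool, ← two_mul,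
          Fintype.sum_sum_type]
        simp only [Sum.elim_inl, Sum.elim_inr, Finset.sum_const_zero, zero_add]
        rw [Fintype.sum_prod_type]
        simp only [Fintype.sum_bool, sideType]
        congr 1
        refine Eq.trans (sum_rectangles fun x : Pos ws × Pos ws =>
          (if x.2.1.1 = i then lastSign x.2 else 0) + if x.1.1.1 = i then lastSign x.1 else 0) ?_
        exact Finset.sum_congr rfl fun a _ => Finset.sum_congr rfl fun b _ => by rw [add_comm]
      · simp
    rw [h1]
    by_cases hi : ws (i, true) = []
    · have hi' : ws (i, false) = [] := by rw [hinv, hi]; rfl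
      rw [lastCount_eq_zero R hi, lastCount_eq_zero R hi', ← hd i hi]
      rw [Finset.sum_eq_single (⟨i, hi⟩ : A)]
      · simp
      · intro a _ ha
        exact if_neg fun h => ha (Subtype.ext h)
      · simp
    · rw [← hdeg i hi, Finset.sum_eq_zero]
      · push_cast
        ring
      · intro a _
        refine if_neg ?_
        rintro rfl
        exact hi a.2
  refine ⟨ribbonSurface ρ τ hτ, ribbonMap hτ e Q hQ,
    rationallyBounds_ribbonMap hQ hn (flip_ne hside) tgt pot δ htgt hpot hδ,
    fun c => ⟨chi_ribbonSurface_nonpos hside hpc hsec hreach hρ c, not_isClosedComponent _ _ _ c⟩, ?_⟩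
  -- With `t` triangles and `r` rectangles in one copy and `a` annuli, there are `2 * t + 2 * r + a`
  -- polygons and `3 * t + 2 * r + a` glued edges; the difference is `-t`.
  rw [chiMinus_ribbonSurface hside hpc hsec hreach hρ]
  have h1 : Nat.card {h // side h = true} = Nat.card (TileSides R T ⊕ A) := by
    symm
    refine Nat.card_congr (Equiv.ofBijective (Sum.elim (fun s => ⟨.inl (s, true), rfl⟩)
      fun a => ⟨.inr (a, true), rfl⟩) ⟨?_, ?_⟩)
    · rintro (s | s) (s' | s') h
      · exact congrArg Sum.inl (congrArg Prod.fst (Sum.inl.inj (congrArg Subtype.val h)))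
      · exact absurd (congrArg Subtype.val h) Sum.inl_ne_inr
      · exact absurd (congrArg Subtype.val h) Sum.inr_ne_inl
      · exact congrArg Sum.inr (congrArg Prod.fst (Sum.inr.inj (congrArg Subtype.val h)))
    · rintro ⟨⟨s, ε⟩ | ⟨a, ε⟩, h⟩
      · obtain rfl : ε = true := h
        exact ⟨.inl s, rfl⟩
      · obtain rfl : ε = true := h
        exact ⟨.inr a, rfl⟩
  have h2 : Nat.card (Triangles T) = ∑ a, ∑ b, ∑ c, T a b c := by
    simp [Triangles, Fintype.sum_prod_type]
  have h3 : (∑ a, ∑ b, ∑ c, (T a b c : ℤ)) = Nat.card (Triangles T) := by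
    rw [h2]
    push_cast
    rfl
  rw [h1, h3]
  simp only [P, Nat.card_sum, Nat.card_prod, Nat.card_eq_fintype_card (α := Bool), Fintype.card_bool,
    Nat.card_eq_fintype_card (α := Fin 3), Fintype.card_fin]
  push_cast
  ring

end Assembly

/-! ### Extremal surfaces -/

section Extremal

variable {ι : Type v} {F : Type u} [Group F]

/-- A solution of the linear program for a sum whose `scl` it computes has minimal cost. -/
theorem IsSolution.cost_eq (b : FreeGroupBasis ι F) {κ : Type} [Fintype κ] [DecidableEq κ]
    {ws : κ × Bool → Word ι} {γ : κ → F} {m : Multiset (κ × Bool)} {r : ℚ} {N : ℕ}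
    {R : Pos ws → Pos ws → ℚ} {T : Pos ws → Pos ws → Pos ws → ℚ}
    (hinv : ∀ i, ws (i, false) = FreeGroup.invRev (ws (i, true)))
    (hγ : ∀ i, IsConj (γ i) (evalWord b (ws (i, true))))
    (hb : ∃ K, Bounds K (m.map (signed γ))) (h : HasScl (m.map (signed γ)) r) (hN : 0 < N)
    (hs : IsSolution ws (fun i => N * net m i) (N * r) R T) :
    ∑ a, ∑ b, ∑ c, T a b c = 4 * (N * r) := by
  refine le_antisymm hs.cost ?_
  have hN' : (N : ℚ) ≠ 0 := by positivity
  have hconj : ∀ i ∈ m, IsConj (signed γ i) (evalWord b (ws i)) := fun i _ => by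
    have := isConj_signed hγ i
    rw [← evalWord_signed b hinv] at this
    exact this
  -- The same tiling is a solution with its exact cost in place of `N * r`, and a solution bounds
  -- scl from above. Therefore its cost cannot be smaller than the optimum.
  have h1 : IsSolution ws (fun i => N * net m i) ((∑ a, ∑ b, ∑ c, T a b c) / 4) R T :=
    { hs with cost := by linarith }
  have h2 := h1.smul (q := (N : ℚ)⁻¹) (by positivity)
  simp only [inv_mul_cancel_left₀ hN'] at h2
  obtain ⟨K, hK⟩ := hb
  have h3 := h2.sclLE b hinv m (fun i _ => rfl)
    ⟨K, by simpa using Bounds.map_conj (m' := 0) hconj (by simpa using hK)⟩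
  have h4 : r ≤ (N : ℚ)⁻¹ * ((∑ a, ∑ b, ∑ c, T a b c) / 4) := by
    exact_mod_cast h.le (h3.map_conj fun i hi => (hconj i hi).symm)
  rw [inv_mul_eq_div, le_div_iff₀ (by positivity)] at h4
  linarith

/-- Rational chains in free groups bound extremal surfaces. -/
theorem exists_isExtremal (b : FreeGroupBasis ι F) {m : ℕ} (g : Fin m → F) (q : Fin m → ℚ)
    (h : ratChain g q ∈ B1 F) : ∃ (S : PolygonalSurface) (f : SurfaceMap S F), IsExtremal f g q h := by
  classical
  choose w hw using evalWord_surjective b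
  obtain ⟨N₀, ms, hN₀, hnet, hb, hscl⟩ := exists_multiset_of_chain b g q h
  obtain ⟨Y, hY⟩ := exists_hasScl_family b fun i => w (g i)
  simp only [hw] at hY
  obtain ⟨y, -, -, hr, R, T, hs⟩ := hY ms hb
  revert hr hs
  generalize ∑ i, y i * net ms i = r
  intro hr hs
  obtain ⟨N, hN, R', T', hRT, hs'⟩ := hs.exists_nat
  have hinv : ∀ i, signedWords (fun i => w (g i)) (i, false) =
      FreeGroup.invRev (signedWords (fun i => w (g i)) (i, true)) := fun i => by simp [signedWords]
  have hconj : ∀ i, IsConj (g i) (evalWord b (signedWords (fun i => w (g i)) (i, true))) := fun i => by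
    have := isConj_evalWord_cyclicReduce b (w (g i))
    rw [hw] at this
    simpa [signedWords] using this
  have hcost := hs'.cost_eq b hinv hconj hb hr hN
  -- The factor `N₀` turns the chain into a sum, `N` clears the denominators of the optimal
  -- solution, and 2 counts the copies of the tiles.
  have hn : 0 < 2 * N * N₀ := by positivity
  obtain ⟨S, f, hf, hc, hχ⟩ := exists_surface_of_isTiling b hRT hinv (fun i => (hconj i).symm)
    (q := q) hn (fun i => 2 * N * ((ms.count (i, true) : ℤ) - ms.count (i, false)))
    (fun i _ => by
      have := hnet i
      rw [net] at this
      push_cast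
      rw [this]
      ring)
    (fun i hi => by
      have := hs'.degree i hi
      rw [lastCount_natCast, lastCount_natCast] at this
      rw [this, hnet]
      push_cast
      ring)
  refine ⟨S, f, _, hf, fun c => ⟨fun h1 => ?_, (hc c).2⟩, ?_⟩
  · have h2 := (hc c).1
    rw [PolygonalSurface.IsDiskComponent] at h1
    omega
  -- Here `-χ⁻ = 4 * N * r` and scl of the chain is `r / N₀`, so division by twice the degree `2 * N
  -- * N₀` gives equality.
  · have h1 : (N₀ : ℝ) * scl (toB1H (ratChain g q) h) = r := hscl r hr
    have h2 : (S.chiMinus : ℚ) = - (4 * (N * r)) := by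
      rw [hχ, ← hcost]
      push_cast
      rfl
    have h3 : (S.chiMinus : ℝ) = - (4 * (N * r)) := by exact_mod_cast congrArg (Rat.cast (K := ℝ)) h2
    have h4 : (0 : ℝ) < N := by exact_mod_cast hN
    have h5 : (0 : ℝ) < N₀ := by exact_mod_cast hN₀
    rw [h3, ← h1]
    push_cast
    field_simp
    norm_num

/-- Elements of the commutator subgroup of a free group bound extremal surfaces. -/
theorem exists_isExtremal_of_mem_commutator (b : FreeGroupBasis ι F) {g : F} (hg : g ∈ commutator F) :
    ∃ (h : ratChain ![g] ![1] ∈ B1 F) (S : PolygonalSurface) (f : SurfaceMap S F),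
      IsExtremal f ![g] ![1] h := by
  have h : ratChain ![g] ![1] ∈ B1 F := by simpa [ratChain] using single_mem_B1 hg
  exact ⟨h, exists_isExtremal b _ _ h⟩

end Extremal

/-! ### Primitive recursive integer arithmetic -/

section IntPrimrec

theorem encode_natCast_int (n : ℕ) : Encodable.encode (n : ℤ) = 2 * n := rfl

theorem encode_negSucc (n : ℕ) : Encodable.encode (Int.negSucc n) = 2 * n + 1 := rfl

/-- Nonnegative integers have the even codes and negative ones the odd codes, so parity and halving
recover the absolute value. Together with `primrec_toNat_neg` and `primrec_natCast_sub` this writes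
integers as differences of natural numbers, to which sums and products are then reduced. -/
theorem primrec_toNat : Primrec Int.toNat := by
  refine (Primrec.ite (c := fun z : ℤ => Encodable.encode z % 2 = 0)
    (Primrec.eq.comp (Primrec.nat_mod.comp Primrec.encode (Primrec.const 2)) (Primrec.const 0))
    (Primrec.nat_div.comp Primrec.encode (Primrec.const 2)) (Primrec.const 0)).of_eq fun z => ?_
  rcases z with n | n
  · have := encode_natCast_int n
    rw [Int.ofNat_eq_natCast, this]
    simp
  · rw [encode_negSucc, if_neg (by omega)]
    rfl

theorem primrec_toNat_neg : Primrec fun z : ℤ => (-z).toNat := by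
  refine (Primrec.ite (c := fun z : ℤ => Encodable.encode z % 2 = 0)
    (Primrec.eq.comp (Primrec.nat_mod.comp Primrec.encode (Primrec.const 2)) (Primrec.const 0))
    (Primrec.const 0)
    (Primrec.succ.comp (Primrec.nat_div.comp Primrec.encode (Primrec.const 2)))).of_eq fun z => ?_
  rcases z with n | n
  · rw [Int.ofNat_eq_natCast, encode_natCast_int, if_pos (by omega)]
    omega
  · rw [encode_negSucc, if_neg (by omega)]
    omega

theorem primrec_natCast_sub : Primrec₂ fun a b : ℕ => (a : ℤ) - b := by
  refine (Primrec.ite (c := fun p : ℕ × ℕ => p.2 ≤ p.1)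
    (Primrec.nat_le.comp Primrec.snd Primrec.fst)
    ((Primrec.ofNat ℤ).comp (Primrec.nat_double.comp (Primrec.nat_sub.comp Primrec.fst Primrec.snd)))
    ((Primrec.ofNat ℤ).comp (Primrec.nat_double_succ.comp (Primrec.pred.comp
      (Primrec.nat_sub.comp Primrec.snd Primrec.fst))))).of_eq fun p => ?_
  obtain ⟨a, b⟩ := p
  dsimp only
  split_ifs with h
  · rw [← encode_natCast_int, Denumerable.ofNat_encode]
    omega
  · rw [← encode_negSucc, Denumerable.ofNat_encode, Nat.pred_eq_sub_one]
    omega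

theorem primrec_int_add : Primrec₂ ((· + ·) : ℤ → ℤ → ℤ) := by
  refine (primrec_natCast_sub.comp
    (Primrec.nat_add.comp (primrec_toNat.comp Primrec.fst) (primrec_toNat.comp Primrec.snd))
    (Primrec.nat_add.comp (primrec_toNat_neg.comp Primrec.fst)
      (primrec_toNat_neg.comp Primrec.snd))).of_eq fun p => ?_
  dsimp only
  omega

theorem primrec_int_neg : Primrec (Neg.neg : ℤ → ℤ) := by
  refine (primrec_natCast_sub.comp primrec_toNat_neg primrec_toNat).of_eq fun z => ?_
  omega

theorem primrec_int_sub : Primrec₂ ((· - ·) : ℤ → ℤ → ℤ) :=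
  (primrec_int_add.comp Primrec.fst (primrec_int_neg.comp Primrec.snd)).of_eq fun p => by
    dsimp only
    omega

theorem primrec_int_mul : Primrec₂ ((· * ·) : ℤ → ℤ → ℤ) := by
  refine (primrec_natCast_sub.comp
    (Primrec.nat_add.comp
      (Primrec.nat_mul.comp (primrec_toNat.comp Primrec.fst) (primrec_toNat.comp Primrec.snd))
      (Primrec.nat_mul.comp (primrec_toNat_neg.comp Primrec.fst)
        (primrec_toNat_neg.comp Primrec.snd)))
    (Primrec.nat_add.comp
      (Primrec.nat_mul.comp (primrec_toNat.comp Primrec.fst) (primrec_toNat_neg.comp Primrec.snd))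
      (Primrec.nat_mul.comp (primrec_toNat_neg.comp Primrec.fst)
        (primrec_toNat.comp Primrec.snd)))).of_eq fun p => ?_
  have h : ∀ z : ℤ, (z.toNat : ℤ) - ((-z).toNat : ℤ) = z := fun z => by omega
  conv_rhs => rw [← h p.1, ← h p.2]
  push_cast
  ring

theorem primrec_natCast_int : Primrec (Nat.cast : ℕ → ℤ) :=
  (primrec_natCast_sub.comp Primrec.id (Primrec.const 0)).of_eq fun n => by simp

theorem primrecPred_int_pos : PrimrecPred fun z : ℤ => 0 < z :=
  (Primrec.nat_lt.comp (Primrec.const 0) primrec_toNat).of_eq fun z => by omega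

theorem primrecPred_int_neg : PrimrecPred fun z : ℤ => z < 0 :=
  (Primrec.nat_lt.comp (Primrec.const 0) primrec_toNat_neg).of_eq fun z => by omega

end IntPrimrec

/-! ### Primitive recursive filtering and summation of lists -/

section ListPrimrec

variable {α β σ : Type*} [Primcodable α] [Primcodable β] [Primcodable σ]

theorem primrec_list_filter {f : α → List β} {p : α → β → Bool} (hf : Primrec f) (hp : Primrec₂ p) :
    Primrec fun a => (f a).filter (p a) := by
  refine (Primrec.list_flatMap hf (g := fun a b => if p a b then [b] else [])
    (Primrec.ite (c := fun x : α × β => p x.1 x.2 = true) (Primrec.eq.comp hp (Primrec.const true))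
      (Primrec.list_cons.comp Primrec.snd (Primrec.const [])) (Primrec.const []))).of_eq fun a => ?_
  induction f a with
  | nil => rfl
  | cons b l ih =>
    rw [List.flatMap_cons, ih, List.filter_cons]
    split_ifs <;> rfl

theorem primrec_list_sum {f : α → List β} {g : α → β → ℤ} (hf : Primrec f) (hg : Primrec₂ g) :
    Primrec fun a => ((f a).map (g a)).sum := by
  refine (Primrec.list_foldr hf (Primrec.const (0 : ℤ)) (h := fun a x => g a x.1 + x.2)
    (primrec_int_add.comp (hg.comp Primrec.fst (Primrec.fst.comp Primrec.snd))
      (Primrec.snd.comp Primrec.snd))).of_eq fun a => ?_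
  rw [List.sum_eq_foldr, List.foldr_map]

end ListPrimrec

/-! ### Primitive recursiveness of the elimination -/

section Elimination

variable {V : Type} [Primcodable V] [DecidableEq V]

theorem primrec_coef : Primrec₂ (Row.coef (V := V)) :=
  primrec_list_sum (f := fun x : V × Row V => x.2) (g := fun x e => if e.1 = x.1 then e.2 else 0)
    Primrec.snd (Primrec.ite (Primrec.eq.comp (Primrec.fst.comp Primrec.snd)
      (Primrec.fst.comp Primrec.fst)) (Primrec.snd.comp Primrec.snd) (Primrec.const 0))

omit [DecidableEq V] in
theorem primrec_scale : Primrec₂ (Row.scale (V := V)) :=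
  Primrec.list_map (f := fun x : ℤ × Row V => x.2) (g := fun x e => (e.1, x.1 * e.2)) Primrec.snd
    (Primrec.pair (Primrec.fst.comp Primrec.snd)
      (primrec_int_mul.comp (Primrec.fst.comp Primrec.fst) (Primrec.snd.comp Primrec.snd)))

theorem primrec_elimVar : Primrec₂ (elimVar (V := V)) := by
  have hz : Primrec fun x : V × List (Row V) => x.2.filter fun r => r.coef x.1 = 0 :=
    primrec_list_filter Primrec.snd
      (Primrec.eq.comp (primrec_coef.comp (Primrec.fst.comp Primrec.fst) Primrec.snd)
        (Primrec.const 0)).decide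
  have hpos : Primrec fun x : V × List (Row V) => x.2.filter fun r => 0 < r.coef x.1 :=
    primrec_list_filter Primrec.snd
      (primrecPred_int_pos.comp (primrec_coef.comp (Primrec.fst.comp Primrec.fst) Primrec.snd)).decide
  have hneg : Primrec fun x : V × List (Row V) => x.2.filter fun r => r.coef x.1 < 0 :=
    primrec_list_filter Primrec.snd
      (primrecPred_int_neg.comp (primrec_coef.comp (Primrec.fst.comp Primrec.fst) Primrec.snd)).decide
  have hv : Primrec fun y : ((V × List (Row V)) × Row V) × Row V => y.1.1.1 :=
    Primrec.fst.comp (Primrec.fst.comp Primrec.fst)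
  have hr : Primrec fun y : ((V × List (Row V)) × Row V) × Row V => y.1.2 :=
    Primrec.snd.comp Primrec.fst
  exact Primrec.list_append.comp hz (Primrec.list_flatMap hpos (Primrec.list_map
    (hneg.comp Primrec.fst) (Primrec.list_append.comp
      (primrec_scale.comp (primrec_int_neg.comp (primrec_coef.comp hv Primrec.snd)) hr)
      (primrec_scale.comp (primrec_coef.comp hv hr) Primrec.snd))))

theorem primrec_elimVars : Primrec₂ (elimVars (V := V)) :=
  Primrec.list_foldl (f := fun x : List V × List (Row V) => x.1) (g := fun x => x.2)
    (h := fun _ y => elimVar y.2 y.1) Primrec.fst Primrec.snd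
    (primrec_elimVar.comp (Primrec.snd.comp Primrec.snd) (Primrec.fst.comp Primrec.snd))

theorem primrec_lowerBounds {s : V} {t : ℕ → V} (ht : Primrec t) : Primrec₂ (lowerBounds s t) := by
  refine Primrec.list_cons.comp (Primrec.list_map (Primrec.list_range.comp Primrec.fst)
    (Primrec.const (0, 0))) (Primrec.list_map (primrec_list_filter Primrec.snd
      (primrecPred_int_pos.comp (primrec_coef.comp (Primrec.const s) Primrec.snd)).decide) ?_)
  refine Primrec.list_map (Primrec.list_range.comp (Primrec.fst.comp Primrec.fst)) ?_
  exact Primrec.pair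
    (primrec_int_neg.comp (primrec_coef.comp (ht.comp Primrec.snd) (Primrec.snd.comp Primrec.fst)))
    (Primrec.nat_sub.comp (primrec_toNat.comp
      (primrec_coef.comp (Primrec.const s) (Primrec.snd.comp Primrec.fst))) (Primrec.const 1))

end Elimination

/-! ### Primitive recursiveness of cyclic reduction -/

section Reduction

variable {ι : Type} [Primcodable ι]

theorem primrec_flipLetter : Primrec (flipLetter : ι × Bool → ι × Bool) :=
  Primrec.pair Primrec.fst (Primrec.not.comp Primrec.snd)

theorem primrec_invRev : Primrec (FreeGroup.invRev : Word ι → Word ι) :=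
  Primrec.list_reverse.comp (Primrec.list_map Primrec.id (Primrec.pair
    (Primrec.fst.comp Primrec.snd) (Primrec.not.comp (Primrec.snd.comp Primrec.snd))))

variable [DecidableEq ι]

theorem primrec_pushLetter : Primrec₂ (pushLetter : ι × Bool → Word ι → Word ι) :=
  Primrec.ite (Primrec.eq.comp (Primrec.list_head?.comp Primrec.snd)
      (Primrec.option_some.comp (primrec_flipLetter.comp Primrec.fst)))
    (Primrec.list_tail.comp Primrec.snd) Primrec.list_cons

theorem primrec_trim : Primrec (trim : Word ι → Word ι) := by
  have h1 : Primrec (List.getLast? : Word ι → Option (ι × Bool)) :=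
    (Primrec.list_head?.comp Primrec.list_reverse).of_eq fun w => by simp
  have h2 : Primrec (List.dropLast : Word ι → Word ι) :=
    (Primrec.list_reverse.comp (Primrec.list_tail.comp Primrec.list_reverse)).of_eq fun w => by simp
  exact Primrec.ite (Primrec.eq.comp h1
    (Primrec.option_map Primrec.list_head? (primrec_flipLetter.comp₂ Primrec₂.right)))
    (h2.comp Primrec.list_tail) Primrec.id

theorem primrec_cyclicReduce : Primrec (cyclicReduce : Word ι → Word ι) :=
  Primrec.nat_iterate Primrec.list_length
    (Primrec.list_foldr (h := fun _ x => pushLetter x.1 x.2) Primrec.id (Primrec.const [])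
      (primrec_pushLetter.comp (Primrec.fst.comp Primrec.snd) (Primrec.snd.comp Primrec.snd)))
    (primrec_trim.comp₂ Primrec₂.right)

end Reduction

/-! ### Primitive recursiveness of the linear program and of the whole algorithm -/

section ProgramPrimrec

set_option synthInstance.maxSize 1000 in
instance : Primcodable LPVar := inferInstance

variable {α β σ : Type*} [Primcodable α] [Primcodable β] [Primcodable σ]

theorem primrec_codeWord : Primrec₂ codeWord := by
  have h : Primrec fun x : List Entry × ℕ × Bool => (x.1.map Prod.snd).getD x.2.1 [] :=
    (Primrec.list_getD []).comp
      (Primrec.list_map Primrec.fst (Primrec.snd.comp Primrec.snd)) (Primrec.fst.comp Primrec.snd)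
  exact Primrec.ite (Primrec.eq.comp (Primrec.snd.comp Primrec.snd) (Primrec.const true)) h
    (primrec_invRev.comp h)

theorem primrec_allPos : Primrec allPos := by
  refine Primrec.list_flatMap (Primrec.list_range.comp Primrec.list_length)
    (Primrec.list_flatMap (Primrec.const [true, false]) (Primrec.list_map ?_ ?_))
  · exact Primrec.list_range.comp (Primrec.list_length.comp (primrec_codeWord.comp
      (Primrec.fst.comp Primrec.fst) (Primrec.pair (Primrec.snd.comp Primrec.fst) Primrec.snd)))
  · exact Primrec.pair (Primrec.pair (Primrec.snd.comp (Primrec.fst.comp Primrec.fst))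
      (Primrec.snd.comp Primrec.fst)) Primrec.snd

theorem primrec_codeLetter : Primrec₂ codeLetter :=
  (Primrec.list_getD _).comp (primrec_codeWord.comp Primrec.fst (Primrec.fst.comp Primrec.snd))
    (Primrec.snd.comp Primrec.snd)

theorem primrec_codeNext : Primrec₂ codeNext :=
  Primrec.pair (Primrec.fst.comp Primrec.snd) (Primrec.nat_mod.comp
    (Primrec.succ.comp (Primrec.snd.comp Primrec.snd))
    (Primrec.list_length.comp (primrec_codeWord.comp Primrec.fst (Primrec.fst.comp Primrec.snd))))

theorem primrec_allPairs : Primrec allPairs :=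
  Primrec.list_flatMap primrec_allPos (Primrec.list_map (primrec_allPos.comp Primrec.fst)
    (Primrec.pair (Primrec.snd.comp Primrec.fst) Primrec.snd))

theorem primrec_allTriples : Primrec allTriples :=
  Primrec.list_flatMap primrec_allPos (Primrec.list_map (primrec_allPairs.comp Primrec.fst)
    (Primrec.pair (Primrec.snd.comp Primrec.fst) Primrec.snd))

theorem primrec_triangleVar :
    Primrec fun x : PosCode × PosCode × PosCode => (.inl (.inl x) : LPVar) :=
  Primrec.sumInl.comp Primrec.sumInl

theorem primrec_rectangleVar : Primrec fun x : PosCode × PosCode => (.inl (.inr x) : LPVar) :=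
  Primrec.sumInl.comp Primrec.sumInr

theorem primrec_triangleRow : Primrec triangleRow :=
  Primrec.list_cons.comp (Primrec.pair primrec_triangleVar (Primrec.const 1)) (Primrec.const [])

theorem primrec_rectangleRow : Primrec₂ rectangleRow :=
  Primrec.list_cons.comp (Primrec.pair (primrec_rectangleVar.comp Primrec.snd) Primrec.fst)
    (Primrec.const [])

theorem primrec_sideSign {P : Type*} [Primcodable P] [DecidableEq P] {f g h k : α → P}
    (hf : Primrec f) (hg : Primrec g) (hh : Primrec h) (hk : Primrec k) :
    Primrec fun a => sideSign ℤ (f a) (g a) (h a) (k a) :=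
  primrec_int_sub.comp
    (Primrec.ite ((Primrec.eq.comp hh hf).and (Primrec.eq.comp hk hg)) (Primrec.const 1)
      (Primrec.const 0))
    (Primrec.ite ((Primrec.eq.comp hh hg).and (Primrec.eq.comp hk hf)) (Primrec.const 1)
      (Primrec.const 0))

theorem primrec_balanceRow : Primrec₂ balanceRow := by
  refine Primrec.list_append.comp
    (Primrec.list_map (primrec_allTriples.comp Primrec.fst)
      (Primrec.pair (primrec_triangleVar.comp Primrec.snd) ?_))
    (Primrec.list_map (primrec_allPairs.comp Primrec.fst)
      (Primrec.pair (primrec_rectangleVar.comp Primrec.snd) ?_))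
  · have hu : Primrec fun z : (List Entry × PosCode × PosCode) × PosCode × PosCode × PosCode =>
        z.1.2.1 := Primrec.fst.comp (Primrec.snd.comp Primrec.fst)
    have hv : Primrec fun z : (List Entry × PosCode × PosCode) × PosCode × PosCode × PosCode =>
        z.1.2.2 := Primrec.snd.comp (Primrec.snd.comp Primrec.fst)
    have h1 : Primrec fun z : (List Entry × PosCode × PosCode) × PosCode × PosCode × PosCode =>
        z.2.1 := Primrec.fst.comp Primrec.snd
    have h2 : Primrec fun z : (List Entry × PosCode × PosCode) × PosCode × PosCode × PosCode =>
        z.2.2.1 := Primrec.fst.comp (Primrec.snd.comp Primrec.snd)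
    have h3 : Primrec fun z : (List Entry × PosCode × PosCode) × PosCode × PosCode × PosCode =>
        z.2.2.2 := Primrec.snd.comp (Primrec.snd.comp Primrec.snd)
    exact primrec_int_add.comp (primrec_int_add.comp (primrec_sideSign hu hv h1 h2)
      (primrec_sideSign hu hv h2 h3)) (primrec_sideSign hu hv h3 h1)
  · have hE : Primrec fun z : (List Entry × PosCode × PosCode) × PosCode × PosCode =>
        z.1.1 := Primrec.fst.comp Primrec.fst
    have hu : Primrec fun z : (List Entry × PosCode × PosCode) × PosCode × PosCode =>
        z.1.2.1 := Primrec.fst.comp (Primrec.snd.comp Primrec.fst)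
    have hv : Primrec fun z : (List Entry × PosCode × PosCode) × PosCode × PosCode =>
        z.1.2.2 := Primrec.snd.comp (Primrec.snd.comp Primrec.fst)
    have h1 : Primrec fun z : (List Entry × PosCode × PosCode) × PosCode × PosCode =>
        z.2.1 := Primrec.fst.comp Primrec.snd
    have h2 : Primrec fun z : (List Entry × PosCode × PosCode) × PosCode × PosCode =>
        z.2.2 := Primrec.snd.comp Primrec.snd
    exact primrec_int_add.comp (primrec_sideSign hu hv (primrec_codeNext.comp hE h2) h1)
      (primrec_sideSign hu hv (primrec_codeNext.comp hE h1) h2)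

theorem primrec_sideRow {f : α → List Entry} {g : α → ℤ} {h : α → PosCode} (hf : Primrec f)
    (hg : Primrec g) (hh : Primrec h) : Primrec fun a => sideRow (f a) (g a) (h a) :=
  Primrec.list_append.comp
    (Primrec.list_map (primrec_allPos.comp hf) (Primrec.pair (primrec_rectangleVar.comp
      (Primrec.pair (hh.comp Primrec.fst) Primrec.snd)) (hg.comp Primrec.fst)))
    (Primrec.list_map (primrec_allPos.comp hf) (Primrec.pair (primrec_rectangleVar.comp
      (Primrec.pair Primrec.snd (hh.comp Primrec.fst))) (hg.comp Primrec.fst)))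

theorem primrec_getD_map {σ : Type*} [Primcodable σ] {f : Entry → σ} (hf : Primrec f) (d : σ) :
    Primrec₂ fun (E : List Entry) (i : ℕ) => (E.map f).getD i d :=
  (Primrec.list_getD d).comp (Primrec.list_map Primrec.fst (hf.comp Primrec.snd)) Primrec.snd

theorem primrec_degreeRow : Primrec₂ degreeRow := by
  have hc : Primrec fun e : Entry => e.1.2 := Primrec.snd.comp Primrec.fst
  have h1 := primrec_getD_map (primrec_natCast_int.comp (Primrec.succ.comp (Primrec.snd.comp hc))) 0
  have h2 := primrec_getD_map (Primrec.fst.comp (Primrec.fst (α := ℕ × Frac) (β := Word ℕ))) 0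
  have h3 := primrec_getD_map (Primrec.fst.comp hc) 0
  have hlast : ∀ ε : Bool, Primrec fun x : List Entry × ℕ =>
      (((x.2, ε), (codeWord x.1 (x.2, ε)).length - 1) : PosCode) := fun ε => by
    have hi : Primrec fun x : List Entry × ℕ => (x.2, ε) :=
      Primrec.pair Primrec.snd (Primrec.const ε)
    exact Primrec.pair hi (Primrec.nat_sub.comp
      (Primrec.list_length.comp (primrec_codeWord.comp Primrec.fst hi)) (Primrec.const 1))
  exact Primrec.list_append.comp (primrec_sideRow Primrec.fst h1 (hlast true))
    (Primrec.list_append.comp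
      (primrec_sideRow Primrec.fst (primrec_int_neg.comp h1) (hlast false))
      (Primrec.list_cons.comp (Primrec.pair (Primrec.sumInr.comp (Primrec.option_some.comp h2))
        (primrec_int_neg.comp h3)) (Primrec.const [])))

theorem primrec_costRow : Primrec costRow :=
  Primrec.list_cons.comp (Primrec.const ((.inr none, 4) : LPVar × ℤ)) (Primrec.list_map primrec_allTriples
    (Primrec.pair (primrec_triangleVar.comp Primrec.snd) (Primrec.const (-1))))

theorem primrec_tilingRows : Primrec tilingRows := by
  refine Primrec.list_append.comp
    (Primrec.list_map primrec_allTriples (primrec_triangleRow.comp Primrec.snd))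
    (Primrec.list_append.comp (Primrec.list_map primrec_allPairs
      (primrec_rectangleRow.comp (Primrec.const 1) Primrec.snd))
    (Primrec.list_append.comp (Primrec.list_map (primrec_list_filter primrec_allPairs ?_)
      (primrec_rectangleRow.comp (Primrec.const (-1)) Primrec.snd))
    (Primrec.list_append.comp (Primrec.list_map primrec_allPairs primrec_balanceRow)
    (Primrec.list_append.comp (Primrec.list_flatMap (primrec_list_filter
      (Primrec.list_range.comp Primrec.list_length) ?_) (Primrec.list_cons.comp primrec_degreeRow
        (Primrec.list_cons.comp (primrec_scale.comp (Primrec.const (-1)) primrec_degreeRow)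
          (Primrec.const []))))
      (Primrec.list_cons.comp primrec_costRow (Primrec.const []))))))
  · exact (Primrec.eq.comp
      (primrec_codeLetter.comp Primrec.fst (Primrec.snd.comp Primrec.snd))
      (primrec_flipLetter.comp
        (primrec_codeLetter.comp Primrec.fst (Primrec.fst.comp Primrec.snd)))).not.decide
  · exact (Primrec.eq.comp (primrec_codeWord.comp Primrec.fst
      (Primrec.pair Primrec.snd (Primrec.const true))) (Primrec.const [])).not.decide

theorem primrec_tilingVars : Primrec tilingVars :=
  Primrec.list_append.comp
    (Primrec.list_map primrec_allTriples (primrec_triangleVar.comp Primrec.snd))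
    (Primrec.list_map primrec_allPairs (primrec_rectangleVar.comp Primrec.snd))

theorem primrec_tilingBounds : Primrec₂ tilingBounds :=
  (primrec_lowerBounds (V := LPVar) (Primrec.sumInr.comp Primrec.option_some)).comp Primrec.fst
    (primrec_elimVars.comp (primrec_tilingVars.comp Primrec.snd)
      (primrec_tilingRows.comp Primrec.snd))

theorem primrec_flatEntries {ι : Type} [Primcodable ι] :
    Primrec (flatEntries : List (FormalChain ι) → _) :=
  Primrec.list_flatMap (Primrec.list_range.comp Primrec.list_length)
    (Primrec.list_map ((Primrec.list_getD []).comp Primrec.fst Primrec.snd)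
      (Primrec.pair (Primrec.pair (Primrec.snd.comp Primrec.fst) (Primrec.fst.comp Primrec.snd))
        (Primrec.snd.comp Primrec.snd)))

/-- The algorithm is computable. -/
theorem computable_sclAlgorithm : Computable sclAlgorithm := by
  have h1 : Primrec fun C : List (FormalChain ℕ) =>
      (flatEntries C).map fun x => (x.1, cyclicReduce x.2) :=
    Primrec.list_map (g := fun _ x => (x.1, cyclicReduce x.2)) primrec_flatEntries
      (Primrec.pair (Primrec.fst.comp Primrec.snd)
        (primrec_cyclicReduce.comp (Primrec.snd.comp Primrec.snd)))
  have h2 : Primrec fun C : List (FormalChain ℕ) => tilingBounds C.length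
      ((flatEntries C).map fun x => (x.1, cyclicReduce x.2)) :=
    primrec_tilingBounds.comp Primrec.list_length h1
  exact h2.to_comp

end ProgramPrimrec

end StableCommutatorLength

theorem mainTheorem1 :
    (∀ (F : Type u) [Group F] [IsFreeGroup F],
      -- scl is a pseudo-norm on B₁ / H with the defining values on sums of group elements
      ((∃ p : Seminorm ℝ (B1H F), ∀ c, p c = scl c) ∧
        ∀ (l : List F) (hl : sumChain l ∈ B1 F),
          Tendsto (fun n : ℕ => (clSum (l.map (· ^ n)) : ℝ≥0∞) / (n : ℝ≥0∞)) atTop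
            (𝓝 (ENNReal.ofReal (scl (toB1H (sumChain l) hl))))) ∧
      -- scl is rational on elements of the commutator subgroup
      (∀ g ∈ commutator F, ∃ (hg : Finsupp.single g (1 : ℝ) ∈ B1 F) (q : ℚ),
        scl (toB1H (Finsupp.single g 1) hg) = q ∧
        Tendsto (fun n : ℕ => (cl (g ^ n) : ℝ≥0∞) / (n : ℝ≥0∞)) atTop
          (𝓝 (ENNReal.ofReal (q : ℝ)))) ∧
      -- extremal surfaces exist, for elements and for rational chains
      (∀ g ∈ commutator F, ∃ h : ratChain ![g] ![1] ∈ B1 F,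
        ∃ (S : PolygonalSurface) (f : SurfaceMap S F), IsExtremal f ![g] ![1] h) ∧
      (∀ (m : ℕ) (g : Fin m → F) (q : Fin m → ℚ) (h : ratChain g q ∈ B1 F),
        ∃ (S : PolygonalSurface) (f : SurfaceMap S F), IsExtremal f g q h) ∧
      -- scl is piecewise rational linear, and its unit ball is a rational polyhedron
      (∀ L : Submodule ℝ (B1H F), IsFiniteRationalSubspace L →
        IsPiecewiseRationalLinear (fun x : L => scl (x : B1H F)) ∧
        IsRationalPolyhedron {x : L | scl (x : B1H F) ≤ 1})) ∧
    -- one algorithm computes scl on all finite-dimensional rational subspaces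
    (∃ A : List (FormalChain ℕ) → List (List Frac), Computable A ∧
      ∀ (F : Type u) [Group F] (ι : Type v) (b : FreeGroupBasis ι F) (name : ι → ℕ)
        (C : List (FormalChain ι)) (hC : ∀ j : Fin C.length, evalChain b (C.get j) ∈ B1 F),
        Set.InjOn name (letters C) →
          ComputesScl b C hC (A (C.map (FormalChain.relabel name)))) := by
  refine ⟨fun F _ _ => ?_, sclAlgorithm, computable_sclAlgorithm, fun F _ ι b name C hC hn =>
    sclAlgorithm_spec b name C hC (injOn_letters hn)⟩
  let b := IsFreeGroup.basis F
  exact ⟨⟨⟨sclSeminorm F, sclSeminorm_apply⟩, fun l hl => tendsto_scl_sumChain b hl⟩,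
    fun g hg => exists_rat_tendsto_cl b hg, fun g hg => exists_isExtremal_of_mem_commutator b hg,
    fun m g q h => exists_isExtremal b g q h,
    fun L hL => piecewise_of_isFiniteRationalSubspace b hL⟩
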